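/- Let $\mu$ be a nonzero finite Borel measure on $\mathbb R$, and let $N$ be a Poisson point measure on $[0,\infty)\times\mathbb R$ with intensity $dt\,\mu(da)$, whose atoms, ordered by time, are $(T_i,\Delta_i)_{i\ge1}$, $0<T_1<T_2<\cdots$; let $J_t=N([0,t]\times\mathbb R)$. Fix $T>0$ and let $c(t,a,x)$ and $g(t,x)$ be real functions of $t\in[0,T]$, $a,x\in\mathbb R$, such that * for each $a$, $(t,x)\mapsto c(t,a,x)$ is twice differentiable on $[0,T]\times\mathbb R$, with first and second derivatives bounded uniformly in $(t,a,x)$, and $a\mapsto c(t,a,x)$ is Borel measurable; * $x\mapsto g(t,x)$ is twice differentiable, with first and second derivatives bounded uniformly in $(t,x)$, and $(t,x)\mapsto g(t,x)$ is continuously differentiable on $[0,T]\times\mathbb R$; * $|c(t,a,x)|+|g(t,x)|\le K(1+|x|)$ for some constant $K$ and all $t\in[0,T]$, $a,x\in\mathbb R$. Put $q(t,a,x)=(\partial_tc+g\,\partial_xc)(t,a,x)+g(t,x)-g(t,x+c(t,a,x))$ and suppose that for some $\eta>0$ and all $(t,a,x)\in[0,T]\times\mathbb R\times\mathbb R$,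 $$|q(t,a,x)|\ge\eta,\qquad |1+\partial_xc(t,a,x)|\ge\eta .$$ Let $S_t=S_t^x$, $0\le t\le T$, be the solution of $$S_t=x+\sum_{i=1}^{J_t}c(T_i,\Delta_i,S_{T_i-})+\int_0^tg(r,S_r)\,dr ,$$ the equation being solved pathwise for all starting points $x\in\mathbb R$, and let $\partial_xS_t$ be the derivative of $S_t$ with respect to the starting point. For $0<u_1<\dots<u_n<T$ and $a\in\mathbb R^n$ let $s_t(u,a)$, $0\le t\le T$, be the solution of $$s_t=x+\sum_{i:\,u_i\le t}c(u_i,a_i,s_{u_i-})+\int_0^tg(r,s_r)\,dr ,$$ so that $S_t=s_t(T_1,\dots,T_n,\Delta_1,\dots,\Delta_n)$ almost surely on $\{J_t=n\}$. Fix $\alpha\in(0,\tfrac12)$, $t\in[0,T]$ and $n\ge4$. With $u_0=0$ and $u_{n+1}=t$, define for $i=1,\dots,n$ $$\pi_i(y)=(u_{i+1}-y)^\alpha(y-u_{i-1})^\alpha\mathbf 1_{[u_{i-1},u_{i+1}]}(y),$$ and, for functions $F,G$ of $u=(u_1,\dots,u_n)$ and for $U=(U_i)_{i\le n}$, $V=(V_i)_{i\le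 n}$, $$D_iF=\partial_{u_i}F,\qquad \langle U,V\rangle_\pi=\sum_{i=1}^n\pi_i(u_i)U_iV_i,\qquad \gamma_F=\frac1{\langle DF,DF\rangle_\pi},$$ $$LF=-\sum_{i=1}^n\bigl(\pi_i'(u_i)\,\partial_{u_i}F+\pi_i(u_i)\,\partial_{u_i}^2F\bigr),$$ $$H(F,G)=G\,\gamma_F\,LF-\gamma_F\langle DF,DG\rangle_\pi-G\,\langle DF,D\gamma_F\rangle_\pi .$$ On $\{J_t=n\}$ let $H_n=H_n(S_t,\partial_xS_t)$ be the value at $u=(T_1,\dots,T_n)$ of $H(F,G)$ for $F(u)=s_t(u,\Delta_1,\dots,\Delta_n)$ and $G(u)=\partial_xs_t(u,\Delta_1,\dots,\Delta_n)$, the $\Delta_i$ being held fixed. Then for every continuously differentiable $\phi:\mathbb R\to\mathbb R$ of linear growth, the random variables $\phi'(S_t)\,\partial_xS_t\,\mathbf 1_{\{J_t=n\}}$ and $\phi(S_t)\,H_n\,\mathbf 1_{\{J_t=n\}}$ are integrable and $$\mathbb E\bigl(\phi'(S_t)\,\partial_xS_t\,\mathbf 1_{\{J_t=n\}}\bigr)=\mathbb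 E\bigl(\phi(S_t)\,H_n\,\mathbf 1_{\{J_t=n\}}\bigr).$$ -/

import Mathlib

open MeasureTheory ProbabilityTheory Set

noncomputable section

namespace JumpDiffusion

/-! ### Coefficients -/

/-- The time-space strip `[0, T] × ℝ`. -/
def strip (T : ℝ) : Set (ℝ × ℝ) := Icc 0 T ×ˢ univ

/-- Regularity of the jump coefficient `c(t, a, x)` and of the drift `g(t, x)`, `0 ≤ t ≤ T`, with
one constant `K` for all the bounds.
* `(t, x) ↦ c(t, a, x)` is twice (Fréchet) differentiable, with first and second derivatives
  bounded uniformly in `(t, a, x)`, and `a ↦ c(t, a, x)` is Borel measurable;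
* `x ↦ g(t, x)` is twice differentiable with bounded first and second derivatives, and `g` is
  continuously differentiable in `(t, x)` (this is what makes the second order derivatives of the
  solution with respect to the jump times exist);
* both have linear growth in `x`, uniformly in `t` and `a`. -/
structure RegularCoefficients (T K : ℝ) (c : ℝ → ℝ → ℝ → ℝ) (g : ℝ → ℝ → ℝ) : Prop where
  measurable_c : ∀ t ∈ Icc 0 T, ∀ x, Measurable fun a => c t a x
  differentiable_c : ∀ a, DifferentiableOn ℝ (fun p : ℝ × ℝ => c p.1 a p.2) (strip T)
  differentiable_fderiv_c : ∀ a, DifferentiableOn ℝ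
    (fderivWithin ℝ (fun p : ℝ × ℝ => c p.1 a p.2) (strip T)) (strip T)
  bound_fderiv_c : ∀ a, ∀ z ∈ strip T,
    ‖fderivWithin ℝ (fun p : ℝ × ℝ => c p.1 a p.2) (strip T) z‖ ≤ K
  bound_fderiv_fderiv_c : ∀ a, ∀ z ∈ strip T,
    ‖fderivWithin ℝ (fderivWithin ℝ (fun p : ℝ × ℝ => c p.1 a p.2) (strip T)) (strip T) z‖ ≤ K
  contDiff_g : ContDiffOn ℝ 1 (fun p : ℝ × ℝ => g p.1 p.2) (strip T)
  differentiable_g : ∀ t ∈ Icc 0 T, Differentiable ℝ (g t)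
  differentiable_deriv_g : ∀ t ∈ Icc 0 T, Differentiable ℝ (deriv (g t))
  bound_deriv_g : ∀ t ∈ Icc 0 T, ∀ x, |deriv (g t) x| ≤ K
  bound_deriv_deriv_g : ∀ t ∈ Icc 0 T, ∀ x, |deriv (deriv (g t)) x| ≤ K
  linear_growth : ∀ t ∈ Icc 0 T, ∀ a x, |c t a x| + |g t x| ≤ K * (1 + |x|)

/-- `∂ₓ c(t, a, x)`. -/
def dxc (c : ℝ → ℝ → ℝ → ℝ) (t a x : ℝ) : ℝ := deriv (fun y => c t a y) x

/-- `∂ₜ c(t, a, x)`, the derivative in time on `[0, T]`. -/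
def dtc (T : ℝ) (c : ℝ → ℝ → ℝ → ℝ) (t a x : ℝ) : ℝ := derivWithin (fun r => c r a x) (Icc 0 T) t

/-- `q(t, a, x) = (∂ₜ c + g ∂ₓ c)(t, a, x) + g(t, x) - g(t, x + c(t, a, x))`. -/
def q (T : ℝ) (c : ℝ → ℝ → ℝ → ℝ) (g : ℝ → ℝ → ℝ) (t a x : ℝ) : ℝ :=
  dtc T c t a x + g t x * dxc c t a x + g t x - g t (x + c t a x)

/-! ### The equation with jumps -/

/-- The path `s` solves, on `[0, T]`, the equation with jump times `τ i` and marks `a i`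
`s_t = x + ∑_{τ_i ≤ t} c(τ_i, a_i, s_{τ_i -}) + ∫_0^t g(r, s_r) dr`. -/
structure IsJumpSolution {ι : Type*} (T : ℝ) (c : ℝ → ℝ → ℝ → ℝ) (g : ℝ → ℝ → ℝ) (x : ℝ)
    (τ a : ι → ℝ) (s : ℝ → ℝ) : Prop where
  intervalIntegrable : IntervalIntegrable (fun r => g r (s r)) volume 0 T
  eq : ∀ t ∈ Icc 0 T, s t = x + (∑ᶠ i ∈ {i | τ i ≤ t}, c (τ i) (a i) (Function.leftLim s (τ i)))
    + ∫ r in (0 : ℝ)..t, g r (s r)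

open Classical in
/-- The value `s_t(u, a)` at time `t` of the solution of the deterministic equation started at `x`
with jump times `u` and marks `a` (only used for `0 < u_1 < ⋯ < u_n < T`, where the solution exists
and is unique on `[0, T]`). -/
def detSol (T : ℝ) (c : ℝ → ℝ → ℝ → ℝ) (g : ℝ → ℝ → ℝ) {n : ℕ} (x : ℝ) (u a : Fin n → ℝ)
    (t : ℝ) : ℝ :=
  if h : ∃ s, IsJumpSolution T c g x u a s then h.choose t else 0

/-! ### Poisson point measures -/

section Poisson

variable {Ω : Type*}

/-- The point measure `N(B) = card {i : (T_i, Δ_i) ∈ B}`. -/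
def pointMeasure (τ Δ : ℕ → Ω → ℝ) (B : Set (ℝ × ℝ)) (ω : Ω) : ℕ∞ :=
  {i | (τ i ω, Δ i ω) ∈ B}.encard

/-- The counting process `J_t = N([0, t] × ℝ)`. -/
def counting (τ Δ : ℕ → Ω → ℝ) (t : ℝ) (ω : Ω) : ℕ∞ :=
  pointMeasure τ Δ (Icc 0 t ×ˢ univ) ω

/-- `N` is a Poisson point measure on `[0, ∞) × ℝ` with intensity `dt × μ(da)`, and its atoms,
listed in increasing order of time, are `(T_i, Δ_i)`. Indices start at `0`: `τ 0, τ 1, …` are the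
jump times `T_1 < T_2 < ⋯` and `Δ 0, Δ 1, …` are the corresponding marks. -/
structure IsPoissonPointMeasure [MeasurableSpace Ω] (P : Measure Ω) (μ : Measure ℝ)
    (τ Δ : ℕ → Ω → ℝ) : Prop where
  measurable_time : ∀ i, Measurable (τ i)
  measurable_mark : ∀ i, Measurable (Δ i)
  pos : ∀ᵐ ω ∂P, ∀ i, 0 < τ i ω
  strictMono : ∀ᵐ ω ∂P, StrictMono fun i => τ i ω
  poisson : ∀ B : Set (ℝ × ℝ), MeasurableSet B →
    ((volume.restrict (Ici (0 : ℝ))).prod μ) B < ⊤ →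
    ∀ k : ℕ, P {ω | pointMeasure τ Δ B ω = k} =
      poissonMeasure (((volume.restrict (Ici (0 : ℝ))).prod μ) B).toNNReal {k}
  indep : ∀ (m : ℕ) (B : Fin m → Set (ℝ × ℝ)), (∀ j, MeasurableSet (B j)) →
    Pairwise (fun j k => Disjoint (B j) (B k)) →
    iIndepFun (fun j => pointMeasure τ Δ (B j)) P

end Poisson

/-! ### Differential calculus with respect to the jump times

A functional is a function `F` of the jump times `u = (u_1, …, u_n)` (everything else being frozen).
-/

section Malliavin

variable {n : ℕ}

/-- `D_i F = ∂F / ∂u_i`. -/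
def D (i : Fin n) (F : (Fin n → ℝ) → ℝ) (u : Fin n → ℝ) : ℝ :=
  deriv (fun y => F (Function.update u i y)) (u i)

/-- `u_{i-1}`, with `u_0 = 0`. -/
def prevTime (u : Fin n → ℝ) (i : Fin n) : ℝ :=
  if (i : ℕ) = 0 then 0 else u ⟨i - 1, by omega⟩

/-- `u_{i+1}`, with `u_{n+1} = t`. -/
def nextTime (t : ℝ) (u : Fin n → ℝ) (i : Fin n) : ℝ :=
  if h : (i : ℕ) + 1 < n then u ⟨i + 1, h⟩ else t

/-- `π_i(y) = (u_{i+1} - y)^α (y - u_{i-1})^α 1_{[u_{i-1}, u_{i+1}]}(y)`. -/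
def weight (α t : ℝ) (i : Fin n) (u : Fin n → ℝ) (y : ℝ) : ℝ :=
  (Icc (prevTime u i) (nextTime t u i)).indicator
    (fun y => (nextTime t u i - y) ^ α * (y - prevTime u i) ^ α) y

/-- `⟨U, V⟩_π = ∑_i π_i(u_i) U_i V_i`. -/
def innerPi (α t : ℝ) (U V : Fin n → (Fin n → ℝ) → ℝ) (u : Fin n → ℝ) : ℝ :=
  ∑ i, weight α t i u (u i) * U i u * V i u

/-- `σ_F = ⟨DF, DF⟩_π = ∑_i π_i(u_i) |D_i F|²`. -/
def sigma (α t : ℝ) (F : (Fin n → ℝ) → ℝ) (u : Fin n → ℝ) : ℝ :=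
  innerPi α t (fun i => D i F) (fun i => D i F) u

/-- `γ_F = 1 / σ_F`. -/
def gamma (α t : ℝ) (F : (Fin n → ℝ) → ℝ) (u : Fin n → ℝ) : ℝ := (sigma α t F u)⁻¹

/-- `L F = - ∑_i (π_i' ∂_i F + π_i ∂_i² F)`: the conditional density of each jump time is constant
between its neighbours, so that its logarithmic derivative does not contribute. -/
def L (α t : ℝ) (F : (Fin n → ℝ) → ℝ) (u : Fin n → ℝ) : ℝ :=
  - ∑ i, (deriv (weight α t i u) (u i) * D i F u + weight α t i u (u i) * D i (D i F) u)

/-- `H(F, G) = G γ_F L F - γ_F ⟨DF, DG⟩_π - G ⟨DF, Dγ_F⟩_π`. -/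
def H (α t : ℝ) (F G : (Fin n → ℝ) → ℝ) (u : Fin n → ℝ) : ℝ :=
  G u * gamma α t F u * L α t F u
    - gamma α t F u * innerPi α t (fun i => D i F) (fun i => D i G) u
    - G u * innerPi α t (fun i => D i F) (fun i => D i (gamma α t F)) u

end Malliavin

/-- The weight `H_n = H_n(S_t, ∂ₓ S_t)` on `{J_t = n}`: the functionals are `u ↦ s_t(u, Δ)` and
`u ↦ ∂ₓ s_t(u, Δ)`, taken at `u = (T_1, …, T_n)`, with `Δ = (Δ_1, …, Δ_n)` frozen. -/
def malliavinWeight {Ω : Type*} (T : ℝ) (c : ℝ → ℝ → ℝ → ℝ) (g : ℝ → ℝ → ℝ) (α x t : ℝ)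
    (τ Δ : ℕ → Ω → ℝ) (n : ℕ) (ω : Ω) : ℝ :=
  H α t (fun u : Fin n → ℝ => detSol T c g x u (fun i => Δ i ω) t)
    (fun u : Fin n → ℝ => deriv (fun y => detSol T c g y u (fun i => Δ i ω) t) x)
    (fun i => τ i ω)

end JumpDiffusion

end

/-! Given that there are `n` jumps before `t`, the jump times are uniform on the simplex `0 < u_1 <
⋯ < u_n < t` and independent of the marks, which are i.i.d. (`map_marks_times`). With the marks
frozen, the claim becomes the divergence theorem on the simplex, where the density is constant. For
the field with components `φ(F) π_i D_iF G γ_F`, the identity `γ_F ⟨DF, DF⟩_π = 1` makes the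
divergence equal to `φ'(F) G - φ(F) H(F, G)` (`sum_ibpDeriv`). No boundary term remains because
`π_i` vanishes when `u_i` meets a neighbour (`setIntegral_ibpDeriv_slice`).

Two facts make this rigorous. First, `F` and `G` must be smooth in the jump times and `|D_iF|`
bounded below, uniformly in the marks. Let `Φ` be the flow of the drift from time `0`, and read
positions in the coordinate `w` with position `Φ u w`. There the path is constant between jumps, and
a jump at time `u` acts by `jumpMap`. Its derivative in `u` is `q` times a positive factor, and its
derivative in `w` is `1 + ∂ₓc` times a positive factor (`hasFDerivAt_jumpMap`). So `D_iF` is a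
single product: one `q`, then a factor `1 + ∂ₓc` for every later jump, and positive flow factors. No
sum can cancel, and the two nondegeneracy hypotheses bound the product below
(`exists_le_abs_D_straight`). Existence and uniqueness for the equation identify `detSol` and `S`
with this description (`jumpPath_spec`, `eq_flow_straight`).

Second, the divergence must be integrable. A derivative of a weight blows up like `gap^(α - 1)`, and
`γ_F` like the inverse of the sum of the weights. Any one index `j` gives `γ_F ≤ 1 / (ε² π_j)`.
Choosing `j` so that its two gaps avoid the singular one leaves a product of powers greater than
`-1` of three distinct gaps. This is integrable because all gaps but one form a linear coordinate
system (`mul_sum_gap_le`, `integrableOn_three_gaps`). The same freedom keeps `γ_F` bounded along a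
line on which only `u_i` moves, which is what makes the boundary terms vanish; having two gaps clear
of `i` and `i + 1` for every `i` is where `n ≥ 4` enters. -/

namespace JumpDiffusion

open Filter Topology

/-! ### The flow of the drift -/

/-- A drift defined for all times, with the regularity in space that the flow needs. -/
structure SmoothDrift (K : ℝ) (g : ℝ → ℝ → ℝ) : Prop where
  nonneg : 0 ≤ K
  continuous : Continuous fun p : ℝ × ℝ => g p.1 p.2
  differentiable : ∀ t, Differentiable ℝ (g t)
  continuous_deriv : Continuous fun p : ℝ × ℝ => deriv (g p.1) p.2
  differentiable_deriv : ∀ t, Differentiable ℝ (deriv (g t))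
  bound_deriv : ∀ t x, |deriv (g t) x| ≤ K
  bound_deriv_deriv : ∀ t x, |deriv (deriv (g t)) x| ≤ K
  growth : ∀ t x, |g t x| ≤ K * (1 + |x|)

/-- `Φ r w` is the value at time `r ∈ [0, T]` of the solution of `y' = g(r, y)` with `y 0 = w`. -/
structure IsFlow (T : ℝ) (g Φ : ℝ → ℝ → ℝ) : Prop where
  continuous : ∀ w, Continuous fun r => Φ r w
  initial : ∀ w, Φ 0 w = w
  hasDerivAt : ∀ w, ∀ r ∈ Icc 0 T, HasDerivAt (fun r => Φ r w) (g r (Φ r w)) r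

variable {T K : ℝ} {g Φ : ℝ → ℝ → ℝ}

theorem SmoothDrift.lipschitz (hg : SmoothDrift K g) (t x y : ℝ) :
    |g t x - g t y| ≤ K * |x - y| := by
  have := Convex.norm_image_sub_le_of_norm_deriv_le (f := g t) (s := univ) (C := K)
    (fun x _ => hg.differentiable t x) (fun x _ => hg.bound_deriv t x) convex_univ
    (mem_univ y) (mem_univ x)
  simpa [Real.norm_eq_abs] using this

theorem SmoothDrift.lipschitzWith (hg : SmoothDrift K g) (t : ℝ) :
    LipschitzWith K.toNNReal (g t) := by
  refine LipschitzWith.of_dist_le_mul fun x y => ?_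
  rw [Real.dist_eq, Real.dist_eq, Real.coe_toNNReal _ hg.nonneg]
  exact hg.lipschitz t x y

theorem abs_clamp_le {M x : ℝ} (hM : 0 ≤ M) : |max (-M) (min x M)| ≤ |x| := by
  rcases le_total x M with h | h <;> rcases le_total (-M) x with h' | h'
  · simp [h, h']
  · rw [min_eq_left h, max_eq_left h', abs_neg, abs_of_nonneg hM]
    exact le_trans (by linarith) (neg_le_abs x)
  · rw [min_eq_right h, max_eq_right (by linarith), abs_of_nonneg hM]
    exact h.trans (le_abs_self x)
  · rw [min_eq_right h, max_eq_right (by linarith), abs_of_nonneg hM]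
    exact h.trans (le_abs_self x)

theorem abs_clamp_le' {M x : ℝ} (hM : 0 ≤ M) : |max (-M) (min x M)| ≤ M := by
  rw [abs_le]
  exact ⟨le_max_left _ _, max_le (by linarith) (min_le_right _ _)⟩

theorem abs_clamp_sub_le {M x y : ℝ} :
    |max (-M) (min x M) - max (-M) (min y M)| ≤ |x - y| := by
  refine (abs_max_sub_max_le_max _ _ _ _).trans ?_
  rw [sub_self, abs_zero]
  refine max_le (abs_nonneg _) ((abs_min_sub_min_le_max _ _ _ _).trans ?_)
  simp

/-- Linear growth gives an a priori Gronwall bound `M` on `[0, T]`. Truncating the space variable at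
`M` makes the field bounded, so Picard–Lindelöf reaches time `T` in one step, and the same bound
shows that the truncation is never active. -/
theorem SmoothDrift.exists_solution (hg : SmoothDrift K g) (hT : 0 ≤ T) (w : ℝ) :
    ∃ f : ℝ → ℝ, Continuous f ∧ f 0 = w ∧ ∀ r ∈ Icc 0 T, HasDerivAt f (g r (f r)) r := by
  have hK := hg.nonneg
  obtain ⟨M, hM0, hM⟩ : ∃ M : ℝ, 0 ≤ M ∧ ∀ r ∈ Icc 0 T, gronwallBound |w| K K (r - 0) ≤ M := by
    refine ⟨gronwallBound |w| K K T, ?_, fun r hr => ?_⟩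
    · have := gronwallBound_mono (abs_nonneg w) hK hK hT
      rw [gronwallBound_x0] at this
      exact (abs_nonneg w).trans this
    · exact gronwallBound_mono (abs_nonneg w) hK hK (by simpa using hr.2)
  set h : ℝ → ℝ → ℝ := fun r x => g r (max (-M) (min x M)) with hh
  have hbound : ∀ r x, |h r x| ≤ K * (1 + M) := fun r x =>
    (hg.growth _ _).trans (by gcongr; exact abs_clamp_le' hM0)
  have hPL : IsPicardLindelof h (⟨0, le_refl 0, hT⟩ : Icc 0 T) w (K * (1 + M) * T).toNNReal 0
      (K * (1 + M)).toNNReal K.toNNReal := by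
    constructor
    · intro r _
      refine LipschitzWith.lipschitzOnWith (LipschitzWith.of_dist_le_mul fun x y => ?_)
      rw [Real.dist_eq, Real.dist_eq, Real.coe_toNNReal _ hK]
      exact (hg.lipschitz _ _ _).trans (mul_le_mul_of_nonneg_left abs_clamp_sub_le hK)
    · intro x _
      exact (hg.continuous.comp (by fun_prop : Continuous fun r : ℝ =>
        (r, max (-M) (min x M)))).continuousOn
    · intro r _ x _
      rw [Real.coe_toNNReal _ (by positivity)]
      exact hbound r x
    · rw [Real.coe_toNNReal _ (by positivity), Real.coe_toNNReal _ (by positivity)]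
      simp [hT]
  obtain ⟨α, hα0, hα⟩ := hPL.exists_eq_forall_mem_Icc_hasDerivWithinAt₀
  simp only at hα0
  have hαc : ContinuousOn α (Icc 0 T) := fun r hr => (hα r hr).continuousWithinAt
  have hα' : ∀ r ∈ Ico 0 T, HasDerivWithinAt α (h r (α r)) (Ici r) r := fun r hr =>
    ((hα r (Ico_subset_Icc_self hr)).mono (Icc_subset_Icc_left hr.1)).mono_of_mem_nhdsWithin
      (Icc_mem_nhdsGE hr.2)
  have hαM : ∀ r ∈ Icc 0 T, |α r| ≤ M := by
    intro r hr
    refine (norm_le_gronwallBound_of_norm_deriv_right_le (δ := |w|) (K := K) (ε := K) hαc hα'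
      (by simp [hα0]) ?_ r hr).trans (hM r hr)
    intro x _
    refine (hg.growth _ _).trans ?_
    rw [Real.norm_eq_abs]
    have : |max (-M) (min (α x) M)| ≤ |α x| := abs_clamp_le hM0
    nlinarith
  have hαg : ∀ r ∈ Icc 0 T, h r (α r) = g r (α r) := by
    intro r hr
    have := abs_le.1 (hαM r hr)
    simp only [hh]
    rw [min_eq_left this.2, max_eq_right this.1]
  -- The solution is rewritten as a primitive of a function continuous on all of `ℝ`, so that its
  -- derivative at `0` and at `T` is two-sided.
  set β : ℝ → ℝ := fun r => α (projIcc 0 T hT r)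
  have hβ : Continuous β := by
    have := (continuousOn_iff_continuous_domRestrict.1 hαc).comp (continuous_projIcc (h := hT))
    exact this
  have hβα : ∀ r ∈ Icc 0 T, β r = α r := fun r hr => by simp [β, projIcc_of_mem hT hr]
  have hgβ : Continuous fun r => g r (β r) := hg.continuous.comp (continuous_id.prodMk hβ)
  have hder : ∀ r, HasDerivAt (fun r => w + ∫ ρ in (0 : ℝ)..r, g ρ (β ρ)) (g r (β r)) r := fun r =>
    (hgβ.integral_hasStrictDerivAt 0 r).hasDerivAt.const_add w
  have heq : ∀ r ∈ Icc 0 T, w + ∫ ρ in (0 : ℝ)..r, g ρ (β ρ) = β r := by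
    intro r hr
    have h1 : ∫ ρ in (0 : ℝ)..r, g ρ (β ρ) = β r - β 0 := by
      refine intervalIntegral.integral_eq_sub_of_hasDeriv_right_of_le hr.1
        hβ.continuousOn (fun x hx => ?_) (hgβ.intervalIntegrable _ _)
      have hx' : x ∈ Ico 0 T := ⟨hx.1.le, hx.2.trans_le hr.2⟩
      have := hα' x hx'
      rw [hαg x (Ico_subset_Icc_self hx'), ← hβα x (Ico_subset_Icc_self hx')] at this
      refine ((this.mono Ioi_subset_Ici_self).congr_of_eventuallyEq ?_ ?_)
      · filter_upwards [Ioo_mem_nhdsGT hx'.2] with y hy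
        exact hβα y ⟨hx'.1.trans hy.1.le, hy.2.le⟩
      · exact hβα x (Ico_subset_Icc_self hx')
    rw [h1, hβα 0 ⟨le_refl 0, hT⟩, hα0]
    ring
  refine ⟨fun r => w + ∫ ρ in (0 : ℝ)..r, g ρ (β ρ), ?_, by simp, fun r hr => ?_⟩
  · exact continuous_iff_continuousAt.2 fun r => (hder r).continuousAt
  · have := hder r
    simp only [heq r hr]
    exact this

theorem SmoothDrift.exists_isFlow (hg : SmoothDrift K g) (hT : 0 ≤ T) :
    ∃ Φ, IsFlow T g Φ := by
  choose f hf using fun w => hg.exists_solution hT w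
  exact ⟨fun r w => f w r, fun w => (hf w).1, fun w => (hf w).2.1, fun w => (hf w).2.2⟩

theorem IsFlow.eqOn (hΦ : IsFlow T g Φ) (hg : SmoothDrift K g) {f : ℝ → ℝ} {p r w : ℝ} (hp : 0 ≤ p)
    (hr : r ≤ T) (hf : ContinuousOn f (Icc p r))
    (hf' : ∀ ρ ∈ Ico p r, HasDerivWithinAt f (g ρ (f ρ)) (Ici ρ) ρ) (h0 : f p = Φ p w) :
    EqOn f (fun ρ => Φ ρ w) (Icc p r) :=
  ODE_solution_unique (v := g) (K := K.toNNReal) hg.lipschitzWith hf hf'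
    (hΦ.continuous w).continuousOn
    (fun ρ hρ => (hΦ.hasDerivAt w ρ ⟨hp.trans hρ.1, hρ.2.le.trans hr⟩).hasDerivWithinAt) h0

theorem IsFlow.integral_eq (hΦ : IsFlow T g Φ) (hg : SmoothDrift K g) (w : ℝ) {p r : ℝ}
    (hp : p ∈ Icc 0 T) (hr : r ∈ Icc 0 T) :
    ∫ ρ in p..r, g ρ (Φ ρ w) = Φ r w - Φ p w := by
  have hc : Continuous fun ρ => g ρ (Φ ρ w) :=
    hg.continuous.comp (continuous_id.prodMk (hΦ.continuous w))
  refine intervalIntegral.integral_eq_sub_of_hasDerivAt (fun x hx => hΦ.hasDerivAt w x ?_)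
    (hc.intervalIntegrable _ _)
  have := uIcc_subset_Icc hp hr hx
  exact this

theorem dslope_bound (hg : SmoothDrift K g) (t x y : ℝ) : |dslope (g t) x y| ≤ K := by
  rcases eq_or_ne y x with rfl | h
  · rw [dslope_same]; exact hg.bound_deriv t _
  · rw [dslope_of_ne _ h, slope_def_field, abs_div, div_le_iff₀ (abs_pos.2 (sub_ne_zero.2 h))]
    exact hg.lipschitz t _ _

/-- Writing the increment of `g` through `dslope` turns the difference of two trajectories into a
solution of a scalar linear equation with coefficient bounded by `K`. -/
theorem IsFlow.hasDerivAt_sub (hΦ : IsFlow T g Φ) (w w' : ℝ) {r : ℝ} (hr : r ∈ Icc 0 T) :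
    HasDerivAt (fun r => Φ r w' - Φ r w)
      ((Φ r w' - Φ r w) * dslope (g r) (Φ r w) (Φ r w')) r := by
  have := (hΦ.hasDerivAt w' r hr).sub (hΦ.hasDerivAt w r hr)
  rwa [← sub_smul_dslope (g r) (Φ r w) (Φ r w'), smul_eq_mul] at this

/-- Gronwall in both directions: the squared distance times `exp (2 K r)` increases, and times `exp
(-2 K r)` decreases. The lower estimate is what later gives injectivity, surjectivity and a
Lipschitz inverse. -/
theorem IsFlow.sq_sub_le (hΦ : IsFlow T g Φ) (hg : SmoothDrift K g) (w w' : ℝ) {r : ℝ}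
    (hr : r ∈ Icc 0 T) :
    (w' - w) ^ 2 ≤ (Φ r w' - Φ r w) ^ 2 * Real.exp (2 * K * r) ∧
      (Φ r w' - Φ r w) ^ 2 ≤ (w' - w) ^ 2 * Real.exp (2 * K * r) := by
  set δ : ℝ → ℝ := fun r => Φ r w' - Φ r w with hδ
  have hδc : Continuous δ := (hΦ.continuous w').sub (hΦ.continuous w)
  have h0 : δ 0 = w' - w := by simp [hδ, hΦ.initial]
  have hder : ∀ s : ℝ, ∀ ρ ∈ Icc 0 T, HasDerivAt (fun ρ => δ ρ ^ 2 * Real.exp (s * ρ))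
      (δ ρ ^ 2 * (2 * dslope (g ρ) (Φ ρ w) (Φ ρ w') + s) * Real.exp (s * ρ)) ρ := by
    intro s ρ hρ
    have h1 := (hΦ.hasDerivAt_sub w w' hρ).pow 2
    have h2 : HasDerivAt (fun ρ => Real.exp (s * ρ)) (Real.exp (s * ρ) * s) ρ := by
      simpa using ((hasDerivAt_id ρ).const_mul s).exp
    refine (h1.mul h2).congr_deriv ?_
    simp only [hδ, Pi.pow_apply]
    push_cast
    ring
  have hb := fun ρ => abs_le.1 (dslope_bound hg ρ (Φ ρ w) (Φ ρ w'))
  constructor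
  · have hm : MonotoneOn (fun ρ => δ ρ ^ 2 * Real.exp (2 * K * ρ)) (Icc 0 T) := by
      refine monotoneOn_of_deriv_nonneg (convex_Icc _ _) (by fun_prop) (fun ρ hρ => ?_)
        (fun ρ hρ => ?_)
      · exact (hder _ ρ (interior_subset hρ)).differentiableAt.differentiableWithinAt
      · rw [(hder _ ρ (interior_subset hρ)).deriv]
        have := (hb ρ).1
        have h3 : 0 ≤ 2 * dslope (g ρ) (Φ ρ w) (Φ ρ w') + 2 * K := by linarith
        positivity
    have := hm ⟨le_refl 0, hr.1.trans hr.2⟩ hr hr.1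
    simpa [h0] using this
  · have hm : AntitoneOn (fun ρ => δ ρ ^ 2 * Real.exp (-(2 * K) * ρ)) (Icc 0 T) := by
      refine antitoneOn_of_deriv_nonpos (convex_Icc _ _) (by fun_prop) (fun ρ hρ => ?_)
        (fun ρ hρ => ?_)
      · exact (hder _ ρ (interior_subset hρ)).differentiableAt.differentiableWithinAt
      · rw [(hder _ ρ (interior_subset hρ)).deriv]
        have := (hb ρ).2
        have h3 : 2 * dslope (g ρ) (Φ ρ w) (Φ ρ w') + -(2 * K) ≤ 0 := by linarith
        exact mul_nonpos_of_nonpos_of_nonneg (mul_nonpos_of_nonneg_of_nonpos (sq_nonneg _) h3)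
          (Real.exp_pos _).le
    have := hm ⟨le_refl 0, hr.1.trans hr.2⟩ hr hr.1
    simp only [h0, mul_zero, Real.exp_zero, mul_one] at this
    have h4 : Real.exp (-(2 * K) * r) * Real.exp (2 * K * r) = 1 := by
      rw [← Real.exp_add]; simp
    calc (Φ r w' - Φ r w) ^ 2 = δ r ^ 2 * Real.exp (-(2 * K) * r) * Real.exp (2 * K * r) := by
          rw [mul_assoc, h4, mul_one]
      _ ≤ _ := by gcongr

theorem abs_le_mul_exp_of_sq_le {a b c : ℝ} (h : a ^ 2 ≤ b ^ 2 * Real.exp (2 * c)) :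
    |a| ≤ |b| * Real.exp c := by
  have : a ^ 2 ≤ (|b| * Real.exp c) ^ 2 := by
    rw [mul_pow, sq_abs, ← Real.exp_nat_mul]; simpa using h
  exact (abs_le_abs_of_sq_le_sq this).trans (by rw [abs_of_nonneg]; positivity)
where abs_le_abs_of_sq_le_sq {a b : ℝ} (h : a ^ 2 ≤ b ^ 2) : |a| ≤ |b| := sq_le_sq.1 h

theorem IsFlow.abs_sub_le (hΦ : IsFlow T g Φ) (hg : SmoothDrift K g) (w w' : ℝ) {r : ℝ}
    (hr : r ∈ Icc 0 T) : |Φ r w' - Φ r w| ≤ |w' - w| * Real.exp (K * T) := by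
  have := (hΦ.sq_sub_le hg w w' hr).2
  rw [mul_assoc] at this
  refine (abs_le_mul_exp_of_sq_le this).trans ?_
  have := hg.nonneg
  gcongr
  exact hr.2

theorem IsFlow.abs_sub_ge (hΦ : IsFlow T g Φ) (hg : SmoothDrift K g) (w w' : ℝ) {r : ℝ}
    (hr : r ∈ Icc 0 T) : |w' - w| ≤ |Φ r w' - Φ r w| * Real.exp (K * T) := by
  have := (hΦ.sq_sub_le hg w w' hr).1
  rw [mul_assoc] at this
  refine (abs_le_mul_exp_of_sq_le this).trans ?_
  have := hg.nonneg
  gcongr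
  exact hr.2

theorem IsFlow.injective (hΦ : IsFlow T g Φ) (hg : SmoothDrift K g) {r : ℝ}
    (hr : r ∈ Icc 0 T) : Function.Injective (Φ r) := by
  intro w w' h
  have := hΦ.abs_sub_ge hg w w' hr
  rw [h, sub_self, abs_zero, zero_mul] at this
  have := abs_nonpos_iff.1 this
  linarith

theorem IsFlow.continuous_right (hΦ : IsFlow T g Φ) (hg : SmoothDrift K g) {r : ℝ}
    (hr : r ∈ Icc 0 T) : Continuous (Φ r) := by
  refine LipschitzWith.continuous (K := (Real.exp (K * T)).toNNReal)
    (LipschitzWith.of_dist_le_mul fun x y => ?_)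
  rw [Real.dist_eq, Real.dist_eq, Real.coe_toNNReal _ (Real.exp_pos _).le, mul_comm]
  exact hΦ.abs_sub_le hg _ _ hr

/-- Distinct trajectories never meet, so the coefficient of the linear equation is an honest
continuous quotient and the equation can be integrated explicitly. -/
theorem IsFlow.sub_eq (hΦ : IsFlow T g Φ) (hg : SmoothDrift K g) {w w' : ℝ} (hw : w' ≠ w) {r : ℝ}
    (hr : r ∈ Icc 0 T) :
    Φ r w' - Φ r w = (w' - w) * Real.exp (∫ ρ in (0 : ℝ)..r, dslope (g ρ) (Φ ρ w) (Φ ρ w')) ∧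
      ContinuousOn (fun ρ => dslope (g ρ) (Φ ρ w) (Φ ρ w')) (Icc 0 T) := by
  have hT : 0 ≤ T := hr.1.trans hr.2
  have hne : ∀ ρ ∈ Icc 0 T, Φ ρ w' ≠ Φ ρ w := fun ρ hρ h => hw (hΦ.injective hg hρ h)
  have hcβ : ContinuousOn (fun ρ => dslope (g ρ) (Φ ρ w) (Φ ρ w')) (Icc 0 T) := by
    have hc1 := hΦ.continuous w
    have hc2 := hΦ.continuous w'
    have h3 : Continuous fun ρ => g ρ (Φ ρ w) :=
      hg.continuous.comp (continuous_id.prodMk hc1)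
    have h4 : Continuous fun ρ => g ρ (Φ ρ w') :=
      hg.continuous.comp (continuous_id.prodMk hc2)
    have h5 : ContinuousOn (fun ρ => (g ρ (Φ ρ w') - g ρ (Φ ρ w)) / (Φ ρ w' - Φ ρ w))
        (Icc 0 T) :=
      (h4.sub h3).continuousOn.div (hc2.sub hc1).continuousOn
        fun ρ hρ => sub_ne_zero.2 (hne ρ hρ)
    refine h5.congr fun ρ hρ => ?_
    simp only
    rw [dslope_of_ne _ (hne ρ hρ), slope_def_field]
  refine ⟨?_, hcβ⟩
  set β : ℝ → ℝ := fun ρ => dslope (g ρ) (Φ ρ w) (Φ ρ w') with hβ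
  set β' : ℝ → ℝ := fun ρ => β (projIcc 0 T hT ρ)
  have hβc : Continuous β' :=
    (continuousOn_iff_continuous_domRestrict.1 hcβ).comp (continuous_projIcc (h := hT))
  have hββ : ∀ ρ ∈ Icc 0 T, β' ρ = β ρ := fun ρ hρ => by simp [β', projIcc_of_mem hT hρ]
  have hB : ∀ ρ, HasDerivAt (fun r => ∫ ρ in (0 : ℝ)..r, β' ρ) (β' ρ) ρ := fun ρ =>
    (hβc.integral_hasStrictDerivAt 0 ρ).hasDerivAt
  have hBc : Continuous (fun r => ∫ ρ in (0 : ℝ)..r, β' ρ) :=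
    continuous_iff_continuousAt.2 fun r => (hB r).continuousAt
  -- Integrating factor: the difference times the exponential of minus the primitive has zero
  -- derivative.
  have hconst := constant_of_has_deriv_right_zero
    (f := fun r => (Φ r w' - Φ r w) * Real.exp (-∫ ρ in (0 : ℝ)..r, β' ρ)) (a := 0) (b := T)
    (((hΦ.continuous w').sub (hΦ.continuous w)).mul
      (Real.continuous_exp.comp hBc.neg)).continuousOn
    (fun ρ hρ => by
      have hρ' := Ico_subset_Icc_self hρ
      have := (hΦ.hasDerivAt_sub w w' hρ').mul (hB ρ).neg.exp
      refine (this.congr_deriv ?_).hasDerivWithinAt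
      rw [hββ ρ hρ']
      simp only [hβ]
      ring) r hr
  simp only [intervalIntegral.integral_same, neg_zero, Real.exp_zero, mul_one, hΦ.initial]
    at hconst
  have hInt : ∫ ρ in (0 : ℝ)..r, β ρ = ∫ ρ in (0 : ℝ)..r, β' ρ := by
    refine intervalIntegral.integral_congr fun ρ hρ => (hββ ρ ?_).symm
    rw [uIcc_of_le hr.1] at hρ
    exact ⟨hρ.1, hρ.2.trans hr.2⟩
  rw [hInt, ← hconst, mul_assoc, ← Real.exp_add]
  simp

/-- The derivative of the flow in its starting point. -/
noncomputable def flowDeriv (g Φ : ℝ → ℝ → ℝ) (r w : ℝ) : ℝ :=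
  Real.exp (∫ ρ in (0 : ℝ)..r, deriv (g ρ) (Φ ρ w))

/-- By `sub_eq` the difference quotient is exactly the exponential of an integral of slopes of `g`;
these are bounded by `K` and converge to `∂ₓg`, so dominated convergence applies. -/
theorem IsFlow.hasDerivAt_right (hΦ : IsFlow T g Φ) (hg : SmoothDrift K g) (w : ℝ) {r : ℝ}
    (hr : r ∈ Icc 0 T) : HasDerivAt (Φ r) (flowDeriv g Φ r w) w := by
  rw [hasDerivAt_iff_tendsto_slope]
  have hsub : ∀ ρ ∈ uIoc 0 r, ρ ∈ Icc 0 T := by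
    intro ρ hρ
    rw [uIoc_of_le hr.1] at hρ
    exact ⟨hρ.1.le, hρ.2.trans hr.2⟩
  have hlim : Tendsto (fun w' => ∫ ρ in (0 : ℝ)..r, dslope (g ρ) (Φ ρ w) (Φ ρ w')) (𝓝[≠] w)
      (𝓝 (∫ ρ in (0 : ℝ)..r, deriv (g ρ) (Φ ρ w))) := by
    refine intervalIntegral.tendsto_integral_filter_of_dominated_convergence (fun _ => K) ?_ ?_
      intervalIntegrable_const ?_
    · filter_upwards [self_mem_nhdsWithin] with w' hw'
      exact ((hΦ.sub_eq hg hw' hr).2.mono hsub).aestronglyMeasurable measurableSet_uIoc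
    · exact Eventually.of_forall fun w' => Eventually.of_forall fun ρ _ =>
        dslope_bound hg _ _ _
    · refine Eventually.of_forall fun ρ hρ => ?_
      have h1 : ContinuousAt (dslope (g ρ) (Φ ρ w)) (Φ ρ w) :=
        continuousAt_dslope_same.2 (hg.differentiable ρ _)
      have h2 : Tendsto (Φ ρ) (𝓝[≠] w) (𝓝 (Φ ρ w)) :=
        (hΦ.continuous_right hg (hsub ρ hρ)).continuousAt.tendsto.mono_left nhdsWithin_le_nhds
      have := h1.tendsto.comp h2
      rwa [dslope_same] at this
  refine ((Real.continuous_exp.tendsto _).comp hlim).congr' ?_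
  filter_upwards [self_mem_nhdsWithin] with w' hw'
  rw [slope_def_field, (hΦ.sub_eq hg hw' hr).1]
  exact (mul_div_cancel_left₀ _ (sub_ne_zero.2 hw')).symm

end JumpDiffusion

namespace JumpDiffusion

open Filter Topology

/-! ### Joint differentiability of the flow and of its inverse -/

/-- The linear form `(h, k) ↦ p h + q k` on `ℝ × ℝ`. -/
noncomputable def planeForm (p q : ℝ) : ℝ × ℝ →L[ℝ] ℝ :=
  p • ContinuousLinearMap.fst ℝ ℝ ℝ + q • ContinuousLinearMap.snd ℝ ℝ ℝ

@[simp]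
theorem planeForm_apply (p q : ℝ) (v : ℝ × ℝ) : planeForm p q v = p * v.1 + q * v.2 := by
  simp [planeForm]

theorem norm_planeForm_le (p q : ℝ) : ‖planeForm p q‖ ≤ |p| + |q| := by
  refine ContinuousLinearMap.opNorm_le_bound _ (by positivity) fun v => ?_
  rw [planeForm_apply, Real.norm_eq_abs]
  calc |p * v.1 + q * v.2| ≤ |p| * |v.1| + |q| * |v.2| := by
        rw [← abs_mul, ← abs_mul]; exact abs_add_le _ _
    _ ≤ |p| * ‖v‖ + |q| * ‖v‖ := by
        gcongr
        · exact norm_fst_le v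
        · exact norm_snd_le v
    _ = _ := by ring

/-- Only one partial derivative has to be continuous; the other is needed just at the point. This
matters for `flowDeriv`, whose derivative in `w` involves `∂ₓ²g`, which is bounded but not assumed
continuous. -/
theorem hasFDerivAt_planeForm_of_partial {f f₁ : ℝ → ℝ → ℝ} {f₂ u w : ℝ}
    (h₁ : ∀ᶠ p : ℝ × ℝ in 𝓝 (u, w), HasDerivAt (fun s => f s p.2) (f₁ p.1 p.2) p.1)
    (hc : ContinuousAt (fun p : ℝ × ℝ => f₁ p.1 p.2) (u, w)) (h₂ : HasDerivAt (f u) f₂ w) :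
    HasFDerivAt (fun p : ℝ × ℝ => f p.1 p.2) (planeForm (f₁ u w) f₂) (u, w) := by
  rw [hasFDerivAt_iff_isLittleO, Asymptotics.isLittleO_iff]
  intro ε hε
  have hc' := Metric.continuousAt_iff.1 hc (ε / 2) (by positivity)
  obtain ⟨δ₁, hδ₁, hc'⟩ := hc'
  obtain ⟨δ₂, hδ₂, h₁⟩ := Metric.eventually_nhds_iff.1 h₁
  have h₂' := (Asymptotics.isLittleO_iff.1 (hasDerivAt_iff_isLittleO.1 h₂))
    (show 0 < ε / 2 by positivity)
  obtain ⟨δ₃, hδ₃, h₂'⟩ := Metric.eventually_nhds_iff.1 h₂'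
  refine Metric.eventually_nhds_iff.2 ⟨min δ₁ (min δ₂ δ₃), by positivity, fun y hy => ?_⟩
  obtain ⟨s, z⟩ := y
  rw [Prod.dist_eq, max_lt_iff] at hy
  simp only [lt_min_iff] at hy
  have hmem : ∀ v ∈ Metric.ball u (min δ₁ δ₂), dist (v, z) (u, w) < δ₁ ∧
      dist (v, z) (u, w) < δ₂ := by
    intro v hv
    rw [Metric.mem_ball, lt_min_iff] at hv
    rw [Prod.dist_eq]
    exact ⟨max_lt hv.1 hy.2.1, max_lt hv.2 hy.2.2.1⟩
  -- Mean value inequality in the first variable, after subtracting the linear part, at the moving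
  -- height `z`; the increment in the second variable is then taken on the fixed line through `u`.
  have e1 := Convex.norm_image_sub_le_of_norm_hasDerivWithin_le
    (f := fun v => f v z - f₁ u w * v) (f' := fun v => f₁ v z - f₁ u w) (C := ε / 2)
    (s := Metric.ball u (min δ₁ δ₂)) (x := u) (y := s)
    (fun v hv => ((h₁ (hmem v hv).2).sub
      (by simpa using (hasDerivAt_id v).const_mul (f₁ u w))).hasDerivWithinAt)
    (fun v hv => (hc' (hmem v hv).1).le) (convex_ball _ _)
    (Metric.mem_ball_self (by positivity)) (by
      rw [Metric.mem_ball, lt_min_iff]; exact ⟨hy.1.1, hy.1.2.1⟩)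
  have e2 := h₂' hy.2.2.2
  simp only [Real.norm_eq_abs, smul_eq_mul] at e1 e2 ⊢
  rw [planeForm_apply]
  have n1 : |s - u| ≤ ‖((s, z) : ℝ × ℝ) - (u, w)‖ := norm_fst_le (((s, z) : ℝ × ℝ) - (u, w))
  have n2 : |z - w| ≤ ‖((s, z) : ℝ × ℝ) - (u, w)‖ := norm_snd_le (((s, z) : ℝ × ℝ) - (u, w))
  have e : f s z - f u w - (f₁ u w * ((s, z) - (u, w) : ℝ × ℝ).1
      + f₂ * ((s, z) - (u, w) : ℝ × ℝ).2)
      = (f s z - f₁ u w * s - (f u z - f₁ u w * u)) + (f u z - f u w - (z - w) * f₂) := by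
    simp only [Prod.mk_sub_mk]; ring
  rw [e]
  refine (abs_add_le _ _).trans ((add_le_add e1 e2).trans ?_)
  nlinarith

variable {T K : ℝ} {g Φ : ℝ → ℝ → ℝ}

theorem IsFlow.continuousOn (hΦ : IsFlow T g Φ) (hg : SmoothDrift K g) :
    ContinuousOn (fun p : ℝ × ℝ => Φ p.1 p.2) (Icc 0 T ×ˢ univ) := by
  rintro ⟨u, w⟩ _
  have hlim : Tendsto (fun p : ℝ × ℝ => |p.2 - w| * Real.exp (K * T) + |Φ p.1 w - Φ u w|)
      (𝓝[Icc 0 T ×ˢ univ] (u, w)) (𝓝 0) := by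
    have : Continuous fun p : ℝ × ℝ => |p.2 - w| * Real.exp (K * T) + |Φ p.1 w - Φ u w| := by
      have h1 : Continuous fun p : ℝ × ℝ => Φ p.1 w := (hΦ.continuous w).comp continuous_fst
      exact ((continuous_snd.sub continuous_const).abs.mul continuous_const).add
        (h1.sub continuous_const).abs
    have := this.tendsto (u, w)
    simp only [sub_self, abs_zero, zero_mul, add_zero] at this
    exact this.mono_left nhdsWithin_le_nhds
  refine tendsto_iff_norm_sub_tendsto_zero.2 (squeeze_zero' (Eventually.of_forall fun _ =>
    norm_nonneg _) ?_ hlim)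
  filter_upwards [self_mem_nhdsWithin] with p hp
  have h1 := hΦ.abs_sub_le hg w p.2 hp.1
  calc ‖Φ p.1 p.2 - Φ u w‖ = |(Φ p.1 p.2 - Φ p.1 w) + (Φ p.1 w - Φ u w)| := by
        rw [Real.norm_eq_abs]; congr 1; ring
    _ ≤ _ := (abs_add_le _ _).trans (by gcongr)

theorem strip_mem_nhds {u : ℝ} (hu : u ∈ Ioo 0 T) (w : ℝ) :
    (Ioo 0 T ×ˢ univ : Set (ℝ × ℝ)) ∈ 𝓝 (u, w) :=
  (isOpen_Ioo.prod isOpen_univ).mem_nhds ⟨hu, trivial⟩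

theorem Icc_prod_mem_nhds {u : ℝ} (hu : u ∈ Ioo 0 T) (w : ℝ) :
    (Icc 0 T ×ˢ univ : Set (ℝ × ℝ)) ∈ 𝓝 (u, w) :=
  mem_of_superset (strip_mem_nhds hu w) (prod_mono Ioo_subset_Icc_self subset_rfl)

theorem IsFlow.continuousAt (hΦ : IsFlow T g Φ) (hg : SmoothDrift K g) {u : ℝ} (hu : u ∈ Ioo 0 T)
    (w : ℝ) : ContinuousAt (fun p : ℝ × ℝ => Φ p.1 p.2) (u, w) :=
  (hΦ.continuousOn hg).continuousAt (Icc_prod_mem_nhds hu w)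

theorem IsFlow.hasFDerivAt (hΦ : IsFlow T g Φ) (hg : SmoothDrift K g) {u : ℝ} (hu : u ∈ Ioo 0 T)
    (w : ℝ) : HasFDerivAt (fun p : ℝ × ℝ => Φ p.1 p.2)
      (planeForm (g u (Φ u w)) (flowDeriv g Φ u w)) (u, w) := by
  refine hasFDerivAt_planeForm_of_partial (f₁ := fun u w => g u (Φ u w)) ?_ ?_
    (hΦ.hasDerivAt_right hg w (Ioo_subset_Icc_self hu))
  · filter_upwards [strip_mem_nhds hu w] with p hp
    exact hΦ.hasDerivAt p.2 p.1 (Ioo_subset_Icc_self hp.1)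
  · have h := (hg.continuous.continuousAt (x := (u, Φ u w)))
    exact ContinuousAt.comp (g := fun p : ℝ × ℝ => g p.1 p.2)
      (f := fun p : ℝ × ℝ => (p.1, Φ p.1 p.2)) h
      (continuousAt_fst.prodMk (hΦ.continuousAt hg hu w))

theorem IsFlow.continuous_deriv_comp (hΦ : IsFlow T g Φ) (hg : SmoothDrift K g) (w : ℝ) :
    Continuous fun ρ => deriv (g ρ) (Φ ρ w) :=
  hg.continuous_deriv.comp (continuous_id.prodMk (hΦ.continuous w))

theorem IsFlow.abs_integral_deriv_le (hg : SmoothDrift K g) (w : ℝ) {r : ℝ} (hr : r ∈ Icc 0 T) :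
    |∫ ρ in (0 : ℝ)..r, deriv (g ρ) (Φ ρ w)| ≤ K * T := by
  have := intervalIntegral.norm_integral_le_of_norm_le_const (a := 0) (b := r) (C := K)
    (f := fun ρ => deriv (g ρ) (Φ ρ w)) (fun ρ _ => hg.bound_deriv _ _)
  refine this.trans ?_
  rw [sub_zero, abs_of_nonneg hr.1]
  exact mul_le_mul_of_nonneg_left hr.2 hg.nonneg

theorem flowDeriv_le (hg : SmoothDrift K g) (w : ℝ) {r : ℝ} (hr : r ∈ Icc 0 T) :
    flowDeriv g Φ r w ≤ Real.exp (K * T) :=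
  Real.exp_le_exp.2 (abs_le.1 (IsFlow.abs_integral_deriv_le hg w hr)).2

theorem le_flowDeriv (hg : SmoothDrift K g) (w : ℝ) {r : ℝ} (hr : r ∈ Icc 0 T) :
    Real.exp (-(K * T)) ≤ flowDeriv g Φ r w :=
  Real.exp_le_exp.2 (abs_le.1 (IsFlow.abs_integral_deriv_le hg w hr)).1

theorem flowDeriv_pos (r w : ℝ) : 0 < flowDeriv g Φ r w := Real.exp_pos _

theorem IsFlow.continuous_flowDeriv_left (hΦ : IsFlow T g Φ) (hg : SmoothDrift K g) (w : ℝ) :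
    Continuous fun r => flowDeriv g Φ r w :=
  Real.continuous_exp.comp (continuous_iff_continuousAt.2 fun r =>
    ((hΦ.continuous_deriv_comp hg w).integral_hasStrictDerivAt 0 r).hasDerivAt.continuousAt)

/-- Differentiation under the integral sign inside the exponential. The second derivative of `g` is
a derivative of a jointly continuous function, hence jointly measurable, and it is bounded; this
suffices for domination. -/
theorem IsFlow.hasDerivAt_flowDeriv_right (hΦ : IsFlow T g Φ) (hg : SmoothDrift K g) (w : ℝ)
    {r : ℝ} (hr : r ∈ Icc 0 T) :
    HasDerivAt (flowDeriv g Φ r) (flowDeriv g Φ r w *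
      ∫ ρ in (0 : ℝ)..r, deriv (deriv (g ρ)) (Φ ρ w) * flowDeriv g Φ ρ w) w := by
  have hsub : ∀ ρ ∈ uIoc 0 r, ρ ∈ Icc 0 T := by
    intro ρ hρ
    rw [uIoc_of_le hr.1] at hρ
    exact ⟨hρ.1.le, hρ.2.trans hr.2⟩
  have hK := hg.nonneg
  have hmeas : Measurable fun ρ => deriv (deriv (g ρ)) (Φ ρ w) := by
    have h1 : Continuous (Function.uncurry fun t x => deriv (g t) x) := hg.continuous_deriv
    have h2 := measurable_deriv_with_param h1
    exact h2.comp (measurable_id.prodMk (hΦ.continuous w).measurable)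
  have := (intervalIntegral.hasDerivAt_integral_of_dominated_loc_of_deriv_le
    (μ := volume) (a := 0) (b := r) (s := univ) (x₀ := w)
    (F := fun w ρ => deriv (g ρ) (Φ ρ w))
    (F' := fun w ρ => deriv (deriv (g ρ)) (Φ ρ w) * flowDeriv g Φ ρ w)
    (bound := fun _ => K * Real.exp (K * T)) univ_mem
    (Eventually.of_forall fun y => (hΦ.continuous_deriv_comp hg y).aestronglyMeasurable)
    ((hΦ.continuous_deriv_comp hg w).intervalIntegrable _ _)
    (hmeas.mul (hΦ.continuous_flowDeriv_left hg w).measurable).aestronglyMeasurable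
    (Eventually.of_forall fun ρ hρ y _ => by
      rw [norm_mul]
      refine mul_le_mul (hg.bound_deriv_deriv _ _) ?_ (norm_nonneg _) hK
      rw [Real.norm_of_nonneg (flowDeriv_pos _ _).le]
      exact flowDeriv_le hg y (hsub ρ hρ))
    intervalIntegrable_const
    (Eventually.of_forall fun ρ hρ y _ => by
      exact ((hg.differentiable_deriv ρ _).hasDerivAt).comp y
        (hΦ.hasDerivAt_right hg y (hsub ρ hρ)))).2
  exact this.exp

theorem abs_deriv_flowDeriv_le (hg : SmoothDrift K g) (w : ℝ) {r : ℝ} (hr : r ∈ Icc 0 T) :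
    |flowDeriv g Φ r w * ∫ ρ in (0 : ℝ)..r, deriv (deriv (g ρ)) (Φ ρ w) * flowDeriv g Φ ρ w| ≤
      Real.exp (K * T) * (K * Real.exp (K * T) * T) := by
  have hK := hg.nonneg
  rw [abs_mul, abs_of_pos (flowDeriv_pos _ _)]
  have hT := hr.1.trans hr.2
  refine mul_le_mul (flowDeriv_le hg w hr) ?_ (abs_nonneg _) (Real.exp_pos _).le
  have := intervalIntegral.norm_integral_le_of_norm_le_const (a := 0) (b := r)
    (C := K * Real.exp (K * T))
    (f := fun ρ => deriv (deriv (g ρ)) (Φ ρ w) * flowDeriv g Φ ρ w) (fun ρ hρ => by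
      rw [uIoc_of_le hr.1] at hρ
      rw [norm_mul]
      refine mul_le_mul (hg.bound_deriv_deriv _ _) ?_ (norm_nonneg _) hK
      rw [Real.norm_of_nonneg (flowDeriv_pos _ _).le]
      exact flowDeriv_le hg w ⟨hρ.1.le, hρ.2.trans hr.2⟩)
  refine this.trans ?_
  rw [sub_zero, abs_of_nonneg hr.1]
  exact mul_le_mul_of_nonneg_left hr.2 (by positivity)

theorem IsFlow.hasDerivAt_flowDeriv_left (hΦ : IsFlow T g Φ) (hg : SmoothDrift K g) (r w : ℝ) :
    HasDerivAt (fun r => flowDeriv g Φ r w) (flowDeriv g Φ r w * deriv (g r) (Φ r w)) r :=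
  ((hΦ.continuous_deriv_comp hg w).integral_hasStrictDerivAt 0 r).hasDerivAt.exp

theorem IsFlow.continuousOn_flowDeriv (hΦ : IsFlow T g Φ) (hg : SmoothDrift K g) :
    ContinuousOn (fun p : ℝ × ℝ => flowDeriv g Φ p.1 p.2) (Icc 0 T ×ˢ univ) := by
  set C := Real.exp (K * T) * (K * Real.exp (K * T) * T)
  rintro ⟨u, w⟩ hu
  have hlim : Tendsto (fun p : ℝ × ℝ => C * |p.2 - w| + |flowDeriv g Φ p.1 w - flowDeriv g Φ u w|)
      (𝓝[Icc 0 T ×ˢ univ] (u, w)) (𝓝 0) := by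
    have : Continuous fun p : ℝ × ℝ =>
        C * |p.2 - w| + |flowDeriv g Φ p.1 w - flowDeriv g Φ u w| := by
      have := (hΦ.continuous_flowDeriv_left hg w).comp (continuous_fst (X := ℝ) (Y := ℝ))
      simp only [Function.comp_def] at this
      fun_prop
    have := this.tendsto (u, w)
    simp only [sub_self, abs_zero, mul_zero, add_zero] at this
    exact this.mono_left nhdsWithin_le_nhds
  refine tendsto_iff_norm_sub_tendsto_zero.2 (squeeze_zero' (Eventually.of_forall fun _ =>
    norm_nonneg _) ?_ hlim)
  filter_upwards [self_mem_nhdsWithin] with p hp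
  have h1 := Convex.norm_image_sub_le_of_norm_hasDerivWithin_le (s := univ) (x := w) (y := p.2)
    (C := C) (fun z _ => (hΦ.hasDerivAt_flowDeriv_right hg z hp.1).hasDerivWithinAt)
    (fun z _ => abs_deriv_flowDeriv_le hg z hp.1) convex_univ trivial trivial
  calc ‖flowDeriv g Φ p.1 p.2 - flowDeriv g Φ u w‖
      = |(flowDeriv g Φ p.1 p.2 - flowDeriv g Φ p.1 w)
        + (flowDeriv g Φ p.1 w - flowDeriv g Φ u w)| := by
        rw [Real.norm_eq_abs]; congr 1; ring
    _ ≤ _ := (abs_add_le _ _).trans (by gcongr; exact h1)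

theorem IsFlow.hasFDerivAt_flowDeriv (hΦ : IsFlow T g Φ) (hg : SmoothDrift K g) {u : ℝ}
    (hu : u ∈ Ioo 0 T) (w : ℝ) : HasFDerivAt (fun p : ℝ × ℝ => flowDeriv g Φ p.1 p.2)
      (planeForm (flowDeriv g Φ u w * deriv (g u) (Φ u w)) (flowDeriv g Φ u w *
      ∫ ρ in (0 : ℝ)..u, deriv (deriv (g ρ)) (Φ ρ w) * flowDeriv g Φ ρ w)) (u, w) := by
  refine hasFDerivAt_planeForm_of_partial
    (f₁ := fun u w => flowDeriv g Φ u w * deriv (g u) (Φ u w)) ?_ ?_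
    (hΦ.hasDerivAt_flowDeriv_right hg w (Ioo_subset_Icc_self hu))
  · exact Eventually.of_forall fun p => hΦ.hasDerivAt_flowDeriv_left hg p.1 p.2
  · refine ContinuousAt.mul ((hΦ.continuousOn_flowDeriv hg).continuousAt
      (Icc_prod_mem_nhds hu w)) ?_
    exact ContinuousAt.comp (g := fun p : ℝ × ℝ => deriv (g p.1) p.2)
      (f := fun p : ℝ × ℝ => (p.1, Φ p.1 p.2)) hg.continuous_deriv.continuousAt
      (continuousAt_fst.prodMk (hΦ.continuousAt hg hu w))

/-! ### The flow as a bijection of the line, and its inverse -/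

theorem IsFlow.strictMono (hΦ : IsFlow T g Φ) (hg : SmoothDrift K g) {r : ℝ}
    (hr : r ∈ Icc 0 T) : StrictMono (Φ r) := fun w w' h => by
  have := (hΦ.sub_eq hg h.ne' hr).1
  have h2 : 0 < Φ r w' - Φ r w := by
    rw [this]; exact mul_pos (sub_pos.2 h) (Real.exp_pos _)
  linarith

/-- Monotonicity and the lower Lipschitz estimate push `Φ r` to both infinities at least linearly.
-/
theorem IsFlow.surjective (hΦ : IsFlow T g Φ) (hg : SmoothDrift K g) {r : ℝ}
    (hr : r ∈ Icc 0 T) : Function.Surjective (Φ r) := by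
  have hmono := (hΦ.strictMono hg hr).monotone
  have hpos := Real.exp_pos (K * T)
  refine Continuous.surjective (hΦ.continuous_right hg hr) ?_ ?_
  · refine tendsto_atTop_mono' (f₁ := fun w => Φ r 0 + w / Real.exp (K * T)) _ ?_
      (tendsto_atTop_add_const_left _ _ (tendsto_id.atTop_div_const hpos))
    filter_upwards [eventually_ge_atTop 0] with w hw
    have h1 := hΦ.abs_sub_ge hg 0 w hr
    rw [sub_zero, abs_of_nonneg hw, abs_of_nonneg (sub_nonneg.2 (hmono hw)),
      ← div_le_iff₀ hpos] at h1
    linarith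
  · refine tendsto_atBot_mono' (f₁ := fun w => Φ r 0 + w / Real.exp (K * T)) _ ?_
      (tendsto_atBot_add_const_left _ _ (tendsto_id.atBot_div_const hpos))
    filter_upwards [eventually_le_atBot 0] with w hw
    have h1 := hΦ.abs_sub_ge hg 0 w hr
    rw [sub_zero, abs_of_nonpos hw, abs_of_nonpos (sub_nonpos.2 (hmono hw)),
      ← div_le_iff₀ hpos, neg_div] at h1
    linarith

/-- The inverse of the flow at time `r`. -/
noncomputable def flowInv (Φ : ℝ → ℝ → ℝ) (r z : ℝ) : ℝ := Function.invFun (Φ r) z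

theorem IsFlow.flow_flowInv (hΦ : IsFlow T g Φ) (hg : SmoothDrift K g) {r : ℝ}
    (hr : r ∈ Icc 0 T) (z : ℝ) : Φ r (flowInv Φ r z) = z :=
  Function.rightInverse_invFun (hΦ.surjective hg hr) z

theorem IsFlow.abs_flowInv_sub_le (hΦ : IsFlow T g Φ) (hg : SmoothDrift K g) {r : ℝ}
    (hr : r ∈ Icc 0 T) (z w : ℝ) :
    |flowInv Φ r z - w| ≤ |z - Φ r w| * Real.exp (K * T) := by
  have := hΦ.abs_sub_ge hg w (flowInv Φ r z) hr
  rwa [hΦ.flow_flowInv hg hr] at this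

/-- The lower Lipschitz constant is uniform in time, so the inverse at a nearby time is compared
with the one fixed trajectory starting from `w`. -/
theorem IsFlow.continuousOn_flowInv (hΦ : IsFlow T g Φ) (hg : SmoothDrift K g) :
    ContinuousOn (fun p : ℝ × ℝ => flowInv Φ p.1 p.2) (Icc 0 T ×ˢ univ) := by
  rintro ⟨u, z⟩ hu
  set w := flowInv Φ u z with hw
  have hlim : Tendsto (fun p : ℝ × ℝ => |p.2 - Φ p.1 w| * Real.exp (K * T))
      (𝓝[Icc 0 T ×ˢ univ] (u, z)) (𝓝 0) := by
    have : Continuous fun p : ℝ × ℝ => |p.2 - Φ p.1 w| * Real.exp (K * T) := by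
      have h1 : Continuous fun p : ℝ × ℝ => Φ p.1 w := (hΦ.continuous w).comp continuous_fst
      exact ((continuous_snd.sub h1).abs).mul continuous_const
    have := this.tendsto (u, z)
    simp only [hw, hΦ.flow_flowInv hg hu.1, sub_self, abs_zero, zero_mul] at this
    exact this.mono_left nhdsWithin_le_nhds
  refine tendsto_iff_norm_sub_tendsto_zero.2 (squeeze_zero' (Eventually.of_forall fun _ =>
    norm_nonneg _) ?_ hlim)
  filter_upwards [self_mem_nhdsWithin] with p hp
  exact hΦ.abs_flowInv_sub_le hg hp.1 _ _

/-- The linear equivalence `(h, k) ↦ (h, p h + q k)`, for `q ≠ 0`. -/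
noncomputable def shear (p q : ℝ) (hq : q ≠ 0) : (ℝ × ℝ) ≃L[ℝ] (ℝ × ℝ) :=
  ContinuousLinearEquiv.equivOfInverse
    ((ContinuousLinearMap.fst ℝ ℝ ℝ).prod (planeForm p q))
    ((ContinuousLinearMap.fst ℝ ℝ ℝ).prod (planeForm (-p / q) (1 / q)))
    (fun v => by ext <;> simp; field_simp; ring)
    (fun v => by ext <;> simp; field_simp; ring)

/-- Invert the space-time map `(u, w) ↦ (u, Φ u w)`, whose derivative is a `shear`. Since the
inverse is already known to be continuous, differentiability at the single point is enough. -/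
theorem IsFlow.hasFDerivAt_flowInv (hΦ : IsFlow T g Φ) (hg : SmoothDrift K g) {u : ℝ}
    (hu : u ∈ Ioo 0 T) (z : ℝ) : HasFDerivAt (fun p : ℝ × ℝ => flowInv Φ p.1 p.2)
      (planeForm (-g u z / flowDeriv g Φ u (flowInv Φ u z))
        (1 / flowDeriv g Φ u (flowInv Φ u z))) (u, z) := by
  set w := flowInv Φ u z with hw
  have hf : HasFDerivAt (fun p : ℝ × ℝ => (p.1, Φ p.1 p.2))
      ((shear (g u z) (flowDeriv g Φ u w) (flowDeriv_pos _ _).ne' : (ℝ × ℝ) ≃L[ℝ] (ℝ × ℝ)) :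
        ℝ × ℝ →L[ℝ] ℝ × ℝ) (u, w) := by
    have h1 := hΦ.hasFDerivAt hg hu w
    rw [hw, hΦ.flow_flowInv hg (Ioo_subset_Icc_self hu), ← hw] at h1
    exact hasFDerivAt_fst.prodMk h1
  have hc : ContinuousAt (fun p : ℝ × ℝ => (p.1, flowInv Φ p.1 p.2)) (u, z) :=
    continuousAt_fst.prodMk ((hΦ.continuousOn_flowInv hg).continuousAt (Icc_prod_mem_nhds hu z))
  have := HasFDerivAt.of_local_left_inverse (a := (u, z)) hc hf (by
    filter_upwards [strip_mem_nhds hu z] with p hp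
    simp [hΦ.flow_flowInv hg (Ioo_subset_Icc_self hp.1)])
  exact (hasFDerivAt_snd.comp (u, z) this)

end JumpDiffusion

namespace JumpDiffusion

open Filter Topology

/-! ### Families of functions with uniformly bounded values and derivatives -/

section UniformlySmooth

variable {A B X : Type*} [NormedAddCommGroup X] [NormedSpace ℝ X] {U : Set X} {f h : A → X → ℝ}

/-- The functions `f a` are bounded and differentiable with bounded derivative at the points of `U`,
uniformly in `a`. -/
def UniformlySmooth (U : Set X) (f : A → X → ℝ) : Prop :=
  ∃ C, ∀ a, ∀ u ∈ U, |f a u| ≤ C ∧ ∃ L : X →L[ℝ] ℝ, HasFDerivAt (f a) L u ∧ ‖L‖ ≤ C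

theorem UniformlySmooth.differentiableAt (hf : UniformlySmooth U f) (a : A) {u : X} (hu : u ∈ U) :
    DifferentiableAt ℝ (f a) u := by
  obtain ⟨C, hC⟩ := hf
  obtain ⟨_, L, hL, _⟩ := hC a u hu
  exact hL.differentiableAt

theorem UniformlySmooth.exists_bound (hf : UniformlySmooth U f) :
    ∃ C, 0 ≤ C ∧ ∀ a, ∀ u ∈ U, |f a u| ≤ C ∧ ‖fderiv ℝ (f a) u‖ ≤ C := by
  obtain ⟨C, hC⟩ := hf
  refine ⟨|C|, abs_nonneg _, fun a u hu => ?_⟩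
  obtain ⟨h1, L, hL, h2⟩ := hC a u hu
  rw [hL.fderiv]
  exact ⟨h1.trans (le_abs_self _), h2.trans (le_abs_self _)⟩

theorem UniformlySmooth.reindex (hf : UniformlySmooth U f) (m : B → A) :
    UniformlySmooth U fun b => f (m b) := by
  obtain ⟨C, hC⟩ := hf
  exact ⟨C, fun a u hu => hC (m a) u hu⟩

theorem UniformlySmooth.congr (hf : UniformlySmooth U f) (hU : IsOpen U)
    (hfh : ∀ a, ∀ u ∈ U, h a u = f a u) : UniformlySmooth U h := by
  obtain ⟨C, hC⟩ := hf
  refine ⟨C, fun a u hu => ?_⟩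
  obtain ⟨h1, L, hL, h2⟩ := hC a u hu
  rw [hfh a u hu]
  exact ⟨h1, L, hL.congr_of_eventuallyEq (eventually_of_mem (hU.mem_nhds hu) (hfh a)), h2⟩

theorem uniformlySmooth_const (k : ℝ) : UniformlySmooth U fun (_ : A) (_ : X) => k :=
  ⟨|k|, fun _ _ _ => ⟨le_rfl, 0, hasFDerivAt_const _ _, by simp⟩⟩

theorem UniformlySmooth.add (hf : UniformlySmooth U f) (hh : UniformlySmooth U h) :
    UniformlySmooth U fun a u => f a u + h a u := by
  obtain ⟨C, hC⟩ := hf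
  obtain ⟨C', hC'⟩ := hh
  refine ⟨C + C', fun a u hu => ?_⟩
  obtain ⟨h1, L, hL, h2⟩ := hC a u hu
  obtain ⟨h1', L', hL', h2'⟩ := hC' a u hu
  exact ⟨(abs_add_le _ _).trans (add_le_add h1 h1'), _, hL.add hL',
    (norm_add_le _ _).trans (add_le_add h2 h2')⟩

theorem UniformlySmooth.neg (hf : UniformlySmooth U f) :
    UniformlySmooth U fun a u => - f a u := by
  obtain ⟨C, hC⟩ := hf
  refine ⟨C, fun a u hu => ?_⟩
  obtain ⟨h1, L, hL, h2⟩ := hC a u hu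
  exact ⟨by rwa [abs_neg], _, hL.neg, by rwa [norm_neg]⟩

theorem UniformlySmooth.sub (hf : UniformlySmooth U f) (hh : UniformlySmooth U h) :
    UniformlySmooth U fun a u => f a u - h a u := by
  simpa only [sub_eq_add_neg] using hf.add hh.neg

theorem UniformlySmooth.mul (hf : UniformlySmooth U f) (hh : UniformlySmooth U h) :
    UniformlySmooth U fun a u => f a u * h a u := by
  obtain ⟨C, hC⟩ := hf
  obtain ⟨C', hC'⟩ := hh
  refine ⟨C * C' + C' * C, fun a u hu => ?_⟩
  obtain ⟨h1, L, hL, h2⟩ := hC a u hu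
  obtain ⟨h1', L', hL', h2'⟩ := hC' a u hu
  have p1 : 0 ≤ C := (abs_nonneg _).trans h1
  have p2 : 0 ≤ C' := (abs_nonneg _).trans h1'
  refine ⟨?_, _, hL.mul hL', (norm_add_le _ _).trans (add_le_add ?_ ?_)⟩
  · rw [abs_mul]
    have := mul_le_mul h1 h1' (abs_nonneg _) p1
    nlinarith
  · rw [norm_smul]
    exact mul_le_mul h1 h2' (norm_nonneg _) p1
  · rw [norm_smul]
    exact mul_le_mul h1' h2 (norm_nonneg _) p2

theorem UniformlySmooth.inv {ε : ℝ} (hf : UniformlySmooth U f) (hε : 0 < ε)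
    (hfε : ∀ a, ∀ u ∈ U, ε ≤ |f a u|) : UniformlySmooth U fun a u => (f a u)⁻¹ := by
  obtain ⟨C, hC⟩ := hf
  refine ⟨max ε⁻¹ ((ε ^ 2)⁻¹ * C), fun a u hu => ?_⟩
  obtain ⟨h1, L, hL, h2⟩ := hC a u hu
  have h0 := hfε a u hu
  have hne : f a u ≠ 0 := abs_pos.1 (hε.trans_le h0)
  refine ⟨?_, _, (hasDerivAt_inv hne).comp_hasFDerivAt u hL, ?_⟩
  · rw [abs_inv]
    exact (inv_anti₀ hε h0).trans (le_max_left _ _)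
  · refine le_trans ?_ (le_max_right _ _)
    rw [norm_smul, norm_neg, norm_inv, norm_pow, Real.norm_eq_abs]
    refine mul_le_mul (inv_anti₀ (by positivity) ?_) h2 (norm_nonneg _) (by positivity)
    gcongr

theorem UniformlySmooth.clm (hU : Bornology.IsBounded U) (L : X →L[ℝ] ℝ) :
    UniformlySmooth U fun (_ : A) => ⇑L := by
  obtain ⟨C, hC⟩ := hU.exists_norm_le
  refine ⟨max ‖L‖ (‖L‖ * C), fun _ u hu => ⟨?_, L, L.hasFDerivAt, le_max_left _ _⟩⟩
  refine le_trans ((L.le_opNorm u).trans ?_) (le_max_right _ _)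
  gcongr
  exact hC u hu

/-- Regularity of functions of `(u, w) ∈ (0, T) × ℝ`, locally uniformly in `w`. -/
def LocUniformlySmooth (T : ℝ) (h : A → ℝ × ℝ → ℝ) : Prop :=
  ∀ M : ℝ, UniformlySmooth (Ioo 0 T ×ˢ Icc (-M) M) h

/-- The inner functions have a common bound `C`, so the outer family only needs its constant on the
strip `|w| ≤ C`. This is how linear growth of the coefficients becomes uniform boundedness after
finitely many jumps. -/
theorem LocUniformlySmooth.comp {T : ℝ} {h : B → ℝ × ℝ → ℝ} (hh : LocUniformlySmooth T h)
    {p : A → X → ℝ} (hp : UniformlySmooth U p) (hpT : ∀ a, ∀ u ∈ U, p a u ∈ Ioo 0 T)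
    (hf : UniformlySmooth U f) (m : A → B) :
    UniformlySmooth U fun a u => h (m a) (p a u, f a u) := by
  obtain ⟨C, hC⟩ := hf
  obtain ⟨C', hC'⟩ := hp
  obtain ⟨C'', hC''⟩ := hh C
  refine ⟨max C'' (C'' * max C' C), fun a u hu => ?_⟩
  obtain ⟨h1, L, hL, h2⟩ := hC a u hu
  obtain ⟨h1', L', hL', h2'⟩ := hC' a u hu
  obtain ⟨h1'', L'', hL'', h2''⟩ := hC'' (m a) (p a u, f a u) ⟨hpT a u hu, abs_le.1 h1⟩
  refine ⟨h1''.trans (le_max_left _ _), L''.comp (L'.prod L),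
    HasFDerivAt.comp u hL'' (hL'.prodMk hL), le_trans ?_ (le_max_right _ _)⟩
  refine (ContinuousLinearMap.opNorm_comp_le _ _).trans ?_
  refine mul_le_mul h2'' ?_ (norm_nonneg _) ((norm_nonneg _).trans h2'')
  rw [ContinuousLinearMap.opNorm_prod, Prod.norm_def]
  exact max_le_max h2' h2

end UniformlySmooth

section Plane

variable {A B : Type*} {T : ℝ}

theorem isBounded_Ioo_prod_Icc (M : ℝ) :
    Bornology.IsBounded (Ioo 0 T ×ˢ Icc (-M) M : Set (ℝ × ℝ)) :=
  (Metric.isBounded_Ioo _ _).prod (Metric.isBounded_Icc _ _)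

theorem LocUniformlySmooth.comp_snd {h : B → ℝ × ℝ → ℝ} (hh : LocUniformlySmooth T h)
    {k : A → ℝ × ℝ → ℝ} (hk : LocUniformlySmooth T k) (m : A → B) :
    LocUniformlySmooth T fun a p => h (m a) (p.1, k a p) := fun M =>
  hh.comp (p := fun _ p => p.1)
    (UniformlySmooth.clm (isBounded_Ioo_prod_Icc M) (ContinuousLinearMap.fst ℝ ℝ ℝ))
    (fun _ _ hu => hu.1) (hk M) m

theorem locUniformlySmooth_of_planeForm {h p q : A → ℝ → ℝ → ℝ}
    (hd : ∀ a, ∀ u ∈ Ioo 0 T, ∀ w,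
      HasFDerivAt (fun z : ℝ × ℝ => h a z.1 z.2) (planeForm (p a u w) (q a u w)) (u, w))
    (hb : ∀ M : ℝ, ∃ C, ∀ a, ∀ u ∈ Ioo 0 T, ∀ w, |w| ≤ M →
      |h a u w| ≤ C ∧ |p a u w| ≤ C ∧ |q a u w| ≤ C) :
    LocUniformlySmooth T fun a (z : ℝ × ℝ) => h a z.1 z.2 := by
  intro M
  obtain ⟨C, hC⟩ := hb M
  refine ⟨C + C, fun a z hz => ?_⟩
  obtain ⟨h1, h2, h3⟩ := hC a z.1 hz.1 z.2 (abs_le.2 hz.2)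
  have := abs_nonneg (h a z.1 z.2)
  exact ⟨by linarith, _, hd a z.1 hz.1 z.2, (norm_planeForm_le _ _).trans (by linarith)⟩

theorem hasFDerivAt_comp_planeForm {h k : ℝ → ℝ → ℝ} {p q r s u w : ℝ}
    (hh : HasFDerivAt (fun z : ℝ × ℝ => h z.1 z.2) (planeForm p q) (u, k u w))
    (hk : HasFDerivAt (fun z : ℝ × ℝ => k z.1 z.2) (planeForm r s) (u, w)) :
    HasFDerivAt (fun z : ℝ × ℝ => h z.1 (k z.1 z.2)) (planeForm (p + q * r) (q * s)) (u, w) := by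
  have := HasFDerivAt.comp (u, w) (f := fun z : ℝ × ℝ => (z.1, k z.1 z.2)) hh
    (hasFDerivAt_fst.prodMk hk)
  refine this.congr_fderiv ?_
  ext <;> simp

end Plane

/-! ### The jump map in straightened coordinates -/

section JumpMap

variable {T K : ℝ} {c : ℝ → ℝ → ℝ → ℝ} {g Φ : ℝ → ℝ → ℝ}

theorem IsFlow.locUniformlySmooth (hΦ : IsFlow T g Φ) (hg : SmoothDrift K g) :
    LocUniformlySmooth T fun (_ : ℝ) (p : ℝ × ℝ) => Φ p.1 p.2 := by
  refine locUniformlySmooth_of_planeForm (h := fun _ u w => Φ u w)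
    (fun _ u hu w => hΦ.hasFDerivAt hg hu w) fun M => ?_
  have hK := hg.nonneg
  have hcomp : IsCompact (Icc 0 T ×ˢ Icc (-M) M : Set (ℝ × ℝ)) := isCompact_Icc.prod isCompact_Icc
  obtain ⟨C, hC⟩ := hcomp.exists_bound_of_continuousOn
    ((hΦ.continuousOn hg).mono (prod_mono subset_rfl (subset_univ _)))
  refine ⟨max C (max (K * (1 + C)) (Real.exp (K * T))), fun _ u hu w hw => ?_⟩
  have h1 : |Φ u w| ≤ C := hC (u, w) ⟨Ioo_subset_Icc_self hu, abs_le.1 hw⟩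
  refine ⟨h1.trans (le_max_left _ _), ?_, ?_⟩
  · exact ((hg.growth _ _).trans (by gcongr)).trans
      ((le_max_left _ _).trans (le_max_right _ _))
  · rw [abs_of_pos (flowDeriv_pos _ _)]
    exact (flowDeriv_le hg w (Ioo_subset_Icc_self hu)).trans
      ((le_max_right _ _).trans (le_max_right _ _))

theorem IsFlow.locUniformlySmooth_flowDeriv (hΦ : IsFlow T g Φ) (hg : SmoothDrift K g) :
    LocUniformlySmooth T fun (_ : ℝ) (p : ℝ × ℝ) => flowDeriv g Φ p.1 p.2 := by
  refine locUniformlySmooth_of_planeForm (h := fun _ u w => flowDeriv g Φ u w)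
    (fun _ u hu w => hΦ.hasFDerivAt_flowDeriv hg hu w) fun M => ?_
  have hK := hg.nonneg
  refine ⟨max (Real.exp (K * T)) (max (Real.exp (K * T) * K)
    (Real.exp (K * T) * (K * Real.exp (K * T) * T))), fun _ u hu w hw => ?_⟩
  have h1 : |flowDeriv g Φ u w| ≤ Real.exp (K * T) := by
    rw [abs_of_pos (flowDeriv_pos _ _)]
    exact flowDeriv_le hg w (Ioo_subset_Icc_self hu)
  refine ⟨h1.trans (le_max_left _ _), ?_, ?_⟩
  · rw [abs_mul]
    exact (mul_le_mul h1 (hg.bound_deriv _ _) (abs_nonneg _) (Real.exp_pos _).le).trans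
      ((le_max_left _ _).trans (le_max_right _ _))
  · exact (abs_deriv_flowDeriv_le hg w (Ioo_subset_Icc_self hu)).trans
      ((le_max_right _ _).trans (le_max_right _ _))

theorem IsFlow.locUniformlySmooth_flowInv (hΦ : IsFlow T g Φ) (hg : SmoothDrift K g) :
    LocUniformlySmooth T fun (_ : ℝ) (p : ℝ × ℝ) => flowInv Φ p.1 p.2 := by
  refine locUniformlySmooth_of_planeForm (h := fun _ u w => flowInv Φ u w)
    (fun _ u hu w => hΦ.hasFDerivAt_flowInv hg hu w) fun M => ?_
  have hK := hg.nonneg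
  have hcomp : IsCompact (Icc 0 T ×ˢ Icc (-M) M : Set (ℝ × ℝ)) := isCompact_Icc.prod isCompact_Icc
  obtain ⟨C, hC⟩ := hcomp.exists_bound_of_continuousOn
    ((hΦ.continuousOn_flowInv hg).mono (prod_mono subset_rfl (subset_univ _)))
  refine ⟨max C (max (K * (1 + M) * Real.exp (K * T)) (Real.exp (K * T))),
    fun _ u hu w hw => ?_⟩
  have h1 : |flowInv Φ u w| ≤ C := hC (u, w) ⟨Ioo_subset_Icc_self hu, abs_le.1 hw⟩
  have h2 : (flowDeriv g Φ u (flowInv Φ u w))⁻¹ ≤ Real.exp (K * T) := by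
    have := inv_anti₀ (Real.exp_pos _)
      (le_flowDeriv (Φ := Φ) hg (flowInv Φ u w) (Ioo_subset_Icc_self hu))
    rwa [← Real.exp_neg, neg_neg] at this
  have h3 : 0 < (flowDeriv g Φ u (flowInv Φ u w))⁻¹ := inv_pos.2 (flowDeriv_pos _ _)
  refine ⟨h1.trans (le_max_left _ _), ?_, ?_⟩
  · rw [div_eq_mul_inv, abs_mul, abs_neg, abs_of_pos h3]
    refine (mul_le_mul ((hg.growth u w).trans ?_) h2 h3.le ?_).trans
      ((le_max_left _ _).trans (le_max_right _ _))
    · gcongr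
    · have : 0 ≤ M := (abs_nonneg _).trans hw
      positivity
  · rw [one_div, abs_of_pos h3]
    exact h2.trans ((le_max_right _ _).trans (le_max_right _ _))

/-- The effect of a jump at time `u` with mark `a`, in the coordinate `w` such that the position
before the jump is `Φ u w`. -/
noncomputable def jumpMap (c : ℝ → ℝ → ℝ → ℝ) (Φ : ℝ → ℝ → ℝ) (u a w : ℝ) : ℝ :=
  flowInv Φ u (Φ u w + c u a (Φ u w))

/-- The derivative of `jumpMap` in the jump time. -/
noncomputable def jumpMapTime (T : ℝ) (c : ℝ → ℝ → ℝ → ℝ) (g Φ : ℝ → ℝ → ℝ) (u a w : ℝ) : ℝ :=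
  q T c g u a (Φ u w) * (flowDeriv g Φ u (jumpMap c Φ u a w))⁻¹

/-- The derivative of `jumpMap` in the starting point. -/
noncomputable def jumpMapSpace (c : ℝ → ℝ → ℝ → ℝ) (g Φ : ℝ → ℝ → ℝ) (u a w : ℝ) : ℝ :=
  (1 + dxc c u a (Φ u w)) * flowDeriv g Φ u w * (flowDeriv g Φ u (jumpMap c Φ u a w))⁻¹

/-- The regularity of the coefficients in the interior of the strip that is used for the jump
map. -/
structure SmoothJump (T : ℝ) (c : ℝ → ℝ → ℝ → ℝ) (g : ℝ → ℝ → ℝ) : Prop where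
  hasFDerivAt : ∀ a, ∀ u ∈ Ioo 0 T, ∀ x, HasFDerivAt (fun p : ℝ × ℝ => c p.1 a p.2)
    (planeForm (dtc T c u a x) (dxc c u a x)) (u, x)
  smooth : LocUniformlySmooth T fun a (p : ℝ × ℝ) => c p.1 a p.2
  smooth_dtc : LocUniformlySmooth T fun a (p : ℝ × ℝ) => dtc T c p.1 a p.2
  smooth_dxc : LocUniformlySmooth T fun a (p : ℝ × ℝ) => dxc c p.1 a p.2
  smooth_drift : LocUniformlySmooth T fun (_ : ℝ) (p : ℝ × ℝ) => g p.1 p.2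

/-- Chain rule. The drift before the jump contributes `g + g ∂ₓc`, the explicit time dependence
`∂ₜc`, and the time derivative of the inverse flow subtracts the drift after the jump; the numerator
that remains is exactly `q`. -/
theorem SmoothJump.hasFDerivAt_jumpMap (hc : SmoothJump T c g) (hΦ : IsFlow T g Φ)
    (hg : SmoothDrift K g) (a : ℝ) {u : ℝ} (hu : u ∈ Ioo 0 T) (w : ℝ) :
    HasFDerivAt (fun p : ℝ × ℝ => jumpMap c Φ p.1 a p.2)
      (planeForm (jumpMapTime T c g Φ u a w) (jumpMapSpace c g Φ u a w)) (u, w) := by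
  have h1 := hΦ.hasFDerivAt hg hu w
  have h2 := hasFDerivAt_comp_planeForm (h := fun u x => c u a x) (hc.hasFDerivAt a u hu (Φ u w)) h1
  have h3 := h1.add h2
  have h4 : HasFDerivAt (fun z : ℝ × ℝ => Φ z.1 z.2 + c z.1 a (Φ z.1 z.2))
      (planeForm (g u (Φ u w) + (dtc T c u a (Φ u w) + dxc c u a (Φ u w) * g u (Φ u w)))
        (flowDeriv g Φ u w + dxc c u a (Φ u w) * flowDeriv g Φ u w)) (u, w) :=
    h3.congr_fderiv (by ext <;> simp)
  have h5 := hasFDerivAt_comp_planeForm (h := fun u z => flowInv Φ u z)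
    (k := fun u w => Φ u w + c u a (Φ u w)) (hΦ.hasFDerivAt_flowInv hg hu _) h4
  refine h5.congr_fderiv ?_
  have := (flowDeriv_pos (g := g) (Φ := Φ) u (jumpMap c Φ u a w)).ne'
  congr 1
  · simp only [jumpMapTime, q]
    simp only [jumpMap] at this ⊢
    field_simp
    ring
  · simp only [jumpMapSpace]
    simp only [jumpMap] at this ⊢
    field_simp

theorem SmoothJump.smooth_jumpMap (hc : SmoothJump T c g) (hΦ : IsFlow T g Φ)
    (hg : SmoothDrift K g) :
    LocUniformlySmooth T fun a (p : ℝ × ℝ) => jumpMap c Φ p.1 a p.2 := by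
  have h1 := hΦ.locUniformlySmooth hg
  have h2 : LocUniformlySmooth T fun a (p : ℝ × ℝ) => Φ p.1 p.2 + c p.1 a (Φ p.1 p.2) :=
    fun M => (h1 M).add (hc.smooth.comp_snd h1 id M)
  exact (hΦ.locUniformlySmooth_flowInv hg).comp_snd h2 id

theorem SmoothJump.smooth_inv_flowDeriv (hc : SmoothJump T c g) (hΦ : IsFlow T g Φ)
    (hg : SmoothDrift K g) : LocUniformlySmooth T
      fun a (p : ℝ × ℝ) => (flowDeriv g Φ p.1 (jumpMap c Φ p.1 a p.2))⁻¹ := fun M =>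
  ((hΦ.locUniformlySmooth_flowDeriv hg).comp_snd (hc.smooth_jumpMap hΦ hg) id M).inv
    (Real.exp_pos (-(K * T))) fun a u hu => by
      rw [abs_of_pos (flowDeriv_pos _ _)]
      exact le_flowDeriv hg _ (Ioo_subset_Icc_self hu.1)

/-- Second derivatives in the jump times come from here: `q` contains `g` itself, so differentiating
it in time calls for the joint continuous differentiability of `g`. -/
theorem SmoothJump.smooth_jumpMapTime (hc : SmoothJump T c g) (hΦ : IsFlow T g Φ)
    (hg : SmoothDrift K g) :
    LocUniformlySmooth T fun a (p : ℝ × ℝ) => jumpMapTime T c g Φ p.1 a p.2 := fun M => by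
  have h1 := hΦ.locUniformlySmooth hg
  have h2 : LocUniformlySmooth T fun a (p : ℝ × ℝ) => Φ p.1 p.2 + c p.1 a (Φ p.1 p.2) :=
    fun M => (h1 M).add (hc.smooth.comp_snd h1 id M)
  have h3 := hc.smooth_dtc.comp_snd h1 id
  have h4 := hc.smooth_dxc.comp_snd h1 id
  have h5 := hc.smooth_drift.comp_snd h1 id
  have h6 := hc.smooth_drift.comp_snd h2 id
  exact ((((h3 M).add ((h5 M).mul (h4 M))).add (h5 M)).sub (h6 M)).mul
    (hc.smooth_inv_flowDeriv hΦ hg M)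

theorem SmoothJump.smooth_jumpMapSpace (hc : SmoothJump T c g) (hΦ : IsFlow T g Φ)
    (hg : SmoothDrift K g) :
    LocUniformlySmooth T fun a (p : ℝ × ℝ) => jumpMapSpace c g Φ p.1 a p.2 := fun M =>
  (((uniformlySmooth_const 1).add (hc.smooth_dxc.comp_snd (hΦ.locUniformlySmooth hg) id M)).mul
    ((hΦ.locUniformlySmooth_flowDeriv hg M).reindex id)).mul (hc.smooth_inv_flowDeriv hΦ hg M)

theorem exp_neg_le_inv_flowDeriv (hg : SmoothDrift K g) (w : ℝ) {r : ℝ} (hr : r ∈ Icc 0 T) :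
    Real.exp (-(K * T)) ≤ (flowDeriv g Φ r w)⁻¹ := by
  rw [Real.exp_neg]
  exact inv_anti₀ (flowDeriv_pos _ _) (flowDeriv_le hg w hr)

theorem le_abs_jumpMapTime (hg : SmoothDrift K g) {η : ℝ} {u a : ℝ}
    (hu : u ∈ Icc 0 T) (hq : ∀ x, η ≤ |q T c g u a x|) (w : ℝ) :
    η * Real.exp (-(K * T)) ≤ |jumpMapTime T c g Φ u a w| := by
  rw [jumpMapTime, abs_mul, abs_of_pos (inv_pos.2 (flowDeriv_pos _ _))]
  exact mul_le_mul (hq _) (exp_neg_le_inv_flowDeriv hg _ hu) (Real.exp_pos _).le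
    (abs_nonneg _)

theorem le_abs_jumpMapSpace (hg : SmoothDrift K g) {η : ℝ} {u a : ℝ}
    (hu : u ∈ Icc 0 T) (hq : ∀ x, η ≤ |1 + dxc c u a x|) (w : ℝ) :
    η * Real.exp (-(K * T)) * Real.exp (-(K * T)) ≤ |jumpMapSpace c g Φ u a w| := by
  rw [jumpMapSpace, abs_mul, abs_mul, abs_of_pos (inv_pos.2 (flowDeriv_pos _ _)),
    abs_of_pos (flowDeriv_pos _ _)]
  have := flowDeriv_pos (g := g) (Φ := Φ) u w
  exact mul_le_mul (mul_le_mul (hq _) (le_flowDeriv hg _ hu) (Real.exp_pos _).le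
    (abs_nonneg _)) (exp_neg_le_inv_flowDeriv hg _ hu) (Real.exp_pos _).le (by positivity)

end JumpMap

end JumpDiffusion

namespace JumpDiffusion

open Filter Topology

/-! ### Regular coefficients -/

section Coefficients

variable {T K : ℝ} {c : ℝ → ℝ → ℝ → ℝ} {g : ℝ → ℝ → ℝ}

/-- The drift, extended to all times by its values at the ends of `[0, T]`. -/
def extendDrift (T : ℝ) (g : ℝ → ℝ → ℝ) (r x : ℝ) : ℝ := g (max 0 (min r T)) x

theorem clamp_mem_Icc (hT : 0 ≤ T) (r : ℝ) : max 0 (min r T) ∈ Icc 0 T :=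
  ⟨le_max_left _ _, max_le hT (min_le_right _ _)⟩

theorem clamp_of_mem {r : ℝ} (hr : r ∈ Icc 0 T) : max 0 (min r T) = r := by
  rw [min_eq_left hr.2, max_eq_right hr.1]

theorem extendDrift_of_mem {r : ℝ} (hr : r ∈ Icc 0 T) (x : ℝ) : extendDrift T g r x = g r x := by
  rw [extendDrift, clamp_of_mem hr]

theorem uniqueDiffOn_strip (hT : 0 < T) : UniqueDiffOn ℝ (strip T) :=
  (uniqueDiffOn_Icc hT).prod uniqueDiffOn_univ

theorem strip_mem_nhds' {u : ℝ} (hu : u ∈ Ioo 0 T) (x : ℝ) : strip T ∈ 𝓝 (u, x) :=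
  Icc_prod_mem_nhds hu x

theorem hasDerivAt_of_hasFDerivWithinAt_strip {f : ℝ × ℝ → ℝ} {L : ℝ × ℝ →L[ℝ] ℝ} {t x : ℝ}
    (ht : t ∈ Icc 0 T) (h : HasFDerivWithinAt f L (strip T) (t, x)) :
    HasDerivAt (fun y => f (t, y)) (L (0, 1)) x := by
  rw [← hasDerivWithinAt_univ]
  exact h.comp_hasDerivWithinAt x ((hasDerivAt_const x t).prodMk (hasDerivAt_id x)).hasDerivWithinAt
    fun _ _ => ⟨ht, trivial⟩

theorem hasDerivWithinAt_of_hasFDerivWithinAt_strip {f : ℝ × ℝ → ℝ} {L : ℝ × ℝ →L[ℝ] ℝ} {t x : ℝ}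
    (h : HasFDerivWithinAt f L (strip T) (t, x)) :
    HasDerivWithinAt (fun r => f (r, x)) (L (1, 0)) (Icc 0 T) t := by
  have hmaps : MapsTo (fun r : ℝ => (r, x)) (Icc 0 T) (strip T) := fun _ hr => ⟨hr, trivial⟩
  exact h.comp_hasDerivWithinAt t
    ((hasDerivAt_id t).prodMk (hasDerivAt_const t x)).hasDerivWithinAt hmaps

theorem RegularCoefficients.nonneg (h : RegularCoefficients T K c g) (hT : 0 ≤ T) : 0 ≤ K := by
  have := h.linear_growth 0 ⟨le_rfl, hT⟩ 0 0
  have h1 := abs_nonneg (c 0 0 0)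
  have h2 := abs_nonneg (g 0 0)
  simp only [abs_zero, add_zero, mul_one] at this
  linarith

theorem RegularCoefficients.hasFDerivWithinAt_drift (h : RegularCoefficients T K c g) {p : ℝ × ℝ}
    (hp : p ∈ strip T) : HasFDerivWithinAt (fun p : ℝ × ℝ => g p.1 p.2)
      (fderivWithin ℝ (fun p : ℝ × ℝ => g p.1 p.2) (strip T) p) (strip T) p :=
  (h.contDiff_g.differentiableOn one_ne_zero p hp).hasFDerivWithinAt

theorem RegularCoefficients.continuousOn_fderivWithin_drift (h : RegularCoefficients T K c g)
    (hT : 0 < T) : ContinuousOn (fderivWithin ℝ (fun p : ℝ × ℝ => g p.1 p.2) (strip T))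
      (strip T) :=
  h.contDiff_g.continuousOn_fderivWithin (uniqueDiffOn_strip hT) le_rfl

/-- Freezing the time argument outside `[0, T]` preserves every space estimate and joint continuity;
time differentiability at the ends is lost, but the flow does not use it. -/
theorem RegularCoefficients.smoothDrift (h : RegularCoefficients T K c g) (hT : 0 < T) :
    SmoothDrift K (extendDrift T g) := by
  have hclamp : Continuous fun p : ℝ × ℝ => ((max 0 (min p.1 T), p.2) : ℝ × ℝ) := by fun_prop
  have hmem : ∀ p : ℝ × ℝ, ((max 0 (min p.1 T), p.2) : ℝ × ℝ) ∈ strip T := fun p =>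
    ⟨clamp_mem_Icc hT.le _, trivial⟩
  refine ⟨h.nonneg hT.le, ?_, fun t => ?_, ?_, fun t => ?_, fun t => ?_, fun t => ?_, fun t x => ?_⟩
  · exact h.contDiff_g.continuousOn.comp_continuous hclamp hmem
  · exact h.differentiable_g _ (clamp_mem_Icc hT.le t)
  · have h1 := (h.continuousOn_fderivWithin_drift hT).comp_continuous hclamp hmem
    have h2 := (ContinuousLinearMap.apply ℝ ℝ ((0, 1) : ℝ × ℝ)).continuous.comp h1
    refine h2.congr fun p => ?_
    exact ((hasDerivAt_of_hasFDerivWithinAt_strip (clamp_mem_Icc hT.le _)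
      (h.hasFDerivWithinAt_drift (hmem p))).deriv).symm
  · exact h.differentiable_deriv_g _ (clamp_mem_Icc hT.le t)
  · exact h.bound_deriv_g _ (clamp_mem_Icc hT.le t)
  · exact h.bound_deriv_deriv_g _ (clamp_mem_Icc hT.le t)
  · exact (le_add_of_nonneg_left (abs_nonneg _)).trans
      (h.linear_growth _ (clamp_mem_Icc hT.le t) 0 x)

theorem RegularCoefficients.hasFDerivWithinAt_jump (h : RegularCoefficients T K c g) (a : ℝ)
    {p : ℝ × ℝ} (hp : p ∈ strip T) : HasFDerivWithinAt (fun p : ℝ × ℝ => c p.1 a p.2)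
      (fderivWithin ℝ (fun p : ℝ × ℝ => c p.1 a p.2) (strip T) p) (strip T) p :=
  (h.differentiable_c a p hp).hasFDerivWithinAt

theorem RegularCoefficients.dxc_eq (h : RegularCoefficients T K c g) (a : ℝ) {p : ℝ × ℝ}
    (hp : p ∈ strip T) :
    dxc c p.1 a p.2 = fderivWithin ℝ (fun p : ℝ × ℝ => c p.1 a p.2) (strip T) p (0, 1) :=
  (hasDerivAt_of_hasFDerivWithinAt_strip hp.1 (h.hasFDerivWithinAt_jump a hp)).deriv

theorem RegularCoefficients.dtc_eq (h : RegularCoefficients T K c g) (hT : 0 < T) (a : ℝ)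
    {p : ℝ × ℝ} (hp : p ∈ strip T) :
    dtc T c p.1 a p.2 = fderivWithin ℝ (fun p : ℝ × ℝ => c p.1 a p.2) (strip T) p (1, 0) :=
  (hasDerivWithinAt_of_hasFDerivWithinAt_strip (h.hasFDerivWithinAt_jump a hp)).derivWithin
    (uniqueDiffOn_Icc hT _ hp.1)

/-- Evaluating the first derivative of `c` at a fixed unit vector is linear, so the bound on the
second derivative is the bound on the gradient of the partial derivative. -/
theorem RegularCoefficients.smooth_apply_fderivWithin (h : RegularCoefficients T K c g)
    (v : ℝ × ℝ) (hv : ‖v‖ ≤ 1) {f : ℝ → ℝ × ℝ → ℝ}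
    (hf : ∀ a, ∀ p ∈ strip T,
      f a p = fderivWithin ℝ (fun p : ℝ × ℝ => c p.1 a p.2) (strip T) p v) :
    LocUniformlySmooth T f := by
  intro M
  refine ⟨K, fun a p hp => ?_⟩
  have hp' : p ∈ strip T := ⟨Ioo_subset_Icc_self hp.1, trivial⟩
  have hnhds : strip T ∈ 𝓝 p := strip_mem_nhds' hp.1 p.2
  have hL := ((h.differentiable_fderiv_c a p hp').hasFDerivWithinAt).hasFDerivAt hnhds
  have hbound := h.bound_fderiv_fderiv_c a p hp'
  refine ⟨?_, _, (((ContinuousLinearMap.apply ℝ ℝ v).hasFDerivAt.comp p hL)).congr_of_eventuallyEq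
    (eventually_of_mem hnhds fun z hz => hf a z hz), ?_⟩
  · rw [hf a p hp']
    have hb := h.bound_fderiv_c a p hp'
    revert hb
    generalize fderivWithin ℝ (fun p : ℝ × ℝ => c p.1 a p.2) (strip T) p = L
    intro hb
    exact (L.le_opNorm v).trans ((mul_le_of_le_one_right (norm_nonneg L) hv).trans hb)
  · revert hbound
    generalize fderivWithin ℝ (fderivWithin ℝ (fun p : ℝ × ℝ => c p.1 a p.2) (strip T))
      (strip T) p = L
    intro hbound
    refine ContinuousLinearMap.opNorm_le_bound _ ((norm_nonneg L).trans hbound) fun z => ?_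
    refine ((L z).le_opNorm v).trans ((mul_le_of_le_one_right (norm_nonneg (L z)) hv).trans ?_)
    exact (L.le_opNorm z).trans (mul_le_mul_of_nonneg_right hbound (norm_nonneg z))

theorem RegularCoefficients.smoothJump (h : RegularCoefficients T K c g) (hT : 0 < T) :
    SmoothJump T c (extendDrift T g) := by
  have hd : ∀ a, ∀ u ∈ Ioo 0 T, ∀ x, HasFDerivAt (fun p : ℝ × ℝ => c p.1 a p.2)
      (planeForm (dtc T c u a x) (dxc c u a x)) (u, x) := by
    intro a u hu x
    have hp : ((u, x) : ℝ × ℝ) ∈ strip T := ⟨Ioo_subset_Icc_self hu, trivial⟩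
    refine ((h.hasFDerivWithinAt_jump a hp).hasFDerivAt (strip_mem_nhds' hu x)).congr_fderiv ?_
    have h1 := h.dxc_eq a hp
    have h2 := h.dtc_eq hT a hp
    simp only at h1 h2
    ext
    · simp [h2]
    · simp [h1]
  have n1 : ‖((0, 1) : ℝ × ℝ)‖ ≤ 1 := by simp [Prod.norm_def]
  have n2 : ‖((1, 0) : ℝ × ℝ)‖ ≤ 1 := by simp [Prod.norm_def]
  refine ⟨hd, ?_, ?_, ?_, ?_⟩
  · intro M
    refine ⟨max (K * (1 + M)) K, fun a p hp => ?_⟩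
    have hK := h.nonneg hT.le
    have hp' : p ∈ strip T := ⟨Ioo_subset_Icc_self hp.1, trivial⟩
    refine ⟨?_, _, (h.hasFDerivWithinAt_jump a hp').hasFDerivAt (strip_mem_nhds' hp.1 p.2),
      (h.bound_fderiv_c a p hp').trans (le_max_right _ _)⟩
    refine le_trans ?_ (le_max_left _ _)
    refine (le_add_of_nonneg_right (abs_nonneg _)).trans
      ((h.linear_growth p.1 hp'.1 a p.2).trans ?_)
    gcongr
    exact abs_le.2 hp.2
  · exact h.smooth_apply_fderivWithin (1, 0) n2 fun a p hp => h.dtc_eq hT a hp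
  · exact h.smooth_apply_fderivWithin (0, 1) n1 fun a p hp => h.dxc_eq a hp
  · intro M
    have hcomp : IsCompact (Icc 0 T ×ˢ Icc (-M) M : Set (ℝ × ℝ)) :=
      isCompact_Icc.prod isCompact_Icc
    have hsub : (Icc 0 T ×ˢ Icc (-M) M : Set (ℝ × ℝ)) ⊆ strip T :=
      prod_mono subset_rfl (subset_univ _)
    obtain ⟨C, hC⟩ := hcomp.exists_bound_of_continuousOn (h.contDiff_g.continuousOn.mono hsub)
    obtain ⟨C', hC'⟩ := hcomp.exists_bound_of_continuousOn
      ((h.continuousOn_fderivWithin_drift hT).mono hsub)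
    refine ⟨max C C', fun _ p hp => ?_⟩
    have hp1 : p ∈ (Icc 0 T ×ˢ Icc (-M) M : Set (ℝ × ℝ)) := ⟨Ioo_subset_Icc_self hp.1, hp.2⟩
    have hnhds : strip T ∈ 𝓝 p := strip_mem_nhds' hp.1 p.2
    refine ⟨?_, _, ((h.hasFDerivWithinAt_drift (hsub hp1)).hasFDerivAt
      hnhds).congr_of_eventuallyEq (eventually_of_mem hnhds fun z hz =>
        extendDrift_of_mem hz.1 z.2), (hC' p hp1).trans (le_max_right _ _)⟩
    simp only [extendDrift_of_mem hp1.1]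
    exact (hC p hp1).trans (le_max_left _ _)

theorem q_extendDrift {u : ℝ} (hu : u ∈ Icc 0 T) (a x : ℝ) :
    q T c (extendDrift T g) u a x = q T c g u a x := by
  simp only [q, extendDrift_of_mem hu]

end Coefficients

/-! ### The straightened position after `k` jumps -/

section Straight

variable {T K : ℝ} {c : ℝ → ℝ → ℝ → ℝ} {g Φ : ℝ → ℝ → ℝ} {n : ℕ}

/-- The position after the first `k` jumps, transported back to time `0` by the flow. -/
noncomputable def straight (c : ℝ → ℝ → ℝ → ℝ) (Φ : ℝ → ℝ → ℝ) (x : ℝ) (u a : Fin n → ℝ) : ℕ → ℝ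
  | 0 => x
  | k + 1 => if h : k < n then jumpMap c Φ (u ⟨k, h⟩) (a ⟨k, h⟩) (straight c Φ x u a k)
      else straight c Φ x u a k

/-- The derivative of `straight` in the starting point. -/
noncomputable def straightDeriv (c : ℝ → ℝ → ℝ → ℝ) (g Φ : ℝ → ℝ → ℝ) (x : ℝ) (u a : Fin n → ℝ) :
    ℕ → ℝ
  | 0 => 1
  | k + 1 => if h : k < n then jumpMapSpace c g Φ (u ⟨k, h⟩) (a ⟨k, h⟩) (straight c Φ x u a k)
      * straightDeriv c g Φ x u a k else straightDeriv c g Φ x u a k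

theorem straight_succ (x : ℝ) (u a : Fin n → ℝ) {k : ℕ} (h : k < n) :
    straight c Φ x u a (k + 1) = jumpMap c Φ (u ⟨k, h⟩) (a ⟨k, h⟩) (straight c Φ x u a k) := by
  rw [straight, dif_pos h]

theorem straightDeriv_succ (x : ℝ) (u a : Fin n → ℝ) {k : ℕ} (h : k < n) :
    straightDeriv c g Φ x u a (k + 1) = jumpMapSpace c g Φ (u ⟨k, h⟩) (a ⟨k, h⟩)
      (straight c Φ x u a k) * straightDeriv c g Φ x u a k := by
  rw [straightDeriv, dif_pos h]

theorem D_eq_of_hasFDerivAt {f : (Fin n → ℝ) → ℝ} {L : (Fin n → ℝ) →L[ℝ] ℝ} {u : Fin n → ℝ}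
    (h : HasFDerivAt f L u) (i : Fin n) :
    HasDerivAt (fun y => f (Function.update u i y)) (L (Pi.single i 1)) (u i) := by
  have h1 : HasDerivAt (Function.update u i) (Pi.single i (1 : ℝ)) (u i) := hasDerivAt_update u i _
  have h2 : HasFDerivAt f L (Function.update u i (u i)) := by rwa [Function.update_eq_self]
  exact h2.comp_hasDerivAt (u i) h1

theorem D_eq_fderiv {f : (Fin n → ℝ) → ℝ} {u : Fin n → ℝ} (h : DifferentiableAt ℝ f u)
    (i : Fin n) : D i f u = fderiv ℝ f u (Pi.single i 1) :=
  (D_eq_of_hasFDerivAt h.hasFDerivAt i).deriv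

theorem hasDerivAt_D {f : (Fin n → ℝ) → ℝ} {u : Fin n → ℝ} (h : DifferentiableAt ℝ f u)
    (i : Fin n) : HasDerivAt (fun y => f (Function.update u i y)) (D i f u) (u i) := by
  rw [D_eq_fderiv h]
  exact D_eq_of_hasFDerivAt h.hasFDerivAt i

theorem abs_D_le {f : (Fin n → ℝ) → ℝ} {u : Fin n → ℝ} (h : DifferentiableAt ℝ f u)
    (i : Fin n) : |D i f u| ≤ ‖fderiv ℝ f u‖ := by
  rw [D_eq_fderiv h]
  refine ((fderiv ℝ f u).le_opNorm _).trans ?_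
  rw [Pi.norm_single, norm_one, mul_one]

variable {U : Set (Fin n → ℝ)}

theorem SmoothJump.smooth_straight (hc : SmoothJump T c g) (hΦ : IsFlow T g Φ)
    (hg : SmoothDrift K g) (hU : ∀ u ∈ U, ∀ i, u i ∈ Ioo 0 T) (hUb : Bornology.IsBounded U)
    (x : ℝ) (k : ℕ) : UniformlySmooth U fun a u => straight c Φ x u a k := by
  induction k with
  | zero => exact uniformlySmooth_const x
  | succ k ih =>
    by_cases h : k < n
    · simp only [straight_succ x _ _ h]
      exact (hc.smooth_jumpMap hΦ hg).comp (p := fun _ u => u ⟨k, h⟩)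
        (UniformlySmooth.clm hUb (ContinuousLinearMap.proj ⟨k, h⟩)) (fun _ u hu => hU u hu _) ih
        fun a : Fin n → ℝ => a ⟨k, h⟩
    · simpa only [straight, dif_neg h] using ih

theorem SmoothJump.smooth_straightDeriv (hc : SmoothJump T c g) (hΦ : IsFlow T g Φ)
    (hg : SmoothDrift K g) (hU : ∀ u ∈ U, ∀ i, u i ∈ Ioo 0 T) (hUb : Bornology.IsBounded U)
    (x : ℝ) (k : ℕ) : UniformlySmooth U fun a u => straightDeriv c g Φ x u a k := by
  induction k with
  | zero => exact uniformlySmooth_const 1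
  | succ k ih =>
    by_cases h : k < n
    · simp only [straightDeriv_succ x _ _ h]
      refine UniformlySmooth.mul ?_ ih
      exact (hc.smooth_jumpMapSpace hΦ hg).comp (p := fun _ u => u ⟨k, h⟩)
        (UniformlySmooth.clm hUb (ContinuousLinearMap.proj ⟨k, h⟩)) (fun _ u hu => hU u hu _)
        (hc.smooth_straight hΦ hg hU hUb x k) fun a : Fin n → ℝ => a ⟨k, h⟩
    · simpa only [straightDeriv, dif_neg h] using ih

/-- In straightened coordinates the time `u_k` acts directly only at its own jump; all other
dependence passes through the previous position. -/
theorem SmoothJump.D_straight_succ (hc : SmoothJump T c g) (hΦ : IsFlow T g Φ)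
    (hg : SmoothDrift K g) (hU : ∀ u ∈ U, ∀ i, u i ∈ Ioo 0 T) (hUb : Bornology.IsBounded U)
    (x : ℝ) {k : ℕ} (h : k < n) (i : Fin n) (a : Fin n → ℝ) {u : Fin n → ℝ} (hu : u ∈ U) :
    D i (fun u => straight c Φ x u a (k + 1)) u =
      jumpMapTime T c g Φ (u ⟨k, h⟩) (a ⟨k, h⟩) (straight c Φ x u a k)
          * (if i = ⟨k, h⟩ then 1 else 0)
        + jumpMapSpace c g Φ (u ⟨k, h⟩) (a ⟨k, h⟩) (straight c Φ x u a k)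
          * D i (fun u => straight c Φ x u a k) u := by
  have hd := (hc.smooth_straight hΦ hg hU hUb x k).differentiableAt a hu
  have h1 := hc.hasFDerivAt_jumpMap hΦ hg (a ⟨k, h⟩) (hU u hu ⟨k, h⟩) (straight c Φ x u a k)
  have h2 : HasFDerivAt (fun u : Fin n → ℝ => (u ⟨k, h⟩, straight c Φ x u a k)) _ u :=
    (ContinuousLinearMap.proj (R := ℝ) (φ := fun _ : Fin n => ℝ) ⟨k, h⟩).hasFDerivAt.prodMk
      hd.hasFDerivAt
  have h3 := HasFDerivAt.comp u h1 h2
  simp only [straight_succ x _ _ h]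
  rw [D_eq_fderiv hd]
  refine (D_eq_of_hasFDerivAt h3 i).deriv.trans ?_
  simp [Pi.single_apply, eq_comm]

/-- The recursion for the first derivative involves only functions already known to be uniformly
smooth, so it can be differentiated once more with bounds independent of the marks. -/
theorem SmoothJump.smooth_D_straight (hc : SmoothJump T c g) (hΦ : IsFlow T g Φ)
    (hg : SmoothDrift K g) (hUo : IsOpen U) (hU : ∀ u ∈ U, ∀ i, u i ∈ Ioo 0 T)
    (hUb : Bornology.IsBounded U) (x : ℝ) (k : ℕ) (i : Fin n) :
    UniformlySmooth U fun a => D i fun u => straight c Φ x u a k := by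
  induction k with
  | zero =>
    have : (fun a : Fin n → ℝ => D i fun u : Fin n → ℝ => straight c Φ x u a 0)
        = fun _ _ => 0 := by
      ext a u; simp [D, straight]
    rw [this]
    exact uniformlySmooth_const 0
  | succ k ih =>
    by_cases h : k < n
    · refine UniformlySmooth.congr ?_ hUo fun a u hu => hc.D_straight_succ hΦ hg hU hUb x h i a hu
      have hs := hc.smooth_straight hΦ hg hU hUb x k
      have hp : UniformlySmooth U fun (_ : Fin n → ℝ) (u : Fin n → ℝ) => u ⟨k, h⟩ :=
        UniformlySmooth.clm hUb (ContinuousLinearMap.proj ⟨k, h⟩)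
      refine UniformlySmooth.add (UniformlySmooth.mul ?_ (uniformlySmooth_const _))
        (UniformlySmooth.mul ?_ ih)
      · exact (hc.smooth_jumpMapTime hΦ hg).comp hp (fun _ u hu => hU u hu _) hs
          fun a : Fin n → ℝ => a ⟨k, h⟩
      · exact (hc.smooth_jumpMapSpace hΦ hg).comp hp (fun _ u hu => hU u hu _) hs
          fun a : Fin n → ℝ => a ⟨k, h⟩
    · simpa only [straight, dif_neg h] using ih

theorem SmoothJump.D_straight_eq_zero (hc : SmoothJump T c g) (hΦ : IsFlow T g Φ)
    (hg : SmoothDrift K g) (hU : ∀ u ∈ U, ∀ i, u i ∈ Ioo 0 T) (hUb : Bornology.IsBounded U)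
    (x : ℝ) {k : ℕ} {i : Fin n} (hk : k ≤ i) (a : Fin n → ℝ) {u : Fin n → ℝ} (hu : u ∈ U) :
    D i (fun u => straight c Φ x u a k) u = 0 := by
  induction k with
  | zero => simp [D, straight]
  | succ k ih =>
    have h : k < n := by omega
    rw [hc.D_straight_succ hΦ hg hU hUb x h i a hu, ih (by omega), if_neg]
    · simp
    · rintro rfl
      simp at hk

/-- In each step of the recursion one of the two terms vanishes: for the newest jump the old
position does not depend on its time, and for an older jump there is no direct dependence. The
derivative is therefore a product of factors bounded below. -/
theorem SmoothJump.exists_le_abs_D_straight (hc : SmoothJump T c g) (hΦ : IsFlow T g Φ)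
    (hg : SmoothDrift K g) {η : ℝ} (hη : 0 < η)
    (hq : ∀ t ∈ Icc 0 T, ∀ a x, η ≤ |q T c g t a x|)
    (hdx : ∀ t ∈ Icc 0 T, ∀ a x, η ≤ |1 + dxc c t a x|)
    (hU : ∀ u ∈ U, ∀ i, u i ∈ Ioo 0 T) (hUb : Bornology.IsBounded U) (x : ℝ) (k : ℕ)
    (hk : k ≤ n) :
    ∃ ε > 0, ∀ i : Fin n, (i : ℕ) < k → ∀ a, ∀ u ∈ U,
      ε ≤ |D i (fun u => straight c Φ x u a k) u| := by
  induction k with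
  | zero => exact ⟨1, one_pos, fun i hi => by omega⟩
  | succ k ih =>
    obtain ⟨ε, hε, ih⟩ := ih (by omega)
    set e := Real.exp (-(K * T))
    have he : 0 < e := Real.exp_pos _
    -- `jumpMapTime` carries one flow factor, bounded below by `e`, and `jumpMapSpace` carries two.
    refine ⟨min (η * e) (η * e * e * ε), by positivity, fun i hi a u hu => ?_⟩
    rw [hc.D_straight_succ hΦ hg hU hUb x hk i a hu]
    have huT := Ioo_subset_Icc_self (hU u hu ⟨k, hk⟩)
    rcases eq_or_lt_of_le (Nat.lt_succ_iff.1 hi) with hik | hik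
    · have : i = ⟨k, hk⟩ := Fin.ext hik
      rw [hc.D_straight_eq_zero hΦ hg hU hUb x hik.ge a hu, if_pos this, mul_one, mul_zero,
        add_zero]
      exact (min_le_left _ _).trans (le_abs_jumpMapTime hg huT (hq _ huT _) _)
    · have : i ≠ ⟨k, hk⟩ := fun h => hik.ne (congrArg Fin.val h)
      rw [if_neg this, mul_zero, zero_add, abs_mul]
      exact (min_le_right _ _).trans (mul_le_mul (le_abs_jumpMapSpace hg huT (hdx _ huT _) _)
        (ih i hik a u hu) hε.le (abs_nonneg _))

theorem SmoothJump.hasDerivAt_straight (hc : SmoothJump T c g) (hΦ : IsFlow T g Φ)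
    (hg : SmoothDrift K g) {u : Fin n → ℝ} (hu : ∀ i, u i ∈ Ioo 0 T) (a : Fin n → ℝ) (x : ℝ)
    (k : ℕ) : HasDerivAt (fun x => straight c Φ x u a k) (straightDeriv c g Φ x u a k) x := by
  induction k with
  | zero => exact hasDerivAt_id x
  | succ k ih =>
    by_cases h : k < n
    · simp only [straight_succ _ _ _ h, straightDeriv_succ _ _ _ h]
      have h1 := hc.hasFDerivAt_jumpMap hΦ hg (a ⟨k, h⟩) (hu ⟨k, h⟩) (straight c Φ x u a k)
      have h2 : HasDerivAt (fun x => (u ⟨k, h⟩, straight c Φ x u a k)) _ x :=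
        (hasDerivAt_const x (u ⟨k, h⟩)).prodMk ih
      refine (h1.comp_hasDerivAt x h2).congr_deriv ?_
      simp
    · simpa only [straight, straightDeriv, dif_neg h] using ih

/-- The outer function needs bounds on bounded sets only, since the inner values share one bound. -/
theorem UniformlySmooth.comp_deriv {A X : Type*} [NormedAddCommGroup X] [NormedSpace ℝ X]
    {U : Set X} {f : A → X → ℝ} (hf : UniformlySmooth U f) {φ : ℝ → ℝ}
    (hφ : ∀ M : ℝ, ∃ C, ∀ w, |w| ≤ M → |φ w| ≤ C ∧ ∃ d, HasDerivAt φ d w ∧ |d| ≤ C) :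
    UniformlySmooth U fun a u => φ (f a u) := by
  obtain ⟨C, hC⟩ := hf
  obtain ⟨C', hC'⟩ := hφ C
  refine ⟨max C' (C' * C), fun a u hu => ?_⟩
  obtain ⟨h1, L, hL, h2⟩ := hC a u hu
  obtain ⟨h3, d, hd, h4⟩ := hC' _ h1
  refine ⟨h3.trans (le_max_left _ _), _, hd.comp_hasFDerivAt u hL, ?_⟩
  rw [norm_smul]
  exact (mul_le_mul h4 h2 (norm_nonneg _) ((abs_nonneg _).trans h4)).trans (le_max_right _ _)

theorem IsFlow.smooth_comp (hΦ : IsFlow T g Φ) (hg : SmoothDrift K g) {t : ℝ} (ht : t ∈ Icc 0 T)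
    {A X : Type*} [NormedAddCommGroup X] [NormedSpace ℝ X] {U : Set X} {f : A → X → ℝ}
    (hf : UniformlySmooth U f) : UniformlySmooth U fun a u => Φ t (f a u) := by
  refine hf.comp_deriv fun M => ?_
  obtain ⟨C, hC⟩ := (isCompact_Icc (a := -M) (b := M)).exists_bound_of_continuousOn
    (hΦ.continuous_right hg ht).continuousOn
  refine ⟨max C (Real.exp (K * T)), fun w hw => ⟨(hC w (abs_le.1 hw)).trans (le_max_left _ _), _,
    hΦ.hasDerivAt_right hg w ht, ?_⟩⟩
  rw [abs_of_pos (flowDeriv_pos _ _)]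
  exact (flowDeriv_le hg w ht).trans (le_max_right _ _)

theorem IsFlow.smooth_flowDeriv_comp (hΦ : IsFlow T g Φ) (hg : SmoothDrift K g) {t : ℝ}
    (ht : t ∈ Icc 0 T) {A X : Type*} [NormedAddCommGroup X] [NormedSpace ℝ X] {U : Set X}
    {f : A → X → ℝ} (hf : UniformlySmooth U f) :
    UniformlySmooth U fun a u => flowDeriv g Φ t (f a u) := by
  refine hf.comp_deriv fun M => ⟨max (Real.exp (K * T)) _, fun w _ => ⟨?_, _,
    hΦ.hasDerivAt_flowDeriv_right hg w ht,
    (abs_deriv_flowDeriv_le hg w ht).trans (le_max_right _ _)⟩⟩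
  rw [abs_of_pos (flowDeriv_pos _ _)]
  exact (flowDeriv_le hg w ht).trans (le_max_left _ _)

theorem SmoothJump.D_flow_straight (hc : SmoothJump T c g) (hΦ : IsFlow T g Φ)
    (hg : SmoothDrift K g) (hU : ∀ u ∈ U, ∀ i, u i ∈ Ioo 0 T) (hUb : Bornology.IsBounded U)
    {t : ℝ} (ht : t ∈ Icc 0 T) (x : ℝ) (i : Fin n) (a : Fin n → ℝ) {u : Fin n → ℝ} (hu : u ∈ U) :
    D i (fun u => Φ t (straight c Φ x u a n)) u =
      flowDeriv g Φ t (straight c Φ x u a n) * D i (fun u => straight c Φ x u a n) u := by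
  have hd := (hc.smooth_straight hΦ hg hU hUb x n).differentiableAt a hu
  have h1 := hΦ.hasDerivAt_right hg (straight c Φ x u a n) ht
  rw [D_eq_fderiv hd]
  refine (D_eq_of_hasFDerivAt (h1.comp_hasFDerivAt u hd.hasFDerivAt) i).deriv.trans ?_
  simp

end Straight

end JumpDiffusion

namespace JumpDiffusion

open Filter Topology

/-! ### Existence and uniqueness for the equation with jumps -/

section Solution

variable {T K : ℝ} {c : ℝ → ℝ → ℝ → ℝ} {g Φ : ℝ → ℝ → ℝ} {n : ℕ}

/-- Bootstrap: integrability makes `s` continuous, so the integrand is continuous and `s` satisfies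
the differential equation, to which uniqueness applies. -/
theorem IsFlow.eq_of_integral_eq (hΦ : IsFlow T g Φ) (hg : SmoothDrift K g) {s : ℝ → ℝ}
    {v r w : ℝ} (hv : 0 ≤ v) (hvr : v ≤ r) (hr : r ≤ T)
    (hInt : IntervalIntegrable (fun ρ => g ρ (s ρ)) volume v r)
    (hs : ∀ ρ ∈ Icc v r, s ρ = Φ v w + ∫ σ in v..ρ, g σ (s σ)) : s r = Φ r w := by
  have hsc : ContinuousOn s (Icc v r) := by
    have := intervalIntegral.continuousOn_primitive_interval' hInt left_mem_uIcc
    rw [uIcc_of_le hvr] at this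
    exact (continuousOn_const.add this).congr hs
  set s' : ℝ → ℝ := fun ρ => s (projIcc v r hvr ρ) with hs'
  have hs'c : Continuous s' :=
    (continuousOn_iff_continuous_domRestrict.1 hsc).comp (continuous_projIcc (h := hvr))
  have hss : ∀ ρ ∈ Icc v r, s' ρ = s ρ := fun ρ hρ => by simp [hs', projIcc_of_mem hvr hρ]
  have hgc : Continuous fun ρ => g ρ (s' ρ) := hg.continuous.comp (continuous_id.prodMk hs'c)
  set f : ℝ → ℝ := fun ρ => Φ v w + ∫ σ in v..ρ, g σ (s' σ) with hf
  have hfd : ∀ ρ, HasDerivAt f (g ρ (s' ρ)) ρ := fun ρ =>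
    (hgc.integral_hasStrictDerivAt v ρ).hasDerivAt.const_add _
  have hfs : ∀ ρ ∈ Icc v r, f ρ = s ρ := by
    intro ρ hρ
    have e : ∫ σ in v..ρ, g σ (s' σ) = ∫ σ in v..ρ, g σ (s σ) :=
      intervalIntegral.integral_congr fun σ hσ => by
        rw [uIcc_of_le hρ.1] at hσ
        simp only [hss σ ⟨hσ.1, hσ.2.trans hρ.2⟩]
    simp only [hf]
    rw [hs ρ hρ, e]
  have := hΦ.eqOn hg (f := f) (w := w) hv hr
    (continuous_iff_continuousAt.2 fun ρ => (hfd ρ).continuousAt).continuousOn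
    (fun ρ hρ => by
      have := hfd ρ
      rw [hss ρ (Ico_subset_Icc_self hρ), ← hfs ρ (Ico_subset_Icc_self hρ)] at this
      exact this.hasDerivWithinAt) (by simp [hf]) (right_mem_Icc.2 hvr)
  rw [← hfs r (right_mem_Icc.2 hvr)]
  exact this

theorem filter_val_lt_succ {k : ℕ} (h : k < n) :
    (Finset.univ.filter fun j : Fin n => (j : ℕ) < k + 1) =
      insert ⟨k, h⟩ (Finset.univ.filter fun j : Fin n => (j : ℕ) < k) := by
  ext j
  simp only [Finset.mem_filter, Finset.mem_univ, true_and, Finset.mem_insert, Fin.ext_iff]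
  omega

theorem sum_filter_val_lt_succ {k : ℕ} (h : k < n) (J : Fin n → ℝ) :
    ∑ j with (j : Fin n).val < k + 1, J j = J ⟨k, h⟩ + ∑ j with (j : Fin n).val < k, J j := by
  rw [filter_val_lt_succ h, Finset.sum_insert (by simp)]

theorem IsFlow.flow_straight_succ (hΦ : IsFlow T g Φ) (hg : SmoothDrift K g) (x : ℝ)
    {u : Fin n → ℝ} (a : Fin n → ℝ) {k : ℕ} (h : k < n) (hu : u ⟨k, h⟩ ∈ Icc 0 T) :
    Φ (u ⟨k, h⟩) (straight c Φ x u a (k + 1)) = Φ (u ⟨k, h⟩) (straight c Φ x u a k)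
      + c (u ⟨k, h⟩) (a ⟨k, h⟩) (Φ (u ⟨k, h⟩) (straight c Φ x u a k)) := by
  rw [straight_succ x u a h, jumpMap, hΦ.flow_flowInv hg hu]

/-- Uniqueness, by induction on the number of jumps already made. After the jump at `v` the equation
restarts from `Φ v` of the next straightened position, because adding the jump is what `jumpMap`
encodes. -/
theorem IsFlow.eq_flow_straight (hΦ : IsFlow T g Φ) (hg : SmoothDrift K g) {t x : ℝ}
    (ht : t ∈ Icc 0 T) {u a : Fin n → ℝ} (hmono : StrictMono u) (hpos : ∀ i, 0 < u i)
    (hut : ∀ i, u i ≤ t) {s : ℝ → ℝ}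
    (hInt : IntervalIntegrable (fun r => g r (s r)) volume 0 T)
    (hs : ∀ r ∈ Icc 0 t, s r = x + (∑ j with u j ≤ r, c (u j) (a j) (Function.leftLim s (u j)))
      + ∫ ρ in (0 : ℝ)..r, g ρ (s ρ)) :
    s t = Φ t (straight c Φ x u a n) := by
  have hT : 0 ≤ T := ht.1.trans ht.2
  set J : Fin n → ℝ := fun j => c (u j) (a j) (Function.leftLim s (u j)) with hJ
  have hInt' : ∀ p ∈ Icc 0 T, ∀ r ∈ Icc 0 T,
      IntervalIntegrable (fun r => g r (s r)) volume p r := fun p hp r hr =>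
    hInt.mono_set (by rw [uIcc_of_le hT]; exact uIcc_subset_Icc hp hr)
  have hprim : ContinuousOn (fun r => ∫ ρ in (0 : ℝ)..r, g ρ (s ρ)) (Icc 0 T) := by
    have := intervalIntegral.continuousOn_primitive_interval' hInt left_mem_uIcc
    rwa [uIcc_of_le hT] at this
  have hsum : ∀ k r, (∀ j : Fin n, (j : ℕ) < k → u j ≤ r) → (∀ j : Fin n, k ≤ j → r < u j) →
      r ∈ Icc 0 t → s r = x + (∑ j with (j : Fin n).val < k, J j) + ∫ ρ in (0 : ℝ)..r, g ρ (s ρ) := by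
    intro k r h1 h2 hr
    rw [hs r hr]
    congr 3
    ext j
    simp only [Finset.mem_filter, Finset.mem_univ, true_and]
    refine ⟨fun h => ?_, h1 j⟩
    by_contra h3
    exact absurd (h2 j (not_lt.1 h3)) (not_lt.2 h)
  have main : ∀ k ≤ n, ∀ r, (∀ j : Fin n, (j : ℕ) < k → u j ≤ r) →
      (∀ j : Fin n, k ≤ j → r < u j) → r ∈ Icc 0 t → s r = Φ r (straight c Φ x u a k) := by
    intro k
    induction k with
    | zero =>
      intro _ r _ h2 hr
      refine hΦ.eq_of_integral_eq hg le_rfl hr.1 (hr.2.trans ht.2)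
        (hInt' _ ⟨le_rfl, hT⟩ _ ⟨hr.1, hr.2.trans ht.2⟩) fun ρ hρ => ?_
      have := hsum 0 ρ (fun j hj => by omega) (fun j hj => hρ.2.trans_lt (h2 j hj))
        ⟨hρ.1, hρ.2.trans hr.2⟩
      rw [this, hΦ.initial]
      simp [straight]
    | succ k ih =>
      intro hk r h1 h2 hr
      have hkn : k < n := hk
      set v := u ⟨k, hkn⟩ with hv
      have hvt : v ∈ Icc 0 T := ⟨(hpos _).le, (hut _).trans ht.2⟩
      obtain ⟨p, hp0, hpv, hp⟩ : ∃ p, 0 ≤ p ∧ p < v ∧ ∀ j : Fin n, (j : ℕ) < k → u j ≤ p := by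
        rcases Nat.eq_zero_or_pos k with rfl | hk0
        · exact ⟨0, le_rfl, hpos _, fun j hj => by omega⟩
        · refine ⟨u ⟨k - 1, by omega⟩, (hpos _).le, hmono (Fin.mk_lt_mk.2 (by omega)),
            fun j hj => hmono.monotone (Fin.mk_le_mk.2 (by omega))⟩
      have hleft : ∀ ρ ∈ Ioo p v, s ρ = Φ ρ (straight c Φ x u a k) ∧
          s ρ = x + (∑ j with (j : Fin n).val < k, J j) + ∫ ρ in (0 : ℝ)..ρ, g ρ (s ρ) := by
        intro ρ hρ
        have e1 : ∀ j : Fin n, (j : ℕ) < k → u j ≤ ρ := fun j hj => (hp j hj).trans hρ.1.le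
        have e2 : ∀ j : Fin n, k ≤ j → ρ < u j := fun j hj =>
          hρ.2.trans_le (hmono.monotone (Fin.mk_le_mk.2 hj))
        have e3 : ρ ∈ Icc 0 t := ⟨hp0.trans hρ.1.le, hρ.2.le.trans (hut _)⟩
        exact ⟨ih (by omega) ρ e1 e2 e3, hsum k ρ e1 e2 e3⟩
      have hnear : Ioo p v ∈ 𝓝[<] v := Ioo_mem_nhdsLT hpv
      -- The left limit at `v` is computed twice, from the flow and from the integral equation. The
      -- first identifies `leftLim`, and equality with the second rewrites everything accumulated
      -- before `v`.
      have hl1 : Tendsto s (𝓝[<] v) (𝓝 (Φ v (straight c Φ x u a k))) := by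
        refine (((hΦ.continuous _).tendsto v).mono_left nhdsWithin_le_nhds).congr' ?_
        filter_upwards [hnear] with ρ hρ using (hleft ρ hρ).1.symm
      have hl2 : Tendsto s (𝓝[<] v) (𝓝 (x + (∑ j with (j : Fin n).val < k, J j)
          + ∫ ρ in (0 : ℝ)..v, g ρ (s ρ))) := by
        have h3 : Tendsto (fun r => ∫ ρ in (0 : ℝ)..r, g ρ (s ρ)) (𝓝[<] v)
            (𝓝 (∫ ρ in (0 : ℝ)..v, g ρ (s ρ))) := by
          refine ((hprim v hvt).tendsto).mono_left ?_
          rw [nhdsWithin_le_iff]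
          filter_upwards [hnear] with ρ hρ
          exact ⟨hp0.trans hρ.1.le, hρ.2.le.trans hvt.2⟩
        refine (h3.const_add _).congr' ?_
        filter_upwards [hnear] with ρ hρ using (hleft ρ hρ).2.symm
      have heq := tendsto_nhds_unique hl1 hl2
      have hlim : Function.leftLim s v = Φ v (straight c Φ x u a k) := leftLim_eq_of_tendsto hl1
      have hvr : v ≤ r := h1 ⟨k, hkn⟩ (Nat.lt_succ_self k)
      have hrT : r ∈ Icc 0 T := ⟨hr.1, hr.2.trans ht.2⟩
      refine hΦ.eq_of_integral_eq hg hvt.1 hvr hrT.2 (hInt' _ hvt _ hrT) fun ρ hρ => ?_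
      have hρT : ρ ∈ Icc 0 T := ⟨hvt.1.trans hρ.1, hρ.2.trans hrT.2⟩
      have e := hsum (k + 1) ρ
        (fun j hj => (hmono.monotone (Fin.mk_le_mk.2 (by omega))).trans hρ.1)
        (fun j hj => hρ.2.trans_lt (h2 j hj)) ⟨hρT.1, hρ.2.trans hr.2⟩
      have hadd := intervalIntegral.integral_add_adjacent_intervals
        (hInt' 0 ⟨le_rfl, hT⟩ v hvt) (hInt' v hvt ρ hρT)
      have hflow := hΦ.flow_straight_succ (c := c) hg x a hkn hvt
      have hJk : J ⟨k, hkn⟩ = c v (a ⟨k, hkn⟩) (Φ v (straight c Φ x u a k)) := by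
        simp only [hJ, ← hv, hlim]
      rw [← hv] at hflow
      rw [e, sum_filter_val_lt_succ hkn, hflow, ← hJk, ← hadd, heq]
      ring
  exact main n le_rfl t (fun j _ => hut j) (fun j hj => absurd j.2 (not_lt.2 hj))
    (right_mem_Icc.2 ht.1)

/-! ### Construction of the solution -/

/-- The path that follows the flow between the first `k` jumps. -/
noncomputable def jumpPath (c : ℝ → ℝ → ℝ → ℝ) (Φ : ℝ → ℝ → ℝ) (x : ℝ) (u a : Fin n → ℝ) :
    ℕ → ℝ → ℝ
  | 0 => fun r => Φ r x
  | k + 1 => fun r => if h : k < n then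
      if r < u ⟨k, h⟩ then jumpPath c Φ x u a k r else Φ r (straight c Φ x u a (k + 1))
    else jumpPath c Φ x u a k r

theorem jumpPath_of_lt {x : ℝ} {u a : Fin n → ℝ} {k : ℕ} (h : k < n) {r : ℝ}
    (hr : r < u ⟨k, h⟩) : jumpPath c Φ x u a (k + 1) r = jumpPath c Φ x u a k r := by
  simp [jumpPath, h, hr]

theorem jumpPath_of_ge {x : ℝ} {u a : Fin n → ℝ} {k : ℕ} (h : k < n) {r : ℝ}
    (hr : u ⟨k, h⟩ ≤ r) :
    jumpPath c Φ x u a (k + 1) r = Φ r (straight c Φ x u a (k + 1)) := by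
  simp [jumpPath, h, not_lt.2 hr]

theorem jumpPath_eq_flow {x : ℝ} {u a : Fin n → ℝ} {k : ℕ} (hk : k ≤ n) {r : ℝ}
    (hr : ∀ j : Fin n, (j : ℕ) < k → u j ≤ r) :
    jumpPath c Φ x u a k r = Φ r (straight c Φ x u a k) := by
  cases k with
  | zero => rfl
  | succ k => exact jumpPath_of_ge hk (hr ⟨k, hk⟩ (Nat.lt_succ_self k))

/-- The induction carries the left limits at the jump times and writes the jump sum with their
explicit values: the path changes with `k`, so a sum in terms of `leftLim` would not pass unchanged
from one step to the next. -/
theorem IsFlow.jumpPath_spec (hΦ : IsFlow T g Φ) (hg : SmoothDrift K g) (hT : 0 ≤ T) (x : ℝ)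
    {u a : Fin n → ℝ} (hmono : StrictMono u) (hu : ∀ i, u i ∈ Ioo 0 T) (k : ℕ) (hk : k ≤ n) :
    IntervalIntegrable (fun r => g r (jumpPath c Φ x u a k r)) volume 0 T ∧
    (∀ j : Fin n, (j : ℕ) < k →
      Tendsto (jumpPath c Φ x u a k) (𝓝[<] u j) (𝓝 (Φ (u j) (straight c Φ x u a j)))) ∧
    ∀ r ∈ Icc 0 T, jumpPath c Φ x u a k r =
      x + (∑ j with j.val < k ∧ u j ≤ r, c (u j) (a j) (Φ (u j) (straight c Φ x u a j)))
        + ∫ ρ in (0 : ℝ)..r, g ρ (jumpPath c Φ x u a k ρ) := by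
  have hcont : ∀ w, Continuous fun r => g r (Φ r w) := fun w =>
    hg.continuous.comp (continuous_id.prodMk (hΦ.continuous w))
  induction k with
  | zero =>
    refine ⟨(hcont x).intervalIntegrable _ _, fun j hj => by omega, fun r hr => ?_⟩
    simp only [jumpPath]
    rw [hΦ.integral_eq hg x ⟨le_rfl, hT⟩ hr, hΦ.initial]
    simp
  | succ k ih =>
    obtain ⟨ih1, ih2, ih3⟩ := ih (by omega)
    have hkn : k < n := hk
    set v := u ⟨k, hkn⟩ with hv
    have hvT := Ioo_subset_Icc_self (hu ⟨k, hkn⟩)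
    have hlow : ∀ r, r < v → jumpPath c Φ x u a (k + 1) r = jumpPath c Φ x u a k r := fun r hr =>
      jumpPath_of_lt hkn hr
    have hhigh : ∀ r, v ≤ r → jumpPath c Φ x u a (k + 1) r = Φ r (straight c Φ x u a (k + 1)) :=
      fun r hr => jumpPath_of_ge hkn hr
    have hlow_int : ∀ r ∈ Icc 0 v,
        ∫ ρ in (0 : ℝ)..r, g ρ (jumpPath c Φ x u a (k + 1) ρ) =
          ∫ ρ in (0 : ℝ)..r, g ρ (jumpPath c Φ x u a k ρ) := fun r hr =>
      intervalIntegral.integral_congr_Ioo_of_le hr.1 fun ρ hρ => by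
        simp only [hlow ρ (hρ.2.trans_le hr.2)]
    have hI1 : IntervalIntegrable (fun r => g r (jumpPath c Φ x u a (k + 1) r)) volume 0 v := by
      refine IntervalIntegrable.congr_uIoo (f := fun r => g r (jumpPath c Φ x u a k r)) ?_ ?_
      · exact ih1.mono_set (by
          rw [uIcc_of_le hT]; exact uIcc_subset_Icc ⟨le_rfl, hT⟩ hvT)
      · intro ρ hρ
        rw [uIoo_of_le hvT.1] at hρ
        simp only [hlow ρ hρ.2]
    have hI2 : ∀ r, v ≤ r →
        IntervalIntegrable (fun r => g r (jumpPath c Φ x u a (k + 1) r)) volume v r := by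
      intro r hr
      refine IntervalIntegrable.congr_uIoo (f := fun r => g r (Φ r (straight c Φ x u a (k + 1))))
        ((hcont _).intervalIntegrable _ _) ?_
      intro ρ hρ
      rw [uIoo_of_le hr] at hρ
      simp only [hhigh ρ hρ.1.le]
    have hlim_k : Tendsto (jumpPath c Φ x u a (k + 1)) (𝓝[<] v)
        (𝓝 (Φ v (straight c Φ x u a k))) := by
      obtain ⟨p, hpv, hp⟩ : ∃ p < v, ∀ j : Fin n, (j : ℕ) < k → u j ≤ p := by
        rcases Nat.eq_zero_or_pos k with rfl | hk0
        · exact ⟨v - 1, by linarith, fun j hj => by omega⟩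
        · refine ⟨u ⟨k - 1, by omega⟩, hmono (Fin.mk_lt_mk.2 (by omega)),
            fun j hj => hmono.monotone (Fin.mk_le_mk.2 (by omega))⟩
      refine (((hΦ.continuous _).tendsto v).mono_left nhdsWithin_le_nhds).congr' ?_
      filter_upwards [Ioo_mem_nhdsLT hpv] with ρ hρ
      rw [hlow ρ hρ.2, jumpPath_eq_flow (by omega) fun j hj => (hp j hj).trans hρ.1.le]
    refine ⟨hI1.trans (hI2 T hvT.2), fun j hj => ?_, fun r hr => ?_⟩
    · rcases eq_or_lt_of_le (Nat.lt_succ_iff.1 hj) with hjk | hjk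
      · have : j = ⟨k, hkn⟩ := Fin.ext hjk
        subst this
        exact hlim_k
      · refine (ih2 j hjk).congr' ?_
        have : u j < v := hmono (Fin.mk_lt_mk.2 hjk)
        filter_upwards [self_mem_nhdsWithin] with ρ hρ
        exact (hlow ρ (lt_trans hρ this)).symm
    · rcases lt_or_ge r v with hrv | hrv
      · rw [hlow r hrv, hlow_int r ⟨hr.1, hrv.le⟩, ih3 r hr]
        congr 3
        ext j
        simp only [Finset.mem_filter, Finset.mem_univ, true_and]
        refine ⟨fun h => ⟨by omega, h.2⟩, fun h => ⟨?_, h.2⟩⟩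
        refine lt_of_le_of_ne (by omega) fun hjk => ?_
        have : j = ⟨k, hkn⟩ := Fin.ext hjk
        rw [this] at h
        exact absurd h.2 (not_le.2 hrv)
      · have hle : ∀ j : Fin n, (j : ℕ) < k + 1 → u j ≤ v := fun j hj =>
          hmono.monotone (Fin.mk_le_mk.2 (by omega))
        have hsum : ∀ m ≤ k + 1, ∀ r, v ≤ r → (Finset.univ.filter fun j : Fin n =>
            j.val < m ∧ u j ≤ r) = Finset.univ.filter fun j : Fin n => j.val < m := by
          intro m hm r hr
          ext j
          simp only [Finset.mem_filter, Finset.mem_univ, true_and, and_iff_left_iff_imp]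
          exact fun hj => (hle j (by omega)).trans hr
        have e1 := ih3 v hvT
        rw [jumpPath_eq_flow (by omega) fun j hj => hle j (by omega),
          hsum k (by omega) v le_rfl] at e1
        have e2 : ∫ ρ in v..r, g ρ (jumpPath c Φ x u a (k + 1) ρ)
            = Φ r (straight c Φ x u a (k + 1)) - Φ v (straight c Φ x u a (k + 1)) := by
          rw [← hΦ.integral_eq hg _ hvT hr]
          exact intervalIntegral.integral_congr_Ioo_of_le hrv fun ρ hρ => by
            simp only [hhigh ρ hρ.1.le]
        have e3 := hΦ.flow_straight_succ (c := c) hg x a hkn hvT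
        rw [← hv] at e3
        rw [hhigh r hrv, hsum (k + 1) le_rfl r hrv, sum_filter_val_lt_succ hkn,
          ← intervalIntegral.integral_add_adjacent_intervals hI1 (hI2 r hrv),
          hlow_int v (right_mem_Icc.2 hvT.1), e2, e3]
        simp only [← hv]
        linarith

theorem IsFlow.isJumpSolution_jumpPath (hΦ : IsFlow T g Φ) (hg : SmoothDrift K g) (hT : 0 ≤ T)
    (x : ℝ) {u a : Fin n → ℝ} (hmono : StrictMono u) (hu : ∀ i, u i ∈ Ioo 0 T) :
    IsJumpSolution T c g x u a (jumpPath c Φ x u a n) := by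
  obtain ⟨h1, h2, h3⟩ := hΦ.jumpPath_spec (c := c) (a := a) hg hT x hmono hu n le_rfl
  refine ⟨h1, fun t ht => ?_⟩
  rw [h3 t ht, finsum_mem_eq_finite_toFinset_sum _ (Set.toFinite _)]
  congr 2
  refine Finset.sum_congr ?_ fun j _ => ?_
  · ext j; simp
  · rw [leftLim_eq_of_tendsto (h2 j j.2)]

/-- The enumeration `e` of the jumps up to `t` lets one statement serve both the deterministic
equation with `n` jumps and the random one with an infinite sequence of atoms. -/
theorem IsFlow.eq_of_isJumpSolution (hΦ : IsFlow T g Φ) (hg : SmoothDrift K g) {ι : Type*}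
    {τ b : ι → ℝ} {t x : ℝ} (ht : t ∈ Icc 0 T) {e : Fin n → ι} (he : Function.Injective e)
    (hrange : {i | τ i ≤ t} = range e) (hmono : StrictMono fun j => τ (e j))
    (hpos : ∀ j, 0 < τ (e j)) {s : ℝ → ℝ} (hs : IsJumpSolution T c g x τ b s) :
    s t = Φ t (straight c Φ x (fun j => τ (e j)) (fun j => b (e j)) n) := by
  refine hΦ.eq_flow_straight hg ht hmono hpos (fun j => ?_) hs.intervalIntegrable fun r hr => ?_
  · have : e j ∈ {i | τ i ≤ t} := by rw [hrange]; exact mem_range_self j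
    exact this
  · rw [hs.eq r ⟨hr.1, hr.2.trans ht.2⟩]
    congr 2
    have himage : {i | τ i ≤ r} = e '' {j | τ (e j) ≤ r} := by
      ext i
      constructor
      · intro hi
        have : i ∈ {i | τ i ≤ t} := le_trans hi hr.2
        rw [hrange] at this
        obtain ⟨j, rfl⟩ := this
        exact ⟨j, hi, rfl⟩
      · rintro ⟨j, hj, rfl⟩
        exact hj
    rw [himage, finsum_mem_image he.injOn, finsum_mem_eq_finite_toFinset_sum _ (Set.toFinite _)]
    refine Finset.sum_congr ?_ fun _ _ => rfl
    ext j; simp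

theorem isJumpSolution_extendDrift_iff {ι : Type*} {τ b : ι → ℝ} {x : ℝ} {s : ℝ → ℝ}
    (hT : 0 ≤ T) :
    IsJumpSolution T c (extendDrift T g) x τ b s ↔ IsJumpSolution T c g x τ b s := by
  have h1 : ∀ r ∈ Icc 0 T, ∫ ρ in (0 : ℝ)..r, extendDrift T g ρ (s ρ)
      = ∫ ρ in (0 : ℝ)..r, g ρ (s ρ) := fun r hr =>
    intervalIntegral.integral_congr fun ρ hρ => by
      rw [uIcc_of_le hr.1] at hρ
      exact extendDrift_of_mem ⟨hρ.1, hρ.2.trans hr.2⟩ _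
  have h2 : EqOn (fun r => extendDrift T g r (s r)) (fun r => g r (s r)) (uIoc 0 T) :=
    fun ρ hρ => by
      rw [uIoc_of_le hT] at hρ
      exact extendDrift_of_mem ⟨hρ.1.le, hρ.2⟩ _
  constructor
  · rintro ⟨h3, h4⟩
    exact ⟨(intervalIntegrable_congr h2).1 h3, fun t ht => by rw [← h1 t ht]; exact h4 t ht⟩
  · rintro ⟨h3, h4⟩
    exact ⟨(intervalIntegrable_congr h2).2 h3, fun t ht => by rw [h1 t ht]; exact h4 t ht⟩

/-- `jumpPath` shows that the choice in `detSol` is not the default value, and uniqueness identifies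
whichever solution was chosen. -/
theorem IsFlow.detSol_eq (hΦ : IsFlow T (extendDrift T g) Φ)
    (hg : SmoothDrift K (extendDrift T g)) {t : ℝ} (ht : t ∈ Icc 0 T) (x : ℝ)
    {u : Fin n → ℝ} (a : Fin n → ℝ) (hmono : StrictMono u) (hu : ∀ i, u i ∈ Ioo 0 t) :
    detSol T c g x u a t = Φ t (straight c Φ x u a n) := by
  have hT := ht.1.trans ht.2
  have hex : ∃ s, IsJumpSolution T c g x u a s :=
    ⟨_, (isJumpSolution_extendDrift_iff hT).1 (hΦ.isJumpSolution_jumpPath hg hT x hmono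
      fun i => ⟨(hu i).1, (hu i).2.trans_le ht.2⟩)⟩
  rw [detSol, dif_pos hex]
  refine hΦ.eq_of_isJumpSolution hg ht (e := id) Function.injective_id ?_ hmono
    (fun i => (hu i).1) ((isJumpSolution_extendDrift_iff hT).2 hex.choose_spec)
  ext i
  simp [(hu i).2.le]

end Solution

end JumpDiffusion

namespace JumpDiffusion

open Filter Topology

/-! ### The simplex of jump times -/

section Simplex

variable {n : ℕ} {t : ℝ}

/-- The jump times completed by `0` and `t`: `0, u_1, …, u_n, t, t, …`. -/
def extTime (t : ℝ) (u : Fin n → ℝ) : ℕ → ℝ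
  | 0 => 0
  | k + 1 => if h : k < n then u ⟨k, h⟩ else t

/-- The lengths of the intervals between consecutive times of `0, u_1, …, u_n, t`. -/
def gap (t : ℝ) (u : Fin n → ℝ) (l : ℕ) : ℝ := extTime t u (l + 1) - extTime t u l

/-- The open simplex `0 < u_1 < ⋯ < u_n < t`. -/
def simplex (n : ℕ) (t : ℝ) : Set (Fin n → ℝ) := {u | ∀ l ≤ n, 0 < gap t u l}

@[simp]
theorem extTime_zero (u : Fin n → ℝ) : extTime t u 0 = 0 := rfl

/-- Shift of indices: `u i` stands at place `i + 1`, so the gaps on its two sides are `i` and `i +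
1`. -/
theorem extTime_val_succ (u : Fin n → ℝ) (i : Fin n) : extTime t u (i + 1) = u i := by
  simp [extTime]

theorem extTime_last (u : Fin n → ℝ) : extTime t u (n + 1) = t := by
  simp [extTime]

theorem prevTime_eq (t : ℝ) (u : Fin n → ℝ) (i : Fin n) : prevTime u i = extTime t u i := by
  obtain ⟨k, hk⟩ := i
  cases k with
  | zero => simp [prevTime, extTime]
  | succ k => simp [prevTime, extTime, show k < n by omega]

theorem nextTime_eq (u : Fin n → ℝ) (i : Fin n) : nextTime t u i = extTime t u (i + 2) := by
  simp [nextTime, extTime]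

theorem gap_val (u : Fin n → ℝ) (i : Fin n) : gap t u i = u i - prevTime u i := by
  rw [gap, extTime_val_succ, prevTime_eq t]

theorem gap_val_succ (u : Fin n → ℝ) (i : Fin n) : gap t u (i + 1) = nextTime t u i - u i := by
  rw [gap, extTime_val_succ, nextTime_eq]

theorem extTime_update (u : Fin n → ℝ) (i : Fin n) (y : ℝ) (k : ℕ) :
    extTime t (Function.update u i y) k = if k = i + 1 then y else extTime t u k := by
  cases k with
  | zero => simp [extTime]
  | succ k =>
    by_cases hk : k < n
    · by_cases hki : k = i
      · subst hki
        simp [extTime]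
      · have : (⟨k, hk⟩ : Fin n) ≠ i := fun h => hki (congrArg Fin.val h)
        simp [extTime, hk, hki, this]
    · have : k ≠ i := fun h => hk (h ▸ i.2)
      simp [extTime, hk, this]

theorem gap_update_of_ne (u : Fin n → ℝ) (i : Fin n) (y : ℝ) {l : ℕ} (h1 : l ≠ i)
    (h2 : l ≠ i + 1) : gap t (Function.update u i y) l = gap t u l := by
  rw [gap, gap, extTime_update, extTime_update, if_neg (by omega), if_neg h2]

theorem gap_update_val (u : Fin n → ℝ) (i : Fin n) (y : ℝ) :
    gap t (Function.update u i y) i = y - prevTime u i := by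
  rw [gap, extTime_update, extTime_update, if_pos rfl, if_neg (by omega), prevTime_eq t]

theorem gap_update_val_succ (u : Fin n → ℝ) (i : Fin n) (y : ℝ) :
    gap t (Function.update u i y) (i + 1) = nextTime t u i - y := by
  rw [gap, extTime_update, extTime_update, if_neg (by omega), if_pos rfl, nextTime_eq]

/-- Moving one time changes only the two adjacent gaps, so the slices of the simplex along a
coordinate axis are open intervals, as Fubini requires. -/
theorem update_mem_simplex_iff {u : Fin n → ℝ} (hu : u ∈ simplex n t) (i : Fin n) (y : ℝ) :
    Function.update u i y ∈ simplex n t ↔ y ∈ Ioo (prevTime u i) (nextTime t u i) := by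
  constructor
  · intro h
    have h1 := h i i.2.le
    have h2 := h (i + 1) i.2
    rw [gap_update_val] at h1
    rw [gap_update_val_succ] at h2
    exact ⟨by linarith, by linarith⟩
  · intro hy l hl
    by_cases h1 : l = i
    · rw [h1, gap_update_val]; linarith [hy.1]
    · by_cases h2 : l = i + 1
      · rw [h2, gap_update_val_succ]; linarith [hy.2]
      · rw [gap_update_of_ne u i y h1 h2]; exact hu l hl

theorem mem_Ioo_of_mem_simplex {u : Fin n → ℝ} (hu : u ∈ simplex n t) (i : Fin n) :
    u i ∈ Ioo (prevTime u i) (nextTime t u i) := by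
  rw [← update_mem_simplex_iff hu i (u i), Function.update_eq_self]
  exact hu

theorem extTime_lt_extTime {u : Fin n → ℝ} (hu : u ∈ simplex n t) {k l : ℕ} (hkl : k < l)
    (hl : l ≤ n + 1) : extTime t u k < extTime t u l := by
  induction l, hkl using Nat.le_induction with
  | base => exact sub_pos.1 (hu k (by omega))
  | succ l hkl ih => exact (ih (by omega)).trans (sub_pos.1 (hu l (by omega)))

theorem extTime_le_extTime {u : Fin n → ℝ} (hu : u ∈ simplex n t) {k l : ℕ} (hkl : k ≤ l)
    (hl : l ≤ n + 1) : extTime t u k ≤ extTime t u l := by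
  rcases hkl.eq_or_lt with rfl | h
  · exact le_rfl
  · exact (extTime_lt_extTime hu h hl).le

theorem strictMono_of_mem_simplex {u : Fin n → ℝ} (hu : u ∈ simplex n t) : StrictMono u := by
  intro i j hij
  rw [← extTime_val_succ (t := t) u i, ← extTime_val_succ (t := t) u j]
  exact extTime_lt_extTime hu (by simpa using hij) (by omega)

theorem mem_Ioo_zero_of_mem_simplex {u : Fin n → ℝ} (hu : u ∈ simplex n t) (i : Fin n) :
    u i ∈ Ioo 0 t := by
  rw [← extTime_val_succ (t := t) u i]
  constructor
  · exact extTime_lt_extTime hu (Nat.succ_pos _) (by omega)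
  · have := extTime_lt_extTime hu (k := i + 1) (l := n + 1) (by omega) le_rfl
    rwa [extTime_last] at this

theorem gap_le {u : Fin n → ℝ} (hu : u ∈ simplex n t) {l : ℕ} (hl : l ≤ n) : gap t u l ≤ t := by
  have h1 := extTime_le_extTime hu (Nat.zero_le l) (by omega)
  have h2 := extTime_le_extTime hu (k := l + 1) (l := n + 1) (by omega) le_rfl
  rw [extTime_last] at h2
  rw [extTime_zero] at h1
  rw [gap]
  linarith

theorem mem_simplex_iff (hn : 0 < n) (u : Fin n → ℝ) :
    u ∈ simplex n t ↔ StrictMono u ∧ ∀ i, u i ∈ Ioo 0 t := by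
  refine ⟨fun h => ⟨strictMono_of_mem_simplex h, mem_Ioo_zero_of_mem_simplex h⟩, ?_⟩
  rintro ⟨h1, h2⟩ l hl
  rw [gap, sub_pos]
  cases l with
  | zero => simpa [extTime, hn] using (h2 ⟨0, hn⟩).1
  | succ l =>
    have hl' : l < n := hl
    by_cases h : l + 1 < n
    · simpa [extTime, hl', h] using h1 (Fin.mk_lt_mk.2 (Nat.lt_succ_self l))
    · simpa [extTime, hl', h] using (h2 ⟨l, hl'⟩).2

theorem continuous_extTime (k : ℕ) : Continuous fun u : Fin n → ℝ => extTime t u k := by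
  cases k with
  | zero => exact continuous_const
  | succ k =>
    by_cases h : k < n
    · simpa [extTime, h] using continuous_apply _
    · simpa [extTime, h] using continuous_const

theorem continuous_gap (l : ℕ) : Continuous fun u : Fin n → ℝ => gap t u l :=
  (continuous_extTime _).sub (continuous_extTime _)

theorem isOpen_simplex (n : ℕ) (t : ℝ) : IsOpen (simplex n t) := by
  have : simplex n t = ⋂ l ∈ Finset.range (n + 1), {u | 0 < gap t u l} := by
    ext u; simp [simplex]
  rw [this]
  exact isOpen_biInter_finset fun l _ => isOpen_lt continuous_const (continuous_gap l)

theorem isBounded_simplex (n : ℕ) (t : ℝ) : Bornology.IsBounded (simplex n t) := by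
  refine (Metric.isBounded_Icc (0 : Fin n → ℝ) (fun _ => t)).subset fun u hu => ?_
  exact ⟨fun i => (mem_Ioo_zero_of_mem_simplex hu i).1.le,
    fun i => (mem_Ioo_zero_of_mem_simplex hu i).2.le⟩

/-! ### Gap coordinates and integrability of singular powers -/

theorem sum_gap (u : Fin n → ℝ) : ∑ l : Fin (n + 1), gap t u l = t := by
  have := Finset.sum_range_sub (extTime t u) (n + 1)
  rw [extTime_last, extTime_zero, sub_zero] at this
  rw [Finset.sum_range] at this
  exact this

/-- The gaps are affine in `u`; taking final time `0` gives their linear part. -/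
theorem gap_eq_gap_zero_add (u : Fin n → ℝ) (l : ℕ) :
    gap t u l = gap 0 u l + gap t (0 : Fin n → ℝ) l := by
  have h : ∀ k, extTime t u k = extTime 0 u k + extTime t (0 : Fin n → ℝ) k := by
    intro k
    cases k with
    | zero => simp [extTime]
    | succ k => by_cases h : k < n <;> simp [extTime, h]
  simp only [gap, h]
  ring

/-- All the gaps but one, as linear functions of the jump times. -/
def gapMap (m : Fin (n + 1)) : (Fin n → ℝ) →ₗ[ℝ] (Fin n → ℝ) where
  toFun u k := gap 0 u (m.succAbove k)
  map_add' u v := by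
    ext k
    have h : ∀ k, extTime 0 (u + v) k = extTime 0 u k + extTime 0 v k := by
      intro k
      cases k with
      | zero => simp [extTime]
      | succ k => by_cases h : k < n <;> simp [extTime, h]
    simp only [gap, h, Pi.add_apply]
    ring
  map_smul' c u := by
    ext k
    have h : ∀ k, extTime 0 (c • u) k = c * extTime 0 u k := by
      intro k
      cases k with
      | zero => simp [extTime]
      | succ k => by_cases h : k < n <;> simp [extTime, h]
    simp only [gap, h, Pi.smul_apply, smul_eq_mul, RingHom.id_apply]
    ring

/-- With final time `0` the gaps sum to `0`, so the omitted gap vanishes with the others, and then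
so do all partial sums, that is, the times. -/
theorem gapMap_injective (m : Fin (n + 1)) : Function.Injective (gapMap m) := by
  rw [← LinearMap.ker_eq_bot, LinearMap.ker_eq_bot']
  intro u hu
  have h0 : ∀ l : Fin (n + 1), gap 0 u l = 0 := by
    have h1 : ∀ k, gap 0 u (m.succAbove k) = 0 := fun k => congrFun hu k
    have h2 := sum_gap (t := 0) u
    rw [Fin.sum_univ_succAbove _ m, Finset.sum_eq_zero fun k _ => h1 k, add_zero] at h2
    intro l
    rcases Fin.eq_self_or_eq_succAbove m l with rfl | ⟨k, rfl⟩
    · exact h2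
    · exact h1 k
  have h3 : ∀ k ≤ n + 1, extTime 0 u k = 0 := by
    intro k
    induction k with
    | zero => simp
    | succ k ih =>
      intro hk
      have := h0 ⟨k, by omega⟩
      rw [gap, ih (by omega), sub_zero] at this
      exact this
  ext i
  rw [← extTime_val_succ (t := 0) u i, h3 _ (by omega)]
  rfl

/-- If one gap does not occur in the product, the others are coordinates with constant Jacobian.
Each lies in `(0, t]` on the simplex, and the claim reduces to a product of one-dimensional
integrable functions. -/
theorem integrableOn_prod_gap (m : Fin (n + 1)) {κ : Fin (n + 1) → ℝ → ℝ}
    (hκ : ∀ l, IntegrableOn (κ l) (Ioc 0 t)) (hm : ∀ s, κ m s = 1) :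
    IntegrableOn (fun u : Fin n → ℝ => ∏ l : Fin (n + 1), κ l (gap t u l)) (simplex n t) := by
  set h : (Fin n → ℝ) → ℝ := fun v =>
    ∏ k, (Ioc 0 t).indicator (κ (m.succAbove k)) (v k) with hh
  have h1 : Integrable h := Integrable.fintype_prod fun k =>
    (integrable_indicator_iff measurableSet_Ioc).2 (hκ _)
  have h2 : Integrable fun v => h (v + fun k => gap t (0 : Fin n → ℝ) (m.succAbove k)) :=
    h1.comp_add_right _
  have hdet : LinearMap.det (gapMap m) ≠ 0 := by
    have := (LinearEquiv.ofInjectiveEndo (gapMap m) (gapMap_injective m)).isUnit_det'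
    exact this.ne_zero
  have hmap := Measure.map_linearMap_addHaar_eq_smul_addHaar (μ := volume) hdet
  have h3 : Integrable (fun u => h (gapMap m u + fun k => gap t (0 : Fin n → ℝ) (m.succAbove k)))
      volume := by
    have hmeas : Measurable (gapMap m) := (gapMap m).continuous_of_finiteDimensional.measurable
    have h4 : Integrable (fun v => h (v + fun k => gap t (0 : Fin n → ℝ) (m.succAbove k)))
        (Measure.map (gapMap m) volume) := by
      rw [hmap]
      exact h2.smul_measure ENNReal.ofReal_ne_top
    exact h4.comp_measurable hmeas
  refine (h3.integrableOn).congr_fun (fun u hu => ?_) (isOpen_simplex n t).measurableSet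
  simp only [hh]
  rw [Fin.prod_univ_succAbove _ m, hm, one_mul]
  refine Finset.prod_congr rfl fun k _ => ?_
  have : (gapMap m u + fun k => gap t (0 : Fin n → ℝ) (m.succAbove k)) k
      = gap t u (m.succAbove k) := (gap_eq_gap_zero_add u _).symm
  rw [this, indicator_of_mem]
  exact ⟨hu _ (by omega), gap_le hu (by omega)⟩

theorem integrableOn_rpow_Ioc {r : ℝ} (hr : -1 < r) (ht : 0 ≤ t) :
    IntegrableOn (fun s : ℝ => s ^ r) (Ioc 0 t) :=
  (intervalIntegrable_iff_integrableOn_Ioc_of_le ht).1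
    (intervalIntegral.intervalIntegrable_rpow' hr)

theorem integrableOn_three_gaps {α : ℝ} (hα : α ∈ Ioo (0 : ℝ) (1 / 2)) (ht : 0 ≤ t) (hn : 4 ≤ n)
    {l j k : Fin (n + 1)} (hlj : l ≠ j) (hlk : l ≠ k) (hjk : j ≠ k) :
    IntegrableOn (fun u : Fin n → ℝ => gap t u l ^ (α - 1) * gap t u j ^ (-α) * gap t u k ^ (-α))
      (simplex n t) := by
  obtain ⟨m, hm⟩ : ∃ m : Fin (n + 1), m ∉ ({l, j, k} : Finset (Fin (n + 1))) := by
    by_contra! h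
    -- There are at least five gaps, hence one outside `{l, j, k}` that can be omitted.
    have h1 : (Finset.univ : Finset (Fin (n + 1))) ⊆ {l, j, k} := fun m _ => h m
    have h2 := (Finset.card_le_card h1).trans Finset.card_le_three
    rw [Finset.card_univ, Fintype.card_fin] at h2
    omega
  simp only [Finset.mem_insert, Finset.mem_singleton, not_or] at hm
  have := integrableOn_prod_gap (t := t) m (κ := fun i s => (if i = l then s ^ (α - 1) else 1) *
    (if i = j then s ^ (-α) else 1) * (if i = k then s ^ (-α) else 1)) (fun i => ?_)
    (fun s => by simp [hm.1, hm.2.1, hm.2.2])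
  · refine this.congr_fun (fun u _ => ?_) (isOpen_simplex n t).measurableSet
    simp only
    rw [Finset.prod_mul_distrib, Finset.prod_mul_distrib, Finset.prod_ite_eq', Finset.prod_ite_eq',
      Finset.prod_ite_eq']
    simp
  · have e1 := integrableOn_rpow_Ioc (r := α - 1) (by linarith [hα.1]) ht
    have e2 := integrableOn_rpow_Ioc (r := -α) (by linarith [hα.2]) ht
    by_cases h1 : i = l
    · subst h1; simpa [hlj, hlk] using e1
    · by_cases h2 : i = j
      · subst h2; simpa [h1, hjk] using e2
      · by_cases h3 : i = k
        · subst h3; simpa [h1, h2] using e2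
        · simp [h1, h2, h3]

/-- An index `j` such that the gaps `j` and `j + 1` are not the gap `l`. -/
def farIndex (l : ℕ) : ℕ := if l < 2 then 2 else 0

/-- A function that bounds the derivatives of the weights against the inverse of their sum. -/
noncomputable def singularBound (α t : ℝ) (u : Fin n → ℝ) : ℝ :=
  1 + ∑ l : Fin (n + 1), gap t u l ^ (α - 1) * gap t u (farIndex l) ^ (-α)
    * gap t u (farIndex l + 1) ^ (-α)

theorem integrableOn_singularBound {α : ℝ} (hα : α ∈ Ioo (0 : ℝ) (1 / 2)) (ht : 0 ≤ t)
    (hn : 4 ≤ n) : IntegrableOn (fun u : Fin n → ℝ => singularBound α t u) (simplex n t) := by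
  have hfin : volume (simplex n t) ≠ ⊤ := (isBounded_simplex n t).measure_lt_top.ne
  refine Integrable.add (integrableOn_const hfin) (integrable_finsetSum _ fun l _ => ?_)
  have hfar : farIndex (l : ℕ) ≠ l ∧ farIndex (l : ℕ) + 1 ≠ l ∧ farIndex (l : ℕ) + 1 < n + 1 := by
    unfold farIndex
    split_ifs <;> omega
  exact integrableOn_three_gaps hα ht hn (l := l) (j := ⟨farIndex l, by omega⟩)
    (k := ⟨farIndex l + 1, hfar.2.2⟩) (fun h => hfar.1 (congrArg Fin.val h).symm)
    (fun h => hfar.2.1 (congrArg Fin.val h).symm) (fun h => by simp [Fin.ext_iff] at h)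

end Simplex

end JumpDiffusion

namespace JumpDiffusion

open Filter Topology

/-! ### The weights in terms of the gaps -/

section Weights

variable {n : ℕ} {α t : ℝ}

/-- The weight `π_j(u_j)` in terms of the gaps. -/
noncomputable def gapWeight (α t : ℝ) (u : Fin n → ℝ) (j : ℕ) : ℝ :=
  gap t u (j + 1) ^ α * gap t u j ^ α

/-- The derivative of the gap `l` in the jump time `u_i`. -/
def gapSign (i l : ℕ) : ℝ := (if l = i then 1 else 0) - (if l = i + 1 then 1 else 0)

/-- The derivative of `π_j(u_j)` in the jump time `u_i`. -/
noncomputable def gapWeightDeriv (α t : ℝ) (u : Fin n → ℝ) (i j : ℕ) : ℝ :=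
  gapSign i (j + 1) * α * gap t u (j + 1) ^ (α - 1) * gap t u j ^ α +
    gap t u (j + 1) ^ α * (gapSign i j * α * gap t u j ^ (α - 1))

theorem abs_gapSign_le (i l : ℕ) : |gapSign i l| ≤ 1 := by
  unfold gapSign
  split_ifs <;> simp

theorem hasDerivAt_gap_update (u : Fin n → ℝ) (i : Fin n) (l : ℕ) (y : ℝ) :
    HasDerivAt (fun y => gap t (Function.update u i y) l) (gapSign i l) y := by
  have h : ∀ k : ℕ, HasDerivAt (fun y => extTime t (Function.update u i y) k)
      (if k = i + 1 then 1 else 0) y := by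
    intro k
    simp only [extTime_update]
    split_ifs
    · exact hasDerivAt_id y
    · exact hasDerivAt_const y _
  refine ((h (l + 1)).sub (h l)).congr_deriv ?_
  simp [gapSign]

theorem hasDerivAt_gapWeight {u : Fin n → ℝ} (hu : u ∈ simplex n t) (i j : Fin n) :
    HasDerivAt (fun y => gapWeight α t (Function.update u i y) j) (gapWeightDeriv α t u i j)
      (u i) := by
  have h : ∀ l ≤ n, HasDerivAt (fun y => gap t (Function.update u i y) l ^ α)
      (gapSign i l * α * gap t u l ^ (α - 1)) (u i) := by
    intro l hl
    have := (hasDerivAt_gap_update (t := t) u i l (u i)).rpow_const (p := α)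
      (Or.inl (by rw [Function.update_eq_self]; exact (hu l hl).ne'))
    rwa [Function.update_eq_self] at this
  have := (h (j + 1) j.2).mul (h j j.2.le)
  simp only [Function.update_eq_self] at this
  exact this

theorem weight_eq_gapWeight {u : Fin n → ℝ} (hu : u ∈ simplex n t) (j : Fin n) :
    weight α t j u (u j) = gapWeight α t u j := by
  rw [weight, indicator_of_mem (Ioo_subset_Icc_self (mem_Ioo_of_mem_simplex hu j)), gapWeight,
    gap_val, gap_val_succ]

theorem eventually_update_mem {u : Fin n → ℝ} (hu : u ∈ simplex n t) (i : Fin n) :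
    ∀ᶠ y in 𝓝 (u i), Function.update u i y ∈ simplex n t := by
  filter_upwards [isOpen_Ioo.mem_nhds (mem_Ioo_of_mem_simplex hu i)] with y hy
  exact (update_mem_simplex_iff hu i y).2 hy

theorem hasDerivAt_weight_update {u : Fin n → ℝ} (hu : u ∈ simplex n t) (i j : Fin n) :
    HasDerivAt (fun y => weight α t j (Function.update u i y) (Function.update u i y j))
      (gapWeightDeriv α t u i j) (u i) := by
  refine (hasDerivAt_gapWeight hu i j).congr_of_eventuallyEq ?_
  filter_upwards [eventually_update_mem hu i] with y hy
  exact weight_eq_gapWeight hy j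

theorem prevTime_update_self (u : Fin n → ℝ) (i : Fin n) (y : ℝ) :
    prevTime (Function.update u i y) i = prevTime u i := by
  rw [prevTime_eq 0, prevTime_eq 0, extTime_update, if_neg (by omega)]

theorem nextTime_update_self (u : Fin n → ℝ) (i : Fin n) (y : ℝ) :
    nextTime t (Function.update u i y) i = nextTime t u i := by
  rw [nextTime_eq, nextTime_eq, extTime_update, if_neg (by omega)]

/-- The neighbours of `u_i` do not move with `u_i`, so `π_i'` in the definition of `L` agrees with
the partial derivative of `π_i(u_i)`. -/
theorem deriv_weight {u : Fin n → ℝ} (hu : u ∈ simplex n t) (i : Fin n) :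
    deriv (weight α t i u) (u i) = gapWeightDeriv α t u i i := by
  rw [← (hasDerivAt_weight_update hu i i).deriv]
  congr 1
  ext y
  simp only [weight, prevTime_update_self, nextTime_update_self, Function.update_self]

theorem gapWeight_pos {u : Fin n → ℝ} (hu : u ∈ simplex n t) (j : Fin n) :
    0 < gapWeight α t u j :=
  mul_pos (Real.rpow_pos_of_pos (hu _ j.2) _) (Real.rpow_pos_of_pos (hu _ j.2.le) _)

theorem abs_gapWeightDeriv_le (hα : α ∈ Ioo (0 : ℝ) (1 / 2)) {u : Fin n → ℝ}
    (hu : u ∈ simplex n t) (i j : Fin n) :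
    |gapWeightDeriv α t u i j| ≤ 2 * t ^ α * ∑ l : Fin (n + 1), gap t u l ^ (α - 1) := by
  have ht : 0 < t := (hu 0 (Nat.zero_le _)).trans_le (gap_le hu (Nat.zero_le _))
  have hpow : ∀ l ≤ n, 0 ≤ gap t u l ^ α ∧ gap t u l ^ α ≤ t ^ α := fun l hl =>
    ⟨Real.rpow_nonneg (hu l hl).le _, Real.rpow_le_rpow (hu l hl).le (gap_le hu hl) hα.1.le⟩
  have hsing : ∀ l ≤ n, 0 ≤ gap t u l ^ (α - 1) ∧
      gap t u l ^ (α - 1) ≤ ∑ l : Fin (n + 1), gap t u l ^ (α - 1) := fun l hl =>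
    ⟨Real.rpow_nonneg (hu l hl).le _, Finset.single_le_sum (s := Finset.univ)
      (f := fun l : Fin (n + 1) => gap t u l ^ (α - 1)) (fun m _ =>
        Real.rpow_nonneg (hu m (by omega)).le _) (Finset.mem_univ ⟨l, by omega⟩)⟩
  set Sg := ∑ l : Fin (n + 1), gap t u l ^ (α - 1)
  have key : ∀ l ≤ n, |gapSign i l * α * gap t u l ^ (α - 1)| ≤ Sg := by
    intro l hl
    rw [abs_mul, abs_mul, abs_of_pos hα.1, abs_of_nonneg (hsing l hl).1]
    calc |gapSign i l| * α * gap t u l ^ (α - 1) ≤ 1 * 1 * Sg :=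
          mul_le_mul (mul_le_mul (abs_gapSign_le _ _) (by linarith [hα.2]) hα.1.le zero_le_one)
            (hsing l hl).2 (hsing l hl).1 (by norm_num)
      _ = Sg := by ring
  have hS0 : 0 ≤ Sg := (hsing 0 (Nat.zero_le _)).1.trans (hsing 0 (Nat.zero_le _)).2
  refine (abs_add_le _ _).trans ?_
  rw [abs_mul _ (gap t u j ^ α), abs_mul (gap t u (j + 1) ^ α), abs_of_nonneg (hpow j j.2.le).1,
    abs_of_nonneg (hpow (j + 1) j.2).1]
  have h1 := mul_le_mul (key (j + 1) j.2) (hpow j j.2.le).2 (hpow j j.2.le).1 hS0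
  have h2 := mul_le_mul (hpow (j + 1) j.2).2 (key j j.2.le) (abs_nonneg _)
    (Real.rpow_nonneg ht.le α)
  linarith

theorem one_le_singularBound {u : Fin n → ℝ} (hn : 4 ≤ n) (hu : u ∈ simplex n t) :
    1 ≤ singularBound α t u := by
  refine le_add_of_nonneg_right (Finset.sum_nonneg fun l _ => ?_)
  have h1 : farIndex l ≤ n := by unfold farIndex; split_ifs <;> omega
  have h2 : farIndex l + 1 ≤ n := by unfold farIndex; split_ifs <;> omega
  exact mul_nonneg (mul_nonneg (Real.rpow_nonneg (hu l (by omega)).le _)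
    (Real.rpow_nonneg (hu _ h1).le _)) (Real.rpow_nonneg (hu _ h2).le _)

/-- The factor `γ` is bounded by `e` over any single weight, and that weight is chosen separately
for each singular gap `l`, at `farIndex l`, so that no gap appears twice. -/
theorem mul_sum_gap_le {u : Fin n → ℝ} (hn : 4 ≤ n) (hu : u ∈ simplex n t) {γ e : ℝ}
    (he : 0 ≤ e) (hγ : ∀ j : Fin n, γ * gapWeight α t u j ≤ e) :
    γ * ∑ l : Fin (n + 1), gap t u l ^ (α - 1) ≤ e * singularBound α t u := by
  rw [singularBound, mul_add, Finset.mul_sum, Finset.mul_sum]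
  refine le_add_of_nonneg_of_le (by positivity) (Finset.sum_le_sum fun l _ => ?_)
  have h1 : farIndex l < n := by unfold farIndex; split_ifs <;> omega
  have hpos := gapWeight_pos (α := α) hu ⟨farIndex l, h1⟩
  have h3 := hγ ⟨farIndex l, h1⟩
  rw [← le_div_iff₀ hpos] at h3
  have h4 := mul_le_mul_of_nonneg_right h3
    (Real.rpow_nonneg (hu l (by omega)).le (α - 1))
  refine h4.trans (le_of_eq ?_)
  rw [gapWeight, Real.rpow_neg (hu _ h1.le).le, Real.rpow_neg (hu _ h1).le]
  have p1 := (Real.rpow_pos_of_pos (hu _ h1.le) α).ne'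
  have p2 := (Real.rpow_pos_of_pos (hu _ h1) α).ne'
  field_simp

end Weights

/-! ### Integration by parts on the simplex -/

section IntegrationByParts

variable {n : ℕ} {α t C ε : ℝ} {F G : (Fin n → ℝ) → ℝ} {φ : ℝ → ℝ}

/-- The hypotheses on the functionals `F` and `G` and the test function `φ` under which one can
integrate by parts, with the constants that control all the bounds. -/
structure IsIBPPair (t C ε : ℝ) (φ : ℝ → ℝ) (F G : (Fin n → ℝ) → ℝ) : Prop where
  pos : 0 < ε
  differentiable : Differentiable ℝ φ
  bound : ∀ u ∈ simplex n t, |φ (F u)| ≤ C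
  bound_deriv : ∀ u ∈ simplex n t, |deriv φ (F u)| ≤ C
  differentiableAt : ∀ u ∈ simplex n t, DifferentiableAt ℝ F u
  differentiableAt_D : ∀ i, ∀ u ∈ simplex n t, DifferentiableAt ℝ (D i F) u
  differentiableAt_right : ∀ u ∈ simplex n t, DifferentiableAt ℝ G u
  bound_D : ∀ i, ∀ u ∈ simplex n t, |D i F u| ≤ C
  bound_D_D : ∀ i j, ∀ u ∈ simplex n t, |D i (D j F) u| ≤ C
  bound_right : ∀ u ∈ simplex n t, |G u| ≤ C
  bound_D_right : ∀ i, ∀ u ∈ simplex n t, |D i G u| ≤ C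
  le_abs_D : ∀ i, ∀ u ∈ simplex n t, ε ≤ |D i F u|

/-- The function whose derivative in `u_i` is integrated. -/
noncomputable def ibpTerm (α t : ℝ) (φ : ℝ → ℝ) (F G : (Fin n → ℝ) → ℝ) (i : Fin n)
    (u : Fin n → ℝ) : ℝ :=
  φ (F u) * (weight α t i u (u i) * D i F u * G u * gamma α t F u)

theorem sigma_eq {u : Fin n → ℝ} (hu : u ∈ simplex n t) :
    sigma α t F u = ∑ j : Fin n, gapWeight α t u j * D j F u * D j F u := by
  simp only [sigma, innerPi, weight_eq_gapWeight hu]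

/-- All terms of `σ_F` are nonnegative and every `|D_jF|` is at least `ε`, so any one index bounds
`σ_F` below; the freedom in `j` is essential later. -/
theorem IsIBPPair.gapWeight_le_sigma (h : IsIBPPair t C ε φ F G) {u : Fin n → ℝ}
    (hu : u ∈ simplex n t) (j : Fin n) : ε ^ 2 * gapWeight α t u j ≤ sigma α t F u := by
  rw [sigma_eq hu]
  have h1 : ε ^ 2 * gapWeight α t u j ≤ gapWeight α t u j * D j F u * D j F u := by
    have h2 := pow_le_pow_left₀ h.pos.le (h.le_abs_D j u hu) 2
    rw [sq_abs] at h2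
    have h3 := gapWeight_pos (α := α) hu j
    nlinarith
  refine h1.trans (Finset.single_le_sum
    (f := fun j : Fin n => gapWeight α t u j * D j F u * D j F u) (fun k _ => ?_)
    (Finset.mem_univ j))
  rw [mul_assoc]
  exact mul_nonneg (gapWeight_pos hu k).le (mul_self_nonneg _)

theorem IsIBPPair.sigma_pos (h : IsIBPPair t C ε φ F G) (hn : 0 < n) {u : Fin n → ℝ}
    (hu : u ∈ simplex n t) : 0 < sigma α t F u :=
  (mul_pos (pow_pos h.pos 2) (gapWeight_pos hu ⟨0, hn⟩)).trans_le (h.gapWeight_le_sigma hu _)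

theorem IsIBPPair.gamma_mul_gapWeight_le (h : IsIBPPair t C ε φ F G) {u : Fin n → ℝ}
    (hu : u ∈ simplex n t) (j : Fin n) :
    gamma α t F u * gapWeight α t u j ≤ (ε ^ 2)⁻¹ := by
  have hp := pow_pos h.pos 2
  have hs := h.sigma_pos (α := α) j.pos hu
  have := h.gapWeight_le_sigma (α := α) hu j
  rw [gamma, ← div_eq_inv_mul, div_le_iff₀ hs, ← div_eq_inv_mul, le_div_iff₀ hp]
  linarith

/-- The derivative of `σ_F` in `u_i`. -/
noncomputable def sigmaDeriv (α t : ℝ) (F : (Fin n → ℝ) → ℝ) (i : Fin n) (u : Fin n → ℝ) : ℝ :=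
  ∑ j : Fin n, (gapWeightDeriv α t u i j * (D j F u * D j F u)
    + gapWeight α t u j * (2 * D j F u * D i (D j F) u))

theorem IsIBPPair.hasDerivAt_sigma (h : IsIBPPair t C ε φ F G) {u : Fin n → ℝ}
    (hu : u ∈ simplex n t) (i : Fin n) :
    HasDerivAt (fun y => sigma α t F (Function.update u i y)) (sigmaDeriv α t F i u) (u i) := by
  unfold sigma innerPi sigmaDeriv
  refine HasDerivAt.fun_sum fun j _ => ?_
  have h1 := hasDerivAt_weight_update (α := α) hu i j
  have h2 := hasDerivAt_D (h.differentiableAt_D j u hu) i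
  refine ((h1.mul h2).mul h2).congr_deriv ?_
  simp only [Pi.mul_apply, Function.update_eq_self, weight_eq_gapWeight hu]
  ring

theorem IsIBPPair.hasDerivAt_gamma (h : IsIBPPair t C ε φ F G) {u : Fin n → ℝ}
    (hu : u ∈ simplex n t) (i : Fin n) :
    HasDerivAt (fun y => gamma α t F (Function.update u i y))
      (-sigmaDeriv α t F i u * gamma α t F u ^ 2) (u i) := by
  have hs := h.sigma_pos (α := α) i.pos hu
  have := (h.hasDerivAt_sigma (α := α) hu i).inv
    (by rw [Function.update_eq_self]; exact hs.ne')
  refine this.congr_deriv ?_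
  rw [Function.update_eq_self, gamma]
  field_simp

theorem IsIBPPair.D_gamma (h : IsIBPPair t C ε φ F G) {u : Fin n → ℝ}
    (hu : u ∈ simplex n t) (i : Fin n) :
    D i (gamma α t F) u = -sigmaDeriv α t F i u * gamma α t F u ^ 2 :=
  (h.hasDerivAt_gamma hu i).deriv

/-- The derivative of `ibpTerm` in `u_i`. -/
noncomputable def ibpDeriv (α t : ℝ) (φ : ℝ → ℝ) (F G : (Fin n → ℝ) → ℝ) (i : Fin n)
    (u : Fin n → ℝ) : ℝ :=
  deriv φ (F u) * D i F u * (weight α t i u (u i) * D i F u * G u * gamma α t F u) +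
    φ (F u) * (deriv (weight α t i u) (u i) * D i F u * G u * gamma α t F u
      + weight α t i u (u i) * D i (D i F) u * G u * gamma α t F u
      + weight α t i u (u i) * D i F u * D i G u * gamma α t F u
      + weight α t i u (u i) * D i F u * G u * D i (gamma α t F) u)

theorem IsIBPPair.hasDerivAt_ibpTerm (h : IsIBPPair t C ε φ F G) {u : Fin n → ℝ}
    (hu : u ∈ simplex n t) (i : Fin n) :
    HasDerivAt (fun y => ibpTerm α t φ F G i (Function.update u i y))
      (ibpDeriv α t φ F G i u) (u i) := by
  have hF := hasDerivAt_D (h.differentiableAt u hu) i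
  have hφ : HasDerivAt φ (deriv φ (F u)) (F (Function.update u i (u i))) := by
    rw [Function.update_eq_self]; exact (h.differentiable _).hasDerivAt
  have h0 := hφ.comp (u i) hF
  have h1 := hasDerivAt_weight_update (α := α) hu i i
  have h2 := hasDerivAt_D (h.differentiableAt_D i u hu) i
  have h3 := hasDerivAt_D (h.differentiableAt_right u hu) i
  have h4 := h.hasDerivAt_gamma (α := α) hu i
  rw [← h.D_gamma hu i] at h4
  rw [← deriv_weight hu i] at h1
  refine (h0.mul (((h1.mul h2).mul h3).mul h4)).congr_deriv ?_
  simp only [Function.update_eq_self, Function.comp, Pi.mul_apply]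
  rw [ibpDeriv]
  ring

/-- When the product is differentiated, the terms with `φ'` collapse by `γ_F ⟨DF, DF⟩_π = 1`; the
terms with `φ` are those of `-H`, the first two groups making up `L F`. -/
theorem IsIBPPair.sum_ibpDeriv (h : IsIBPPair t C ε φ F G) (hn : 0 < n) {u : Fin n → ℝ}
    (hu : u ∈ simplex n t) :
    ∑ i, ibpDeriv α t φ F G i u = deriv φ (F u) * G u - φ (F u) * H α t F G u := by
  have hs := h.sigma_pos (α := α) hn hu
  have h1 : gamma α t F u * innerPi α t (fun i => D i F) (fun i => D i F) u = 1 :=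
    inv_mul_cancel₀ hs.ne'
  have h2 : deriv φ (F u) * G u = deriv φ (F u) * G u *
      (gamma α t F u * innerPi α t (fun i => D i F) (fun i => D i F) u) := by rw [h1, mul_one]
  rw [h2, H, L]
  simp only [innerPi, ibpDeriv, Finset.mul_sum, Finset.sum_add_distrib, mul_add, mul_sub, mul_neg,
    neg_add_rev]
  have e : ∀ (f k : Fin n → ℝ), (∀ i, f i = k i) → ∑ i, f i = ∑ i, k i := fun f k hfk =>
    Finset.sum_congr rfl fun i _ => hfk i
  rw [e (fun i => deriv φ (F u) * D i F u *
      (weight α t i u (u i) * D i F u * G u * gamma α t F u))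
    (fun i => deriv φ (F u) * G u * (gamma α t F u *
      (weight α t i u (u i) * D i F u * D i F u))) (fun i => by ring),
    e (fun i => φ (F u) * (deriv (weight α t i u) (u i) * D i F u * G u * gamma α t F u))
    (fun i => φ (F u) * (G u * gamma α t F u * (deriv (weight α t i u) (u i) * D i F u)))
      (fun i => by ring),
    e (fun i => φ (F u) * (weight α t i u (u i) * D i (D i F) u * G u * gamma α t F u))
    (fun i => φ (F u) * (G u * gamma α t F u * (weight α t i u (u i) * D i (D i F) u)))
      (fun i => by ring),
    e (fun i => φ (F u) * (weight α t i u (u i) * D i F u * D i G u * gamma α t F u))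
    (fun i => φ (F u) * (gamma α t F u * (weight α t i u (u i) * D i F u * D i G u)))
      (fun i => by ring),
    e (fun i => φ (F u) * (weight α t i u (u i) * D i F u * G u * D i (gamma α t F) u))
    (fun i => φ (F u) * (G u * (weight α t i u (u i) * D i F u * D i (gamma α t F) u)))
      (fun i => by ring)]
  ring

theorem abs_mul_le_mul {a b A B : ℝ} (ha : |a| ≤ A) (hb : |b| ≤ B) : |a * b| ≤ A * B := by
  rw [abs_mul]
  exact mul_le_mul ha hb (abs_nonneg _) ((abs_nonneg _).trans ha)

theorem IsIBPPair.gamma_mul_abs_gapWeightDeriv_le (h : IsIBPPair t C ε φ F G)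
    (hα : α ∈ Ioo (0 : ℝ) (1 / 2)) (hn : 4 ≤ n) {u : Fin n → ℝ} (hu : u ∈ simplex n t)
    (i j : Fin n) :
    gamma α t F u * |gapWeightDeriv α t u i j| ≤
      2 * t ^ α * ((ε ^ 2)⁻¹ * singularBound α t u) := by
  have ht : 0 < t := (hu 0 (Nat.zero_le _)).trans_le (gap_le hu (Nat.zero_le _))
  have hγ : 0 ≤ gamma α t F u := (inv_pos.2 (h.sigma_pos i.pos hu)).le
  have hp := pow_pos h.pos 2
  have h1 := mul_sum_gap_le (α := α) hn hu (inv_pos.2 hp).le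
    (fun j => h.gamma_mul_gapWeight_le (α := α) hu j)
  have h2 := mul_le_mul_of_nonneg_left (abs_gapWeightDeriv_le hα hu i j) hγ
  have h3 := Real.rpow_nonneg ht.le α
  calc _ ≤ _ := h2
    _ = 2 * t ^ α * (gamma α t F u * ∑ l : Fin (n + 1), gap t u l ^ (α - 1)) := by ring
    _ ≤ _ := by gcongr

/-- Here `Dγ_F = -γ_F² Dσ_F`. One factor `γ_F` is absorbed by the weight `π_i`, the other tames
`Dσ_F`, so `singularBound` occurs only to the first power. -/
theorem IsIBPPair.gapWeight_mul_abs_D_gamma_le (h : IsIBPPair t C ε φ F G)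
    (hα : α ∈ Ioo (0 : ℝ) (1 / 2)) (hn : 4 ≤ n) {u : Fin n → ℝ} (hu : u ∈ simplex n t)
    (i : Fin n) :
    gapWeight α t u i * |D i (gamma α t F) u| ≤
      (ε ^ 2)⁻¹ * (n * (2 * t ^ α * ((ε ^ 2)⁻¹ * singularBound α t u) * (C * C)
        + (ε ^ 2)⁻¹ * (2 * C * C))) := by
  have hγ : 0 ≤ gamma α t F u := (inv_pos.2 (h.sigma_pos i.pos hu)).le
  have hp := pow_pos h.pos 2
  have h1 : gamma α t F u * |sigmaDeriv α t F i u| ≤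
      n * (2 * t ^ α * ((ε ^ 2)⁻¹ * singularBound α t u) * (C * C)
        + (ε ^ 2)⁻¹ * (2 * C * C)) := by
    refine (mul_le_mul_of_nonneg_left (Finset.abs_sum_le_sum_abs _ _) hγ).trans ?_
    rw [Finset.mul_sum]
    refine (Finset.sum_le_card_nsmul Finset.univ _ _ fun j _ => ?_).trans
      (le_of_eq (by rw [Finset.card_univ, Fintype.card_fin, nsmul_eq_mul]))
    refine (mul_le_mul_of_nonneg_left (abs_add_le _ _) hγ).trans ?_
    rw [mul_add, abs_mul, abs_mul (gapWeight α t u j), ← mul_assoc, ← mul_assoc,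
      abs_of_pos (gapWeight_pos hu j)]
    have d1 := h.bound_D j u hu
    have d2 := h.bound_D_D i j u hu
    have e1 := h.gamma_mul_abs_gapWeightDeriv_le hα hn hu i j
    have e2 := h.gamma_mul_gapWeight_le (α := α) hu j
    refine add_le_add (mul_le_mul e1 (abs_mul_le_mul d1 d1) (abs_nonneg _) ?_)
      (mul_le_mul e2 (abs_mul_le_mul (abs_mul_le_mul ?_ d1) d2) (abs_nonneg _) (by positivity))
    · exact (mul_nonneg hγ (abs_nonneg _)).trans e1
    · norm_num
  rw [h.D_gamma hu i, abs_mul, abs_neg, abs_of_nonneg (sq_nonneg (gamma α t F u))]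
  calc gapWeight α t u i * (|sigmaDeriv α t F i u| * gamma α t F u ^ 2)
      = (gamma α t F u * gapWeight α t u i) * (gamma α t F u * |sigmaDeriv α t F i u|) := by ring
    _ ≤ _ := mul_le_mul (h.gamma_mul_gapWeight_le hu i) h1 (mul_nonneg hγ (abs_nonneg _))
      (by positivity)

/-- The constant that bounds `ibpDeriv`. -/
noncomputable def ibpConst (n : ℕ) (α t C ε : ℝ) : ℝ :=
  C * C * ((ε ^ 2)⁻¹ * C * C) + C * (2 * t ^ α * (ε ^ 2)⁻¹ * C * C + (ε ^ 2)⁻¹ * C * C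
    + (ε ^ 2)⁻¹ * C * C + (ε ^ 2)⁻¹ * (n * (2 * t ^ α * (ε ^ 2)⁻¹ * (C * C)
        + (ε ^ 2)⁻¹ * (2 * C * C))) * C * C)

theorem IsIBPPair.abs_ibpDeriv_le (h : IsIBPPair t C ε φ F G) (hα : α ∈ Ioo (0 : ℝ) (1 / 2))
    (hn : 4 ≤ n) {u : Fin n → ℝ} (hu : u ∈ simplex n t) (i : Fin n) :
    |ibpDeriv α t φ F G i u| ≤ ibpConst n α t C ε * singularBound α t u := by
  have ht : 0 < t := (hu 0 (Nat.zero_le _)).trans_le (gap_le hu (Nat.zero_le _))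
  have htα := Real.rpow_nonneg ht.le α
  have hγ : 0 ≤ gamma α t F u := (inv_pos.2 (h.sigma_pos i.pos hu)).le
  have hp := inv_pos.2 (pow_pos h.pos 2)
  have hw := gapWeight_pos (α := α) hu i
  have hB := one_le_singularBound (α := α) hn hu
  set B := singularBound α t u
  set e := (ε ^ 2)⁻¹
  have d1 := h.bound_D i u hu
  have d2 := h.bound_D_D i i u hu
  have d3 := h.bound_right u hu
  have d4 := h.bound_D_right i u hu
  have hC : 0 ≤ C := (abs_nonneg _).trans d1
  have b1 : |gamma α t F u * gapWeight α t u i| ≤ e := by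
    rw [abs_of_nonneg (mul_nonneg hγ hw.le)]
    exact h.gamma_mul_gapWeight_le hu i
  have b2 : |gamma α t F u * gapWeightDeriv α t u i i| ≤ 2 * t ^ α * (e * B) := by
    rw [abs_mul, abs_of_nonneg hγ]
    exact h.gamma_mul_abs_gapWeightDeriv_le hα hn hu i i
  have b3 : |gapWeight α t u i * D i (gamma α t F) u| ≤ e * (n * (2 * t ^ α * (e * B) * (C * C)
      + e * (2 * C * C))) := by
    rw [abs_mul, abs_of_pos hw]
    exact h.gapWeight_mul_abs_D_gamma_le hα hn hu i
  rw [ibpDeriv, weight_eq_gapWeight hu, deriv_weight hu]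
  have r1 : |deriv φ (F u) * D i F u * (gapWeight α t u i * D i F u * G u * gamma α t F u)| ≤
      C * C * (e * C * C) := by
    have := abs_mul_le_mul (abs_mul_le_mul (h.bound_deriv u hu) d1)
      (abs_mul_le_mul (abs_mul_le_mul b1 d1) d3)
    rwa [show gamma α t F u * gapWeight α t u i * D i F u * G u
      = gapWeight α t u i * D i F u * G u * gamma α t F u by ring] at this
  have r2 : |gapWeightDeriv α t u i i * D i F u * G u * gamma α t F u| ≤
      2 * t ^ α * (e * B) * C * C := by
    have := abs_mul_le_mul (abs_mul_le_mul b2 d1) d3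
    rwa [show gamma α t F u * gapWeightDeriv α t u i i * D i F u * G u
      = gapWeightDeriv α t u i i * D i F u * G u * gamma α t F u by ring] at this
  have r3 : |gapWeight α t u i * D i (D i F) u * G u * gamma α t F u| ≤ e * C * C := by
    have := abs_mul_le_mul (abs_mul_le_mul b1 d2) d3
    rwa [show gamma α t F u * gapWeight α t u i * D i (D i F) u * G u
      = gapWeight α t u i * D i (D i F) u * G u * gamma α t F u by ring] at this
  have r4 : |gapWeight α t u i * D i F u * D i G u * gamma α t F u| ≤ e * C * C := by
    have := abs_mul_le_mul (abs_mul_le_mul b1 d1) d4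
    rwa [show gamma α t F u * gapWeight α t u i * D i F u * D i G u
      = gapWeight α t u i * D i F u * D i G u * gamma α t F u by ring] at this
  have r5 : |gapWeight α t u i * D i F u * G u * D i (gamma α t F) u| ≤
      e * (n * (2 * t ^ α * (e * B) * (C * C) + e * (2 * C * C))) * C * C := by
    have := abs_mul_le_mul (abs_mul_le_mul b3 d1) d3
    rwa [show gapWeight α t u i * D i (gamma α t F) u * D i F u * G u
      = gapWeight α t u i * D i F u * G u * D i (gamma α t F) u by ring] at this
  refine (abs_add_le _ _).trans ((add_le_add r1 (abs_mul_le_mul (h.bound u hu)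
    ((abs_add_le _ _).trans (add_le_add ((abs_add_le _ _).trans (add_le_add
      ((abs_add_le _ _).trans (add_le_add r2 r3)) r4)) r5)))).trans ?_)
  -- The terms without singularity are multiplied by `B ≥ 1` to fit the common form; `hdiff` is the
  -- total excess.
  have hB0 : 0 ≤ B - 1 := sub_nonneg.2 hB
  have hdiff : 0 ≤ (B - 1) * (C * C * (e * C * C) + C * (e * C * C + e * C * C
      + e * (n * (e * (2 * C * C))) * C * C)) := by positivity
  rw [ibpConst]
  refine le_of_sub_nonneg (hdiff.trans (le_of_eq ?_))
  ring

/-- An index whose gaps are disjoint from the gaps `i` and `i + 1`. -/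
def farFromBoth (i : ℕ) : ℕ := if i < 2 then 3 else 0

/-- The weight at `farFromBoth i` does not feel a change of `u_i`, so it bounds `γ_F` on the whole
slice and the term is dominated by `π_i`. For `i = 1` in this numbering from `0`, the first free
pair of gaps is `3, 4`, which requires `n ≥ 4`. -/
theorem IsIBPPair.abs_ibpTerm_update_le (h : IsIBPPair t C ε φ F G) (hn : 4 ≤ n)
    {u : Fin n → ℝ} (hu : u ∈ simplex n t) (i : Fin n) :
    ∃ M, ∀ y ∈ Ioo (prevTime u i) (nextTime t u i),
      |ibpTerm α t φ F G i (Function.update u i y)| ≤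
        M * ((nextTime t u i - y) ^ α * (y - prevTime u i) ^ α) := by
  have hj : farFromBoth i < n := by unfold farFromBoth; split_ifs <;> omega
  have hne : farFromBoth i ≠ i ∧ farFromBoth i ≠ i + 1 ∧ farFromBoth i + 1 ≠ i ∧
      farFromBoth i + 1 ≠ i + 1 := by
    unfold farFromBoth; split_ifs <;> omega
  set j : Fin n := ⟨farFromBoth i, hj⟩
  have hwj := gapWeight_pos (α := α) hu j
  refine ⟨C * (C * C * ((ε ^ 2)⁻¹ / gapWeight α t u j)), fun y hy => ?_⟩
  set v := Function.update u i y with hv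
  have hvU : v ∈ simplex n t := (update_mem_simplex_iff hu i y).2 hy
  have hγ : 0 ≤ gamma α t F v := (inv_pos.2 (h.sigma_pos i.pos hvU)).le
  have hgj : gapWeight α t v j = gapWeight α t u j := by
    simp only [gapWeight, hv, j, gap_update_of_ne u i y hne.1 hne.2.1,
      gap_update_of_ne u i y hne.2.2.1 hne.2.2.2]
  have hγb : |gamma α t F v| ≤ (ε ^ 2)⁻¹ / gapWeight α t u j := by
    rw [abs_of_nonneg hγ, le_div_iff₀ hwj, ← hgj]
    exact h.gamma_mul_gapWeight_le hvU j
  have hwi : gapWeight α t v i = (nextTime t u i - y) ^ α * (y - prevTime u i) ^ α := by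
    rw [gapWeight, hv, gap_update_val, gap_update_val_succ]
  have hwi0 := gapWeight_pos (α := α) hvU i
  rw [ibpTerm, weight_eq_gapWeight hvU, ← hwi]
  have := abs_mul_le_mul (abs_mul_le_mul (h.bound v hvU) (abs_mul_le_mul
    (abs_mul_le_mul (h.bound_D i v hvU) (h.bound_right v hvU)) hγb))
    (le_of_eq (abs_of_pos hwi0))
  rwa [show φ (F v) * (D i F v * G v * gamma α t F v) * gapWeight α t v i
    = φ (F v) * (gapWeight α t v i * D i F v * G v * gamma α t F v) by ring] at this

/-- Fundamental theorem of calculus on an open interval: `ibpTerm` tends to `0` at both ends because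
`π_i` does, as `α > 0`. -/
theorem IsIBPPair.setIntegral_ibpDeriv_slice (h : IsIBPPair t C ε φ F G) (hα : 0 < α)
    (hn : 4 ≤ n) {u : Fin n → ℝ} (hu : u ∈ simplex n t) (i : Fin n) :
    ∫ y in Ioo (prevTime u i) (nextTime t u i),
      ibpDeriv α t φ F G i (Function.update u i y) = 0 := by
  set p := prevTime u i
  set r := nextTime t u i
  have hpr : p < r := (mem_Ioo_of_mem_simplex hu i).1.trans (mem_Ioo_of_mem_simplex hu i).2
  by_cases hInt : IntegrableOn (fun y => ibpDeriv α t φ F G i (Function.update u i y)) (Ioo p r)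
  · obtain ⟨M, hM⟩ := h.abs_ibpTerm_update_le (α := α) hn hu i
    have hcont : Continuous fun y : ℝ => M * ((r - y) ^ α * (y - p) ^ α) := by
      refine continuous_const.mul (Continuous.mul ?_ ?_)
      · exact (continuous_const.sub continuous_id).rpow_const fun _ => Or.inr hα.le
      · exact (continuous_id.sub continuous_const).rpow_const fun _ => Or.inr hα.le
    have hlim : ∀ z, (z = p ∨ z = r) → ∀ l ≤ 𝓝 z, Ioo p r ∈ l →
        Tendsto (fun y => ibpTerm α t φ F G i (Function.update u i y)) l (𝓝 0) := by
      intro z hz l hl hmem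
      have h0 : M * ((r - z) ^ α * (z - p) ^ α) = 0 := by
        rcases hz with rfl | rfl <;> simp [Real.zero_rpow hα.ne']
      have h1 := (hcont.tendsto z).mono_left hl
      rw [h0] at h1
      refine squeeze_zero_norm' ?_ h1
      filter_upwards [hmem] with y hy using hM y hy
    have := intervalIntegral.integral_eq_sub_of_hasDerivAt_of_tendsto
      (f := fun y => ibpTerm α t φ F G i (Function.update u i y))
      (f' := fun y => ibpDeriv α t φ F G i (Function.update u i y)) hpr
      (fun y hy => by
        have := h.hasDerivAt_ibpTerm (α := α) ((update_mem_simplex_iff hu i y).2 hy) i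
        simpa only [Function.update_idem, Function.update_self] using this)
      ((intervalIntegrable_iff_integrableOn_Ioo_of_le hpr.le).2 hInt)
      (hlim p (Or.inl rfl) _ nhdsWithin_le_nhds (Ioo_mem_nhdsGT hpr))
      (hlim r (Or.inr rfl) _ nhdsWithin_le_nhds (Ioo_mem_nhdsLT hpr))
    rw [intervalIntegral.integral_of_le hpr.le, integral_Ioc_eq_integral_Ioo, sub_zero] at this
    exact this
  -- A slice on which the derivative is not integrable has integral `0` by convention.
  · exact integral_undef hInt

/-- Fubini with coordinate `i` split off: a line in that direction either misses the simplex or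
meets it in the interval of `hslice`. -/
theorem setIntegral_simplex_eq_zero_of_slices {m : ℕ} {t : ℝ} {f : (Fin (m + 1) → ℝ) → ℝ}
    (hf : IntegrableOn f (simplex (m + 1) t)) (i : Fin (m + 1))
    (hslice : ∀ u ∈ simplex (m + 1) t, ∫ y in Ioo (prevTime u i) (nextTime t u i),
      f (Function.update u i y) = 0) :
    ∫ u in simplex (m + 1) t, f u = 0 := by
  have hU : MeasurableSet (simplex (m + 1) t) := (isOpen_simplex _ _).measurableSet
  rw [← integral_indicator hU]
  have hmp := (volume_preserving_piFinSuccAbove (fun _ : Fin (m + 1) => ℝ) i).symm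
  rw [← hmp.integral_comp', Measure.volume_eq_prod, integral_prod_symm]
  · refine integral_eq_zero_of_ae (Eventually.of_forall fun v => ?_)
    simp only [Pi.zero_apply]
    by_cases hv : ∃ y₀, i.insertNth y₀ v ∈ simplex (m + 1) t
    · obtain ⟨y₀, hy₀⟩ := hv
      have hup : ∀ y, (i.insertNth y v : Fin (m + 1) → ℝ)
          = Function.update (i.insertNth y₀ v) i y := fun y => by
        rw [Fin.update_insertNth]
      rw [← hslice _ hy₀, ← integral_indicator measurableSet_Ioo]
      refine integral_congr_ae (Eventually.of_forall fun y => ?_)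
      change (simplex (m + 1) t).indicator f (i.insertNth y v) = _
      rw [hup y]
      by_cases hy : y ∈ Ioo (prevTime (i.insertNth y₀ v : Fin (m + 1) → ℝ) i)
          (nextTime t (i.insertNth y₀ v : Fin (m + 1) → ℝ) i)
      · rw [indicator_of_mem hy, indicator_of_mem ((update_mem_simplex_iff hy₀ i y).2 hy)]
      · rw [indicator_of_notMem hy, indicator_of_notMem
          (fun h' => hy ((update_mem_simplex_iff hy₀ i y).1 h'))]
    · push Not at hv
      refine integral_eq_zero_of_ae (Eventually.of_forall fun y => ?_)
      exact indicator_of_notMem (hv y) _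
  · have := (integrable_indicator_iff hU).2 hf
    exact (hmp.integrable_comp_emb (MeasurableEquiv.measurableEmbedding _)).2 this

theorem IsIBPPair.setIntegral_ibpDeriv (h : IsIBPPair t C ε φ F G) (hα : 0 < α) (hn : 4 ≤ n)
    (i : Fin n) (hInt : IntegrableOn (ibpDeriv α t φ F G i) (simplex n t)) :
    ∫ u in simplex n t, ibpDeriv α t φ F G i u = 0 := by
  obtain ⟨m, rfl⟩ : ∃ m, n = m + 1 := ⟨n - 1, by omega⟩
  exact setIntegral_simplex_eq_zero_of_slices hInt i fun u hu =>
    h.setIntegral_ibpDeriv_slice hα hn hu i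

end IntegrationByParts

end JumpDiffusion

namespace JumpDiffusion

open Filter Topology

/-! ### Joint measurability in the jump times and the marks -/

section Measurability

variable {n : ℕ} {A : Type*} [MeasurableSpace A] {U : Set (Fin n → ℝ)}
  {f h : A → (Fin n → ℝ) → ℝ}

/-- `(a, u) ↦ f a u` agrees with a measurable function when `u ∈ U`. -/
def MeasurableFamily (U : Set (Fin n → ℝ)) (f : A → (Fin n → ℝ) → ℝ) : Prop :=
  ∃ f' : A × (Fin n → ℝ) → ℝ, Measurable f' ∧ ∀ a, ∀ u ∈ U, f a u = f' (a, u)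

theorem MeasurableFamily.congr (hf : MeasurableFamily U f) (hfh : ∀ a, ∀ u ∈ U, h a u = f a u) :
    MeasurableFamily U h := by
  obtain ⟨f', hf', e⟩ := hf
  exact ⟨f', hf', fun a u hu => (hfh a u hu).trans (e a u hu)⟩

theorem MeasurableFamily.add (hf : MeasurableFamily U f) (hh : MeasurableFamily U h) :
    MeasurableFamily U fun a u => f a u + h a u := by
  obtain ⟨f', hf', e⟩ := hf
  obtain ⟨h', hh', e'⟩ := hh
  exact ⟨_, hf'.add hh', fun a u hu => by simp [e a u hu, e' a u hu]⟩

theorem MeasurableFamily.mul (hf : MeasurableFamily U f) (hh : MeasurableFamily U h) :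
    MeasurableFamily U fun a u => f a u * h a u := by
  obtain ⟨f', hf', e⟩ := hf
  obtain ⟨h', hh', e'⟩ := hh
  exact ⟨_, hf'.mul hh', fun a u hu => by simp [e a u hu, e' a u hu]⟩

theorem MeasurableFamily.comp {φ : ℝ → ℝ} (hf : MeasurableFamily U f) (hφ : Measurable φ) :
    MeasurableFamily U fun a u => φ (f a u) := by
  obtain ⟨f', hf', e⟩ := hf
  exact ⟨_, hφ.comp hf', fun a u hu => by simp [e a u hu]⟩

theorem MeasurableFamily.sum {ι : Type*} (s : Finset ι) {f : ι → A → (Fin n → ℝ) → ℝ}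
    (hf : ∀ i, MeasurableFamily U (f i)) :
    MeasurableFamily U fun a u => ∑ i ∈ s, f i a u := by
  choose f' hf' e using hf
  exact ⟨fun p => ∑ i ∈ s, f' i p, Finset.measurable_fun_sum s fun i _ => hf' i,
    fun a u hu => Finset.sum_congr rfl fun i _ => e i a u hu⟩

theorem measurableFamily_of_measurable {k : (Fin n → ℝ) → ℝ} (hk : Measurable k) :
    MeasurableFamily U fun (_ : A) => k :=
  ⟨_, hk.comp measurable_snd, fun _ _ _ => rfl⟩

theorem MeasurableFamily.of_tendsto (hU : MeasurableSet U) {f' : ℕ → A × (Fin n → ℝ) → ℝ}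
    (hf' : ∀ k, Measurable (f' k))
    (hlim : ∀ a, ∀ u ∈ U, Tendsto (fun k => f' k (a, u)) atTop (𝓝 (f a u))) :
    MeasurableFamily U f := by
  have hUU : MeasurableSet (Prod.snd ⁻¹' U : Set (A × (Fin n → ℝ))) := measurable_snd hU
  refine ⟨(Prod.snd ⁻¹' U).indicator fun p => f p.1 p.2,
    measurable_of_tendsto_metrizable (fun k => (hf' k).indicator hUU) ?_, fun a u hu => ?_⟩
  · rw [tendsto_pi_nhds]
    rintro ⟨a, u⟩
    by_cases hu : u ∈ U
    · have : (a, u) ∈ (Prod.snd ⁻¹' U : Set (A × (Fin n → ℝ))) := hu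
      simp only [indicator_of_mem this]
      exact hlim a u hu
    · have : (a, u) ∉ (Prod.snd ⁻¹' U : Set (A × (Fin n → ℝ))) := hu
      simp only [indicator_of_notMem this]
      exact tendsto_const_nhds
  · have : (a, u) ∈ (Prod.snd ⁻¹' U : Set (A × (Fin n → ℝ))) := hu
    rw [indicator_of_mem this]

theorem tendsto_add_inv_nat (x : ℝ) :
    Tendsto (fun k : ℕ => x + ((k : ℝ) + 1)⁻¹) atTop (𝓝[≠] x) := by
  refine tendsto_nhdsWithin_iff.2 ⟨?_, Eventually.of_forall fun k => ?_⟩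
  · have := (tendsto_one_div_add_atTop_nhds_zero_nat (𝕜 := ℝ)).const_add x
    simpa using this
  · have : (0 : ℝ) < ((k : ℝ) + 1)⁻¹ := by positivity
    simp [this.ne']

theorem measurable_update_left (i : Fin n) (s : ℝ) :
    Measurable fun u : Fin n → ℝ => Function.update u i (u i + s) := by
  refine measurable_pi_lambda _ fun j => ?_
  by_cases h : j = i
  · subst h
    have hj : Measurable fun u : Fin n → ℝ => u j := measurable_pi_apply j
    simpa using hj.add_const s
  · simpa [h] using measurable_pi_apply j

/-- The derivative is a limit of difference quotients with steps `1 / (k + 1)`. As `U` is open, the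
shifted point eventually lies in `U`, where the measurable version may be used. -/
theorem MeasurableFamily.D (hUo : IsOpen U) (hf : MeasurableFamily U f) (i : Fin n)
    (hd : ∀ a, ∀ u ∈ U, DifferentiableAt ℝ (fun y => f a (Function.update u i y)) (u i)) :
    MeasurableFamily U fun a => D i (f a) := by
  obtain ⟨f', hf', e⟩ := hf
  refine MeasurableFamily.of_tendsto hUo.measurableSet
    (f' := fun k p => (((k : ℝ) + 1)⁻¹)⁻¹ *
      (f' (p.1, Function.update p.2 i (p.2 i + ((k : ℝ) + 1)⁻¹)) - f' p)) (fun k => ?_) ?_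
  · refine measurable_const.mul ((hf'.comp (measurable_fst.prodMk
      ((measurable_update_left i _).comp measurable_snd))).sub hf')
  · intro a u hu
    have h1 := (hasDerivAt_iff_tendsto_slope.1 (hd a u hu).hasDerivAt).comp
      (tendsto_add_inv_nat (u i))
    refine h1.congr' ?_
    have h2 : ∀ᶠ y in 𝓝 (u i), Function.update u i y ∈ U := by
      have hc : Continuous (Function.update u i) := continuous_const.update i continuous_id
      refine hc.continuousAt.eventually_mem (hUo.mem_nhds ?_)
      rwa [Function.update_eq_self]
    have h3 := ((tendsto_add_inv_nat (u i)).mono_right nhdsWithin_le_nhds).eventually h2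
    filter_upwards [h3] with k hk
    simp only [Function.comp, slope_def_field, Function.update_eq_self]
    rw [e a u hu, e a _ hk, div_eq_inv_mul]
    simp

theorem MeasurableFamily.hasDerivAt (hU : MeasurableSet U) {f : ℝ → A → (Fin n → ℝ) → ℝ}
    (hf : ∀ y, MeasurableFamily U (f y)) {x : ℝ}
    (hd : ∀ a, ∀ u ∈ U, HasDerivAt (fun y => f y a u) (h a u) x) : MeasurableFamily U h := by
  choose f' hf' e using hf
  refine MeasurableFamily.of_tendsto hU
    (f' := fun k p => (((k : ℝ) + 1)⁻¹)⁻¹ * (f' (x + ((k : ℝ) + 1)⁻¹) p - f' x p))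
    (fun k => measurable_const.mul ((hf' _).sub (hf' _))) ?_
  intro a u hu
  have h1 := (hasDerivAt_iff_tendsto_slope.1 (hd a u hu)).comp (tendsto_add_inv_nat x)
  refine h1.congr fun k => ?_
  simp only [Function.comp, slope_def_field]
  rw [e _ a u hu, e _ a u hu, div_eq_inv_mul]
  simp

theorem MeasurableFamily.aestronglyMeasurable (hU : MeasurableSet U) (hf : MeasurableFamily U f)
    (μA : Measure A) [SFinite μA] :
    AEStronglyMeasurable (fun p : A × (Fin n → ℝ) => f p.1 p.2)
      (μA.prod (volume.restrict U)) := by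
  obtain ⟨f', hf', e⟩ := hf
  refine hf'.aestronglyMeasurable.congr ?_
  filter_upwards [(Measure.quasiMeasurePreserving_snd (μ := μA)
    (ν := volume.restrict U)).ae (ae_restrict_mem hU)] with p hp
  exact (e p.1 p.2 hp).symm

theorem ae_prod_restrict_mem (hU : MeasurableSet U) (μA : Measure A) [SFinite μA] :
    ∀ᵐ p ∂(μA.prod ((volume : Measure (Fin n → ℝ)).restrict U)), p.2 ∈ U :=
  (Measure.quasiMeasurePreserving_snd (μ := μA)
    (ν := volume.restrict U)).ae (ae_restrict_mem hU)

end Measurability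

/-! ### Integration by parts with marks -/

section Marks

variable {n : ℕ} {A : Type*} [MeasurableSpace A] {α t C ε : ℝ} {F G : A → (Fin n → ℝ) → ℝ}
  {φ : ℝ → ℝ}

theorem measurable_gapWeight (α t : ℝ) (j : ℕ) :
    Measurable fun u : Fin n → ℝ => gapWeight α t u j :=
  ((continuous_gap _).measurable.pow_const _).mul ((continuous_gap _).measurable.pow_const _)

theorem measurable_gapWeightDeriv (α t : ℝ) (i j : ℕ) :
    Measurable fun u : Fin n → ℝ => gapWeightDeriv α t u i j :=
  ((measurable_const.mul ((continuous_gap _).measurable.pow_const _)).mul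
    ((continuous_gap _).measurable.pow_const _)).add
    (((continuous_gap _).measurable.pow_const _).mul
      (measurable_const.mul ((continuous_gap _).measurable.pow_const _)))

theorem measurableFamily_ibpDeriv (h : ∀ a, IsIBPPair t C ε φ (F a) (G a)) (hφ : Measurable φ)
    (hF : MeasurableFamily (simplex n t) F) (hG : MeasurableFamily (simplex n t) G) (i : Fin n) :
    MeasurableFamily (simplex n t) fun a => ibpDeriv α t φ (F a) (G a) i := by
  have hUo := isOpen_simplex n t
  have hDF : ∀ j, MeasurableFamily (simplex n t) fun a => D j (F a) := fun j =>
    hF.D hUo j fun a u hu => (hasDerivAt_D ((h a).differentiableAt u hu) j).differentiableAt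
  have hDDF : MeasurableFamily (simplex n t) fun a => D i (D i (F a)) :=
    (hDF i).D hUo i fun a u hu =>
      (hasDerivAt_D ((h a).differentiableAt_D i u hu) i).differentiableAt
  have hDG : MeasurableFamily (simplex n t) fun a => D i (G a) :=
    hG.D hUo i fun a u hu =>
      (hasDerivAt_D ((h a).differentiableAt_right u hu) i).differentiableAt
  have hw : ∀ j : Fin n, MeasurableFamily (A := A) (simplex n t)
      fun _ u => weight α t j u (u j) := fun j =>
    (measurableFamily_of_measurable (measurable_gapWeight α t j)).congr fun _ u hu =>
      weight_eq_gapWeight hu j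
  have hw' : MeasurableFamily (A := A) (simplex n t) fun _ u => deriv (weight α t i u) (u i) :=
    (measurableFamily_of_measurable (measurable_gapWeightDeriv α t i i)).congr fun _ u hu =>
      deriv_weight hu i
  have hγ : MeasurableFamily (simplex n t) fun a => gamma α t (F a) :=
    (MeasurableFamily.sum Finset.univ fun j => ((hw j).mul (hDF j)).mul (hDF j)).comp
      measurable_inv
  have hDγ : MeasurableFamily (simplex n t) fun a => D i (gamma α t (F a)) :=
    hγ.D hUo i fun a u hu => ((h a).hasDerivAt_gamma hu i).differentiableAt
  have hφ' := hF.comp (measurable_deriv φ)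
  exact ((hφ'.mul (hDF i)).mul ((((hw i).mul (hDF i)).mul hG).mul hγ)).add
    ((hF.comp hφ).mul ((((((hw'.mul (hDF i)).mul hG).mul hγ).add
      (((((hw i).mul hDDF).mul hG).mul hγ))).add
      ((((hw i).mul (hDF i)).mul hDG).mul hγ)).add ((((hw i).mul (hDF i)).mul hG).mul hDγ)))

/-- `φ'(F) G` is bounded and each `ibpDeriv` is dominated by `singularBound`, uniformly in the
marks. Integrability of `φ(F) H` is then read off from the divergence identity, and Fubini over the
marks gives equality of the integrals. -/
theorem integrable_ibp (h : ∀ a, IsIBPPair t C ε φ (F a) (G a)) (hφ : ContDiff ℝ 1 φ)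
    (hF : MeasurableFamily (simplex n t) F) (hG : MeasurableFamily (simplex n t) G)
    (hα : α ∈ Ioo (0 : ℝ) (1 / 2)) (ht : 0 ≤ t) (hn : 4 ≤ n)
    (μA : Measure A) [IsFiniteMeasure μA] :
    Integrable (fun p : A × (Fin n → ℝ) => deriv φ (F p.1 p.2) * G p.1 p.2)
      (μA.prod (volume.restrict (simplex n t))) ∧
    Integrable (fun p : A × (Fin n → ℝ) => φ (F p.1 p.2) * H α t (F p.1) (G p.1) p.2)
      (μA.prod (volume.restrict (simplex n t))) ∧
    ∫ p : A × (Fin n → ℝ), deriv φ (F p.1 p.2) * G p.1 p.2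
        ∂(μA.prod (volume.restrict (simplex n t))) =
      ∫ p : A × (Fin n → ℝ), φ (F p.1 p.2) * H α t (F p.1) (G p.1) p.2
        ∂(μA.prod (volume.restrict (simplex n t))) := by
  have hU : MeasurableSet (simplex n t) := (isOpen_simplex n t).measurableSet
  have : IsFiniteMeasure (volume.restrict (simplex n t)) :=
    ⟨by rw [Measure.restrict_apply_univ]; exact (isBounded_simplex n t).measure_lt_top⟩
  have hae := ae_prod_restrict_mem hU μA
  set ν := μA.prod ((volume : Measure (Fin n → ℝ)).restrict (simplex n t))
  have hleft : Integrable (fun p : A × (Fin n → ℝ) => deriv φ (F p.1 p.2) * G p.1 p.2) ν := by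
    refine Integrable.of_bound (((hF.comp (measurable_deriv φ)).mul hG).aestronglyMeasurable hU μA)
      (C * C) ?_
    filter_upwards [hae] with p hp
    exact abs_mul_le_mul ((h p.1).bound_deriv _ hp) ((h p.1).bound_right _ hp)
  have hterm : ∀ i, Integrable (fun p : A × (Fin n → ℝ) =>
      ibpDeriv α t φ (F p.1) (G p.1) i p.2) ν := by
    intro i
    have hB : Integrable (fun p : A × (Fin n → ℝ) =>
        ibpConst n α t C ε * singularBound α t p.2) ν :=
      ((integrableOn_singularBound hα ht hn).const_mul _).comp_snd μA
    refine hB.mono' ((measurableFamily_ibpDeriv h hφ.continuous.measurable hF hG i).aestronglyMeasurable hU μA) ?_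
    filter_upwards [hae] with p hp
    exact (h p.1).abs_ibpDeriv_le hα hn hp i
  have hzero : ∀ i, ∫ p, ibpDeriv α t φ (F p.1) (G p.1) i p.2 ∂ν = 0 := by
    intro i
    rw [integral_prod _ (hterm i)]
    refine integral_eq_zero_of_ae ?_
    filter_upwards [(hterm i).prod_right_ae] with a ha
    exact (h a).setIntegral_ibpDeriv hα.1 hn i ha
  have hsum := integrable_finsetSum Finset.univ fun i _ => hterm i
  have heq : (fun p : A × (Fin n → ℝ) => φ (F p.1 p.2) * H α t (F p.1) (G p.1) p.2) =ᵐ[ν]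
      fun p => deriv φ (F p.1 p.2) * G p.1 p.2
        - ∑ i, ibpDeriv α t φ (F p.1) (G p.1) i p.2 := by
    filter_upwards [hae] with p hp
    rw [(h p.1).sum_ibpDeriv (by omega) hp]
    ring
  refine ⟨hleft, (hleft.sub hsum).congr heq.symm, ?_⟩
  rw [integral_congr_ae heq, integral_sub hleft hsum, integral_finsetSum _ fun i _ => hterm i]
  simp [hzero]

end Marks

end JumpDiffusion

namespace JumpDiffusion

open Filter Topology

/-! ### The deterministic equation as an integration by parts pair -/

section Model

variable {T K : ℝ} {c : ℝ → ℝ → ℝ → ℝ} {g Φ : ℝ → ℝ → ℝ} {n : ℕ}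

/-- Carathéodory: continuous in `(t, x)` and measurable in `a`. Time is clamped to make the function
globally defined and continuous. -/
theorem RegularCoefficients.measurable_jump (h : RegularCoefficients T K c g) (hT : 0 ≤ T) :
    Measurable fun z : (ℝ × ℝ) × ℝ => c (max 0 (min z.1.1 T)) z.2 z.1.2 := by
  have hclamp : Continuous fun p : ℝ × ℝ => ((max 0 (min p.1 T), p.2) : ℝ × ℝ) := by fun_prop
  have hcont : ∀ a, Continuous fun p : ℝ × ℝ => c (max 0 (min p.1 T)) a p.2 := fun a =>
    (h.differentiable_c a).continuousOn.comp_continuous hclamp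
      fun p => ⟨clamp_mem_Icc hT _, trivial⟩
  exact measurable_uncurry_of_continuous_of_measurable
    (u := fun (p : ℝ × ℝ) (a : ℝ) => c (max 0 (min p.1 T)) a p.2) hcont
    fun p => h.measurable_c _ (clamp_mem_Icc hT _) p.2

theorem measurable_clamp_of_continuousOn {f : ℝ → ℝ → ℝ} (hT : 0 ≤ T)
    (hf : ContinuousOn (fun p : ℝ × ℝ => f p.1 p.2) (Icc 0 T ×ˢ univ)) :
    Measurable fun p : ℝ × ℝ => f (max 0 (min p.1 T)) p.2 := by
  have hclamp : Continuous fun p : ℝ × ℝ => ((max 0 (min p.1 T), p.2) : ℝ × ℝ) := by fun_prop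
  exact (hf.comp_continuous hclamp fun p => ⟨clamp_mem_Icc hT _, trivial⟩).measurable

theorem RegularCoefficients.measurableFamily_straight (h : RegularCoefficients T K c g)
    (hT : 0 < T) (hΦ : IsFlow T (extendDrift T g) Φ) {U : Set (Fin n → ℝ)}
    (hU : ∀ u ∈ U, ∀ i, u i ∈ Ioo 0 T) (x : ℝ) (k : ℕ) :
    MeasurableFamily U fun a u => straight c Φ x u a k := by
  have hg := h.smoothDrift hT
  have hflow := measurable_clamp_of_continuousOn hT.le (hΦ.continuousOn hg)
  have hinv := measurable_clamp_of_continuousOn hT.le (hΦ.continuousOn_flowInv hg)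
  induction k with
  | zero => exact ⟨_, measurable_const, fun _ _ _ => rfl⟩
  | succ k ih =>
    by_cases hk : k < n
    · obtain ⟨f, hf, e⟩ := ih
      have hu : Measurable fun p : (Fin n → ℝ) × (Fin n → ℝ) => p.2 ⟨k, hk⟩ :=
        (measurable_pi_apply _).comp measurable_snd
      have ha : Measurable fun p : (Fin n → ℝ) × (Fin n → ℝ) => p.1 ⟨k, hk⟩ :=
        (measurable_pi_apply _).comp measurable_fst
      have hz := hflow.comp (hu.prodMk hf)
      have hz' := hz.add ((h.measurable_jump hT.le).comp ((hu.prodMk hz).prodMk ha))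
      refine ⟨_, hinv.comp (hu.prodMk hz'), fun a u huU => ?_⟩
      have hmem := clamp_of_mem (Ioo_subset_Icc_self (hU u huU ⟨k, hk⟩))
      simp only [straight_succ x u a hk, jumpMap, e a u huU, Function.comp, hmem]
      simp [hmem]
    · simpa only [straight, dif_neg hk] using ih

theorem simplex_subset_Ioo {t : ℝ} (ht : t ∈ Icc 0 T) {u : Fin n → ℝ} (hu : u ∈ simplex n t)
    (i : Fin n) : u i ∈ Ioo 0 T :=
  ⟨(mem_Ioo_zero_of_mem_simplex hu i).1, (mem_Ioo_zero_of_mem_simplex hu i).2.trans_le ht.2⟩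

theorem IsFlow.detSol_eq_of_mem_simplex (hΦ : IsFlow T (extendDrift T g) Φ)
    (hg : SmoothDrift K (extendDrift T g)) {t : ℝ} (ht : t ∈ Icc 0 T) (x : ℝ)
    (a : Fin n → ℝ) {u : Fin n → ℝ} (hu : u ∈ simplex n t) :
    detSol T c g x u a t = Φ t (straight c Φ x u a n) :=
  hΦ.detSol_eq hg ht x a (strictMono_of_mem_simplex hu) (mem_Ioo_zero_of_mem_simplex hu)

theorem RegularCoefficients.hasDerivAt_flow_straight (h : RegularCoefficients T K c g) (hT : 0 < T)
    (hΦ : IsFlow T (extendDrift T g) Φ) {t : ℝ} (ht : t ∈ Icc 0 T) (x : ℝ) (a : Fin n → ℝ)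
    {u : Fin n → ℝ} (hu : u ∈ simplex n t) :
    HasDerivAt (fun y => Φ t (straight c Φ y u a n))
      (flowDeriv (extendDrift T g) Φ t (straight c Φ x u a n)
        * straightDeriv c (extendDrift T g) Φ x u a n) x := by
  have h1 := hΦ.hasDerivAt_right (h.smoothDrift hT) (straight c Φ x u a n) ht
  exact h1.comp x ((h.smoothJump hT).hasDerivAt_straight hΦ (h.smoothDrift hT)
    (fun i => simplex_subset_Ioo ht hu i) a x n)

theorem RegularCoefficients.hasDerivAt_detSol (h : RegularCoefficients T K c g) (hT : 0 < T)
    (hΦ : IsFlow T (extendDrift T g) Φ) {t : ℝ} (ht : t ∈ Icc 0 T) (x : ℝ) (a : Fin n → ℝ)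
    {u : Fin n → ℝ} (hu : u ∈ simplex n t) :
    HasDerivAt (fun y => detSol T c g y u a t)
      (flowDeriv (extendDrift T g) Φ t (straight c Φ x u a n)
        * straightDeriv c (extendDrift T g) Φ x u a n) x := by
  refine (h.hasDerivAt_flow_straight hT hΦ ht x a hu).congr_of_eventuallyEq
    (Eventually.of_forall fun y => ?_)
  exact hΦ.detSol_eq_of_mem_simplex (h.smoothDrift hT) ht y a hu

theorem RegularCoefficients.measurableFamily_detSol (h : RegularCoefficients T K c g) (hT : 0 < T)
    {t : ℝ} (ht : t ∈ Icc 0 T) (x : ℝ) :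
    MeasurableFamily (simplex n t) fun a u => detSol T c g x u a t := by
  obtain ⟨Φ, hΦ⟩ := (h.smoothDrift hT).exists_isFlow hT.le
  refine ((h.measurableFamily_straight hT hΦ (fun u hu i => simplex_subset_Ioo ht hu i) x n).comp
    (hΦ.continuous_right (h.smoothDrift hT) ht).measurable).congr fun a u hu => ?_
  exact hΦ.detSol_eq_of_mem_simplex (h.smoothDrift hT) ht x a hu

theorem RegularCoefficients.measurableFamily_deriv_detSol (h : RegularCoefficients T K c g)
    (hT : 0 < T) {t : ℝ} (ht : t ∈ Icc 0 T) (x : ℝ) :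
    MeasurableFamily (simplex n t) fun a u => deriv (fun y => detSol T c g y u a t) x := by
  obtain ⟨Φ, hΦ⟩ := (h.smoothDrift hT).exists_isFlow hT.le
  exact MeasurableFamily.hasDerivAt (isOpen_simplex n t).measurableSet
    (fun y => h.measurableFamily_detSol hT ht y)
    fun a u hu => (h.hasDerivAt_detSol hT hΦ ht x a hu).differentiableAt.hasDerivAt

theorem UniformlySmooth.bound_D {A : Type*} {U : Set (Fin n → ℝ)} {f : A → (Fin n → ℝ) → ℝ}
    (hf : UniformlySmooth U f) :
    ∃ C, ∀ a, ∀ u ∈ U, |f a u| ≤ C ∧ DifferentiableAt ℝ (f a) u ∧ ∀ i, |D i (f a) u| ≤ C := by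
  obtain ⟨C, -, hC⟩ := hf.exists_bound
  exact ⟨C, fun a u hu => ⟨(hC a u hu).1, hf.differentiableAt a hu,
    fun i => (abs_D_le (hf.differentiableAt a hu) i).trans (hC a u hu).2⟩⟩

theorem D_congr {U : Set (Fin n → ℝ)} (hU : IsOpen U) {f h : (Fin n → ℝ) → ℝ}
    (hfh : ∀ u ∈ U, f u = h u) {u : Fin n → ℝ} (hu : u ∈ U) (i : Fin n) : D i f u = D i h u := by
  refine Filter.EventuallyEq.deriv_eq ?_
  have hc : Continuous (Function.update u i) := continuous_const.update i continuous_id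
  have := hc.continuousAt.eventually_mem (x := u i) (hU.mem_nhds (by
    rwa [Function.update_eq_self]))
  filter_upwards [this] with y hy
  exact hfh _ hy

/-- With `n` fixed, `F` takes values in one bounded interval for all times and marks, so continuity
of `φ` and `φ'` already gives constants that do not depend on the marks. -/
theorem RegularCoefficients.exists_isIBPPair (h : RegularCoefficients T K c g) (hT : 0 < T)
    {η : ℝ} (hη : 0 < η) (hq : ∀ t ∈ Icc 0 T, ∀ a x, η ≤ |q T c g t a x|)
    (hdx : ∀ t ∈ Icc 0 T, ∀ a x, η ≤ |1 + dxc c t a x|) {t : ℝ} (ht : t ∈ Icc 0 T) (x : ℝ)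
    {φ : ℝ → ℝ} (hφ : ContDiff ℝ 1 φ) :
    ∃ C ε, ∀ a : Fin n → ℝ, IsIBPPair t C ε φ (fun u => detSol T c g x u a t)
      (fun u => deriv (fun y => detSol T c g y u a t) x) := by
  have hg := h.smoothDrift hT
  have hc := h.smoothJump hT
  obtain ⟨Φ, hΦ⟩ := hg.exists_isFlow hT.le
  have hU : ∀ u ∈ simplex n t, ∀ i, u i ∈ Ioo 0 T := fun u hu i => simplex_subset_Ioo ht hu i
  have hUo := isOpen_simplex n t
  have hUb := isBounded_simplex n t
  have hq' : ∀ t ∈ Icc 0 T, ∀ a x, η ≤ |q T c (extendDrift T g) t a x| := fun t ht a x => by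
    rw [q_extendDrift ht]; exact hq t ht a x
  have hs := hc.smooth_straight hΦ hg hU hUb x n
  have hdet : ∀ a, ∀ u ∈ simplex n t, detSol T c g x u a t = Φ t (straight c Φ x u a n) :=
    fun a u hu => hΦ.detSol_eq_of_mem_simplex hg ht x a hu
  have hF : UniformlySmooth (simplex n t) fun a u => detSol T c g x u a t :=
    (hΦ.smooth_comp hg ht hs).congr hUo hdet
  have hDeq : ∀ i a, ∀ u ∈ simplex n t, D i (fun u => detSol T c g x u a t) u =
      flowDeriv (extendDrift T g) Φ t (straight c Φ x u a n)
        * D i (fun u => straight c Φ x u a n) u := fun i a u hu => by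
    rw [D_congr hUo (hdet a) hu i, hc.D_flow_straight hΦ hg hU hUb ht x i a hu]
  have hDF : ∀ i, UniformlySmooth (simplex n t) fun a => D i fun u => detSol T c g x u a t :=
    fun i => ((hΦ.smooth_flowDeriv_comp hg ht hs).mul
      (hc.smooth_D_straight hΦ hg hUo hU hUb x n i)).congr hUo (hDeq i)
  have hG : UniformlySmooth (simplex n t)
      fun a u => deriv (fun y => detSol T c g y u a t) x :=
    ((hΦ.smooth_flowDeriv_comp hg ht hs).mul
      (hc.smooth_straightDeriv hΦ hg hU hUb x n)).congr hUo
      fun a u hu => (h.hasDerivAt_detSol hT hΦ ht x a hu).deriv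
  obtain ⟨C₁, hC₁⟩ := hF.bound_D
  choose C₂ hC₂ using fun i => (hDF i).bound_D
  obtain ⟨C₃, hC₃⟩ := hG.bound_D
  obtain ⟨C₄, hC₄⟩ := (isCompact_Icc (a := -C₁) (b := C₁)).exists_bound_of_continuousOn
    hφ.continuous.continuousOn
  obtain ⟨C₅, hC₅⟩ := (isCompact_Icc (a := -C₁) (b := C₁)).exists_bound_of_continuousOn
    (hφ.continuous_deriv le_rfl).continuousOn
  obtain ⟨ε, hε, hlow⟩ := hc.exists_le_abs_D_straight hΦ hg hη hq' hdx hU hUb x n le_rfl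
  set C := |C₁| + (∑ i, |C₂ i|) + |C₃| + |C₄| + |C₅|
  have hsum : 0 ≤ ∑ i, |C₂ i| := Finset.sum_nonneg fun i _ => abs_nonneg _
  have h1 : C₁ ≤ C := by
    linarith [le_abs_self C₁, abs_nonneg C₃, abs_nonneg C₄, abs_nonneg C₅]
  have h2 : ∀ i, C₂ i ≤ C := fun i => by
    have := Finset.single_le_sum (f := fun i => |C₂ i|) (fun i _ => abs_nonneg _)
      (Finset.mem_univ i)
    linarith [le_abs_self (C₂ i), abs_nonneg C₁, abs_nonneg C₃, abs_nonneg C₄, abs_nonneg C₅]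
  have h3 : C₃ ≤ C := by
    linarith [le_abs_self C₃, abs_nonneg C₁, abs_nonneg C₄, abs_nonneg C₅]
  have h4 : C₄ ≤ C := by
    linarith [le_abs_self C₄, abs_nonneg C₁, abs_nonneg C₃, abs_nonneg C₅]
  have h5 : C₅ ≤ C := by
    linarith [le_abs_self C₅, abs_nonneg C₁, abs_nonneg C₃, abs_nonneg C₄]
  refine ⟨C, Real.exp (-(K * T)) * ε, fun a => ⟨by positivity,
    hφ.differentiable one_ne_zero, fun u hu => ?_, fun u hu => ?_,
    fun u hu => (hC₁ a u hu).2.1, fun i u hu => (hC₂ i a u hu).2.1,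
    fun u hu => (hC₃ a u hu).2.1, fun i u hu => ((hC₁ a u hu).2.2 i).trans h1,
    fun i j u hu => ((hC₂ j a u hu).2.2 i).trans (h2 j),
    fun u hu => (hC₃ a u hu).1.trans h3, fun i u hu => ((hC₃ a u hu).2.2 i).trans h3,
    fun i u hu => ?_⟩⟩
  · exact (hC₄ _ (abs_le.1 (hC₁ a u hu).1)).trans h4
  · exact (hC₅ _ (abs_le.1 (hC₁ a u hu).1)).trans h5
  · rw [hDeq i a u hu, abs_mul, abs_of_pos (flowDeriv_pos _ _)]
    exact mul_le_mul (le_flowDeriv hg _ ht) (hlow i i.2 a u hu) hε.le (flowDeriv_pos _ _).le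

end Model

end JumpDiffusion

namespace JumpDiffusion

open Filter Topology

/-! ### The law of the atoms on the event that there are `n` of them -/

section Poisson

theorem eq_Iio_of_isLowerSet {s : Set ℕ} (hs : IsLowerSet s) {n : ℕ} (h : s.encard = n) :
    s = Iio n := by
  have hfin : s.Finite := finite_of_encard_eq_coe h
  have hcard : ∀ m : ℕ, (Iio m : Set ℕ).encard = m := fun m => by
    rw [← Finset.coe_Iio, encard_coe_eq_coe_finsetCard, Nat.card_Iio]
  have hn : n ∉ s := fun hn => by
    have h1 : (Iio (n + 1) : Set ℕ) ⊆ s := fun m hm => hs (Nat.lt_succ_iff.1 hm) hn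
    have h2 := encard_le_encard h1
    rw [hcard, h] at h2
    exact absurd (Nat.cast_le.1 h2) (by omega)
  refine hfin.eq_of_subset_of_encard_le (fun m hm => ?_) (by rw [hcard, h])
  by_contra hmn
  exact hn (hs (not_lt.1 hmn) hm)

variable {Ω : Type*} {τ Δ : ℕ → Ω → ℝ} {ω : Ω} {t : ℝ} {n : ℕ}

/-- The event that exactly the first `n` times are at most `t`. -/
def exactly (τ : ℕ → Ω → ℝ) (t : ℝ) (n : ℕ) : Set Ω := {ω | ∀ i, τ i ω ≤ t ↔ i < n}

theorem counting_eq (hpos : ∀ i, 0 < τ i ω) : counting τ Δ t ω = {i | τ i ω ≤ t}.encard := by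
  simp only [counting, pointMeasure]
  congr 1
  ext i
  simp [(hpos i).le]

theorem isLowerSet_times (hmono : StrictMono fun i => τ i ω) : IsLowerSet {i | τ i ω ≤ t} :=
  fun _ _ hji hi => (hmono.monotone hji).trans hi

theorem counting_eq_iff (hpos : ∀ i, 0 < τ i ω) (hmono : StrictMono fun i => τ i ω) :
    counting τ Δ t ω = n ↔ ω ∈ exactly τ t n := by
  rw [counting_eq hpos]
  constructor
  · intro h i
    exact Set.ext_iff.1 (eq_Iio_of_isLowerSet (isLowerSet_times hmono) h) i
  · intro h
    have : {i | τ i ω ≤ t} = Iio n := Set.ext h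
    rw [this, ← Finset.coe_Iio, encard_coe_eq_coe_finsetCard, Nat.card_Iio]

/-- The atoms fall in order into the sets `B i`, and there are no others, if and only if each
`B i` has one atom and the rest of the strip has none. -/
theorem forall_mem_iff_pointMeasure (hpos : ∀ i, 0 < τ i ω) (hmono : StrictMono fun i => τ i ω)
    {B : Fin n → Set (ℝ × ℝ)} {l r : Fin n → ℝ} (hB : ∀ i, B i ⊆ Ioc (l i) (r i) ×ˢ univ)
    (hlr : ∀ i j, i < j → r i ≤ l j) (hr : ∀ i, r i ≤ t) :
    (ω ∈ exactly τ t n ∧ ∀ i : Fin n, (τ i ω, Δ i ω) ∈ B i) ↔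
      (pointMeasure τ Δ ((Icc 0 t ×ˢ univ) \ ⋃ i, B i) ω = 0 ∧
        ∀ i, pointMeasure τ Δ (B i) ω = 1) := by
  have hlt : ∀ {i j : Fin n} {p q : ℝ × ℝ}, i < j → p ∈ B i → q ∈ B j → p.1 < q.1 :=
    fun hij hp hq => ((hB _ hp).1.2.trans (hlr _ _ hij)).trans_lt (hB _ hq).1.1
  constructor
  · rintro ⟨hE, hmem⟩
    refine ⟨?_, fun i => ?_⟩
    · rw [pointMeasure, encard_eq_zero, eq_empty_iff_forall_notMem]
      rintro j ⟨hj, hj'⟩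
      have hjn := (hE j).1 hj.1.2
      exact hj' (mem_iUnion.2 ⟨⟨j, hjn⟩, hmem ⟨j, hjn⟩⟩)
    · rw [pointMeasure, encard_eq_one]
      refine ⟨i, ?_⟩
      ext j
      refine ⟨fun hj => ?_, fun hj => by rw [mem_singleton_iff.1 hj]; exact hmem i⟩
      have hjn := (hE j).1 ((hB i hj).1.2.trans (hr i))
      by_contra hne
      rcases lt_or_gt_of_ne (show (⟨j, hjn⟩ : Fin n) ≠ i from
        fun h => hne (congrArg Fin.val h)) with h | h
      · exact lt_irrefl _ (hlt h (hmem ⟨j, hjn⟩) hj)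
      · exact lt_irrefl _ (hlt h hj (hmem ⟨j, hjn⟩))
  · rintro ⟨hrest, hone⟩
    simp only [pointMeasure, encard_eq_one] at hone
    choose e he using hone
    have hmem : ∀ i, (τ (e i) ω, Δ (e i) ω) ∈ B i := fun i => by
      have : e i ∈ {j | (τ j ω, Δ j ω) ∈ B i} := by rw [he]; exact mem_singleton _
      exact this
    -- The boxes are ordered in time, so the indices of their atoms increase. Their range is the
    -- initial segment of length `n`, which forces the atom in `B i` to be the atom of index `i`.
    have hemono : StrictMono e := fun i j hij => hmono.lt_iff_lt.1 (hlt hij (hmem i) (hmem j))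
    have hrange : {i | τ i ω ≤ t} = range e := by
      ext j
      constructor
      · intro hj
        rw [pointMeasure, encard_eq_zero, eq_empty_iff_forall_notMem] at hrest
        have h1 : (τ j ω, Δ j ω) ∈ ⋃ i, B i := by
          by_contra hj'
          exact hrest j ⟨⟨⟨(hpos j).le, hj⟩, trivial⟩, hj'⟩
        obtain ⟨i, hi⟩ := mem_iUnion.1 h1
        have : j ∈ {j | (τ j ω, Δ j ω) ∈ B i} := hi
        rw [he] at this
        exact ⟨i, (mem_singleton_iff.1 this).symm⟩
      · rintro ⟨i, rfl⟩
        exact (hB i (hmem i)).1.2.trans (hr i)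
    have hcard : {i | τ i ω ≤ t}.encard = n := by
      rw [hrange, ← image_univ, hemono.injective.injOn.encard_image]
      simp
    have hIio := eq_Iio_of_isLowerSet (isLowerSet_times hmono) hcard
    have hval : e = Fin.val := by
      refine (hemono.range_inj Fin.val_strictMono).1 ?_
      rw [← hrange, hIio]
      ext j
      simp only [mem_Iio, mem_range]
      exact ⟨fun h => ⟨⟨j, h⟩, rfl⟩, fun ⟨i, hi⟩ => hi ▸ i.2⟩
    exact ⟨Set.ext_iff.1 hIio, fun i => by simpa [hval] using hmem i⟩

/-! ### Probabilities of boxes and the joint law of times and marks -/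

variable [MeasurableSpace Ω] {P : Measure Ω} {μ : Measure ℝ}

theorem IsPoissonPointMeasure.measurableSet_exactly (hN : IsPoissonPointMeasure P μ τ Δ) (t : ℝ)
    (n : ℕ) : MeasurableSet (exactly τ t n) := by
  have : exactly τ t n = ⋂ i, {ω | τ i ω ≤ t ↔ i < n} := by
    ext; simp [exactly]
  rw [this]
  refine MeasurableSet.iInter fun i => ?_
  by_cases h : i < n
  · simp only [h, iff_true]
    exact hN.measurable_time i measurableSet_Iic
  · simp only [h, iff_false, not_le]
    exact hN.measurable_time i measurableSet_Ioi

theorem IsPoissonPointMeasure.counting_ae_eq (hN : IsPoissonPointMeasure P μ τ Δ) (t : ℝ)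
    (n : ℕ) : {ω | counting τ Δ t ω = n} =ᵐ[P] exactly τ t n := by
  filter_upwards [hN.pos, hN.strictMono] with ω h1 h2
  exact propext (counting_eq_iff h1 h2)

theorem measure_Icc_prod_ne_top [IsFiniteMeasure μ] (t : ℝ) :
    ((volume.restrict (Ici (0 : ℝ))).prod μ) (Icc 0 t ×ˢ univ) ≠ ⊤ := by
  rw [Measure.prod_prod]
  exact ENNReal.mul_ne_top ((Measure.restrict_apply_le _ _).trans_lt
    measure_Icc_lt_top).ne (measure_ne_top _ _)

theorem IsPoissonPointMeasure.ae_time_ne [IsProbabilityMeasure P] [IsFiniteMeasure μ]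
    (hN : IsPoissonPointMeasure P μ τ Δ) (t : ℝ) : ∀ᵐ ω ∂P, ∀ i, τ i ω ≠ t := by
  refine ae_all_iff.2 fun i => ?_
  have hzero : ((volume.restrict (Ici (0 : ℝ))).prod μ) ({t} ×ˢ univ) = 0 := by
    rw [Measure.prod_prod]; simp
  have h1 := hN.poisson ({t} ×ˢ univ) ((measurableSet_singleton t).prod MeasurableSet.univ)
    (by rw [hzero]; exact ENNReal.zero_lt_top) 0
  rw [hzero, poissonMeasure_singleton] at h1
  have hmeas : MeasurableSet {ω | τ i ω ≠ t} :=
    (hN.measurable_time i (measurableSet_singleton t)).compl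
  refine (mem_ae_iff_prob_eq_one hmeas).2 (le_antisymm prob_le_one ?_)
  refine le_trans (by rw [h1]; simp) (measure_mono (μ := P)
    (s := {ω | pointMeasure τ Δ ({t} ×ˢ univ) ω = (0 : ℕ)}) fun ω hω => ?_)
  simp only [mem_ofPred_eq, pointMeasure, Nat.cast_zero, encard_eq_zero,
    eq_empty_iff_forall_notMem] at hω
  exact fun h => hω i ⟨h, trivial⟩

/-- By independence this is a product of Poisson masses `exp (-λ)` at `0` and `λ exp (-λ)` at `1`;
the sets partition `A`, so the exponentials combine into one factor that does not depend on the
boxes. -/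
theorem IsPoissonPointMeasure.measure_zero_and_one [IsProbabilityMeasure P] [IsFiniteMeasure μ]
    (hN : IsPoissonPointMeasure P μ τ Δ) {A : Set (ℝ × ℝ)} (hA : MeasurableSet A)
    (hAfin : ((volume.restrict (Ici (0 : ℝ))).prod μ) A ≠ ⊤)
    {B : Fin n → Set (ℝ × ℝ)} (hB : ∀ i, MeasurableSet (B i)) (hBA : ∀ i, B i ⊆ A)
    (hdisj : Pairwise fun i j => Disjoint (B i) (B j)) :
    P {ω | pointMeasure τ Δ (A \ ⋃ i, B i) ω = 0 ∧ ∀ i, pointMeasure τ Δ (B i) ω = 1} =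
      ENNReal.ofReal (Real.exp (-(((volume.restrict (Ici (0 : ℝ))).prod μ) A).toReal)) *
        ∏ i, ((volume.restrict (Ici (0 : ℝ))).prod μ) (B i) := by
  set ν := (volume.restrict (Ici (0 : ℝ))).prod μ
  have hUm : MeasurableSet (⋃ i, B i) := MeasurableSet.iUnion hB
  have hUA : ⋃ i, B i ⊆ A := iUnion_subset hBA
  have hsum : ν (A \ ⋃ i, B i) + ∑ i, ν (B i) = ν A := by
    have hU : ν (⋃ i, B i) = ∑ i, ν (B i) := by rw [measure_iUnion hdisj hB, tsum_fintype]
    rw [← hU, add_comm, measure_add_sdiff hUm.nullMeasurableSet, union_eq_self_of_subset_left hUA]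
  have hBfin : ∀ i, ν (B i) ≠ ⊤ := fun i => measure_ne_top_of_subset (hBA i) hAfin
  have hRfin : ν (A \ ⋃ i, B i) ≠ ⊤ := measure_ne_top_of_subset sdiff_subset hAfin
  let B' : Fin (n + 1) → Set (ℝ × ℝ) := Fin.cons (A \ ⋃ i, B i) B
  let k : Fin (n + 1) → ℕ∞ := Fin.cons 0 fun _ => 1
  have hind := hN.indep (n + 1) B' (fun j => by
      refine Fin.cases ?_ (fun i => ?_) j
      · exact hA.diff hUm
      · exact hB i) (fun i j => by
      refine Fin.cases ?_ (fun i => ?_) i <;> refine Fin.cases ?_ (fun j => ?_) j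
      · simp
      · intro _
        exact disjoint_sdiff_left.mono_right (subset_iUnion B j)
      · intro _
        exact disjoint_sdiff_right.mono_left (subset_iUnion B i)
      · intro hij
        exact hdisj fun h => hij (congrArg Fin.succ h))
  have hprod := hind.measure_inter_preimage_eq_mul Finset.univ (sets := fun j => {k j})
    fun j _ => measurableSet_singleton _
  have hset : {ω | pointMeasure τ Δ (A \ ⋃ i, B i) ω = 0 ∧ ∀ i, pointMeasure τ Δ (B i) ω = 1} =
      ⋂ j ∈ Finset.univ, pointMeasure τ Δ (B' j) ⁻¹' {k j} := by
    ext ω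
    simp [Fin.forall_fin_succ, B', k]
  rw [hset, hprod, Fin.prod_univ_succ]
  have h0 : P (pointMeasure τ Δ (B' 0) ⁻¹' {k 0}) =
      ENNReal.ofReal (Real.exp (-(ν (A \ ⋃ i, B i)).toReal)) := by
    have := hN.poisson (A \ ⋃ i, B i) (hA.diff hUm) hRfin.lt_top 0
    rw [poissonMeasure_singleton] at this
    have h2 : P (pointMeasure τ Δ (A \ ⋃ i, B i) ⁻¹' {0}) = _ := this
    rw [show B' 0 = A \ ⋃ i, B i from rfl, show k 0 = 0 from rfl, h2]
    simp [ENNReal.coe_toNNReal_eq_toReal, ν]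
  have h1 : ∀ i : Fin n, P (pointMeasure τ Δ (B' i.succ) ⁻¹' {k i.succ}) =
      ENNReal.ofReal (Real.exp (-(ν (B i)).toReal)) * ν (B i) := fun i => by
    have := hN.poisson (B i) (hB i) (hBfin i).lt_top 1
    rw [poissonMeasure_singleton] at this
    have h2 : P (pointMeasure τ Δ (B i) ⁻¹' {1}) = _ := this
    rw [show B' i.succ = B i from rfl, show k i.succ = 1 from rfl, h2]
    simp only [pow_one, Nat.factorial_one, Nat.cast_one, div_one]
    rw [ENNReal.ofReal_mul (Real.exp_nonneg _), ENNReal.coe_toNNReal_eq_toReal,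
      ENNReal.ofReal_toReal (hBfin i)]
  rw [h0, Finset.prod_congr rfl fun i _ => h1 i, Finset.prod_mul_distrib, ← mul_assoc,
    ← ENNReal.ofReal_prod_of_nonneg fun i _ => Real.exp_nonneg _,
    ← ENNReal.ofReal_mul (Real.exp_nonneg _), ← Real.exp_sum, ← Real.exp_add, ← hsum,
    ENNReal.toReal_add hRfin (ENNReal.sum_ne_top.2 fun i _ => hBfin i),
    ENNReal.toReal_sum fun i _ => hBfin i, Finset.sum_neg_distrib, neg_add]

/-- The atoms of index less than `n`. -/
def atoms (τ Δ : ℕ → Ω → ℝ) (n : ℕ) (ω : Ω) (i : Fin n) : ℝ × ℝ := (τ i ω, Δ i ω)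

/-- The constant `P(J_t = 0)`. -/
noncomputable def voidProb (μ : Measure ℝ) (t : ℝ) : ENNReal :=
  ENNReal.ofReal
    (Real.exp (-(((volume.restrict (Ici (0 : ℝ))).prod μ) (Icc 0 t ×ˢ univ)).toReal))

theorem voidProb_ne_zero (μ : Measure ℝ) (t : ℝ) : voidProb μ t ≠ 0 :=
  (ENNReal.ofReal_pos.2 (Real.exp_pos _)).ne'

theorem voidProb_ne_top (μ : Measure ℝ) (t : ℝ) : voidProb μ t ≠ ⊤ := ENNReal.ofReal_ne_top

theorem restrict_Ici_prod_apply [SFinite μ] {B : Set (ℝ × ℝ)} (hB : MeasurableSet B)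
    (h : ∀ p ∈ B, 0 ≤ p.1) :
    ((volume.restrict (Ici (0 : ℝ))).prod μ) B = (volume.prod μ) B := by
  rw [← Measure.restrict_univ (μ := μ), Measure.prod_restrict, Measure.restrict_univ,
    Measure.restrict_apply hB, inter_eq_self_of_subset_left]
  exact fun p hp => ⟨h p hp, trivial⟩

theorem IsPoissonPointMeasure.measurable_atoms (hN : IsPoissonPointMeasure P μ τ Δ) (n : ℕ) :
    Measurable (atoms τ Δ n) :=
  measurable_pi_lambda _ fun i => (hN.measurable_time i).prodMk (hN.measurable_mark i)

theorem IsPoissonPointMeasure.measure_atoms_pi [IsProbabilityMeasure P] [IsFiniteMeasure μ]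
    (hN : IsPoissonPointMeasure P μ τ Δ) {B : Fin n → Set (ℝ × ℝ)} {l r : Fin n → ℝ}
    (hBm : ∀ i, MeasurableSet (B i)) (hB : ∀ i, B i ⊆ Ioc (l i) (r i) ×ˢ univ)
    (hlr : ∀ i j, i < j → r i ≤ l j) (hl : ∀ i, 0 ≤ l i) (hr : ∀ i, r i ≤ t) :
    (P.restrict (exactly τ t n)).map (atoms τ Δ n) (univ.pi B) =
      voidProb μ t * ∏ i, (volume.prod μ) (B i) := by
  have hdisj : Pairwise fun i j => Disjoint (B i) (B j) := by
    have key : ∀ i j, i < j → Disjoint (B i) (B j) := fun i j hij =>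
      Set.disjoint_left.2 fun p hp hp' =>
        lt_irrefl _ (((hB _ hp).1.2.trans (hlr _ _ hij)).trans_lt (hB _ hp').1.1)
    intro i j hij
    rcases lt_or_gt_of_ne hij with h | h
    · exact key i j h
    · exact (key j i h).symm
  have hpos : ∀ i, ∀ p ∈ B i, 0 ≤ p.1 := fun i p hp => (hl i).trans (hB i hp).1.1.le
  have h1 := hN.measure_zero_and_one (measurableSet_Icc.prod MeasurableSet.univ)
    (measure_Icc_prod_ne_top t) hBm
    (fun i p hp => ⟨⟨hpos i p hp, (hB i hp).1.2.trans (hr i)⟩, trivial⟩) hdisj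
  simp only [restrict_Ici_prod_apply (hBm _) (hpos _)] at h1
  have hm := MeasurableSet.univ_pi hBm
  rw [Measure.map_apply (hN.measurable_atoms n) hm,
    Measure.restrict_apply (hN.measurable_atoms n hm), voidProb, ← h1]
  refine measure_congr ?_
  filter_upwards [hN.pos, hN.strictMono] with ω hp hmono
  refine propext (Iff.trans ?_ (forall_mem_iff_pointMeasure hp hmono hB hlr hr))
  exact ⟨fun h => ⟨h.2, fun i => h.1 i trivial⟩, fun h => ⟨fun i _ => h.2 i, h.1⟩⟩

theorem prevTime_le_of_monotone {s : Fin n → ℝ} (hs : Monotone s) {i j : Fin n} (hij : i < j) :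
    s i ≤ prevTime s j := by
  have hij' : (i : ℕ) < j := hij
  rw [prevTime, if_neg (by omega)]
  exact hs (Fin.le_def.2 (by simp only; omega))

theorem prevTime_nonneg {s : Fin n → ℝ} (hs : ∀ i, 0 ≤ s i) (i : Fin n) : 0 ≤ prevTime s i := by
  rw [prevTime]
  split_ifs
  · exact le_rfl
  · exact hs _

/-- The times of the points lie in the consecutive intervals with end points `0, s_1, …, s_n`. -/
def orderedBox (s : Fin n → ℝ) : Set (Fin n → ℝ × ℝ) :=
  univ.pi fun i => Ioc (prevTime s i) (s i) ×ˢ univ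

/-- Increasing times can be separated by rationals, one strictly between each time and the next (or
`t`). Countability of the family allows measures to be compared box by box. -/
theorem iUnion_orderedBox (hn : 0 < n) (t : ℝ) :
    ⋃ s : {s : Fin n → ℚ // Monotone s ∧ ∀ i, 0 ≤ s i ∧ (s i : ℝ) < t},
      orderedBox (fun i => ((s.1 i : ℚ) : ℝ)) = {p | (fun i => (p i).1) ∈ simplex n t} := by
  ext p
  simp only [mem_iUnion, orderedBox, Set.mem_pi, mem_univ, forall_const, mem_prod, and_true,
    Subtype.exists, exists_prop]
  constructor
  · rintro ⟨s, ⟨hmono, hs⟩, hp⟩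
    have hmono' : Monotone fun i => (s i : ℝ) := fun i j hij => Rat.cast_le.2 (hmono hij)
    refine (mem_simplex_iff hn _).2 ⟨fun i j hij => ?_, fun i => ⟨?_, ?_⟩⟩
    · exact ((hp i).2.trans (prevTime_le_of_monotone hmono' hij)).trans_lt (hp j).1
    · exact (prevTime_nonneg (fun i => Rat.cast_nonneg.2 (hs i).1) i).trans_lt (hp i).1
    · exact (hp i).2.trans_lt (hs i).2
  · intro hp
    have hp' : (fun i => (p i).1) ∈ simplex n t := hp
    have hmono := strictMono_of_mem_simplex hp'
    have hIoo := mem_Ioo_zero_of_mem_simplex hp'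
    choose s hs1 hs2 using fun i => exists_rat_btwn (mem_Ioo_of_mem_simplex hp' i).2
    have hnext : ∀ i j : Fin n, i < j → nextTime t (fun i => (p i).1) i ≤ (p j).1 := by
      intro i j hij
      have hij' : (i : ℕ) < j := hij
      rw [nextTime, dif_pos (by omega)]
      exact hmono.monotone (Fin.le_def.2 (by simp only; omega))
    have hnext' : ∀ i : Fin n, nextTime t (fun i => (p i).1) i ≤ t := by
      intro i
      rw [nextTime]
      split_ifs
      · exact (hIoo _).2.le
      · exact le_rfl
    refine ⟨s, ⟨fun i j hij => ?_, fun i => ⟨?_, (hs2 i).trans_le (hnext' i)⟩⟩,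
      fun i => ⟨?_, (hs1 i).le⟩⟩
    · rcases hij.eq_or_lt with h | h
      · rw [h]
      · exact_mod_cast ((hs2 i).trans_le (hnext i j h)).le.trans (hs1 j).le
    · exact_mod_cast (hIoo i).1.le.trans (hs1 i).le
    · rw [prevTime]
      split_ifs with h
      · exact (hIoo i).1
      · refine (hs2 _).trans_le (hnext _ _ (Fin.lt_def.2 ?_))
        change (i : ℕ) - 1 < i
        omega

/-- The event only gives times at most `t`; almost surely no atom sits at `t`, since that line has
zero intensity. -/
theorem IsPoissonPointMeasure.ae_mem_simplex [IsProbabilityMeasure P] [IsFiniteMeasure μ]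
    (hN : IsPoissonPointMeasure P μ τ Δ) (hn : 0 < n) (t : ℝ) :
    ∀ᵐ ω ∂P.restrict (exactly τ t n), (fun i : Fin n => τ i ω) ∈ simplex n t := by
  rw [ae_restrict_iff' (hN.measurableSet_exactly t n)]
  filter_upwards [hN.pos, hN.strictMono, hN.ae_time_ne t] with ω hpos hmono hne hω
  exact (mem_simplex_iff hn _).2 ⟨fun i j hij => hmono hij,
    fun i => ⟨hpos i, lt_of_le_of_ne ((hω i).2 i.2) (hne i)⟩⟩

/-- Inside one ordered box, every product set has the right mass by `measure_atoms_pi`, and product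
sets determine the product measure; the countable cover then glues the boxes together. -/
theorem IsPoissonPointMeasure.map_atoms [IsProbabilityMeasure P] [IsFiniteMeasure μ]
    (hN : IsPoissonPointMeasure P μ τ Δ) (hn : 0 < n) (t : ℝ) :
    (P.restrict (exactly τ t n)).map (atoms τ Δ n) =
      voidProb μ t • (Measure.pi fun _ : Fin n => (volume : Measure ℝ).prod μ).restrict
        {p | (fun i => (p i).1) ∈ simplex n t} := by
  set M := (P.restrict (exactly τ t n)).map (atoms τ Δ n) with hM
  set W : Set (Fin n → ℝ × ℝ) := {p | (fun i => (p i).1) ∈ simplex n t} with hW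
  have hWm : MeasurableSet W := by
    have : Measurable fun p : Fin n → ℝ × ℝ => fun i => (p i).1 :=
      measurable_pi_lambda _ fun i => measurable_fst.comp (measurable_pi_apply i)
    exact this (isOpen_simplex n t).measurableSet
  have hMW : M.restrict W = M := by
    refine Measure.restrict_eq_self_of_ae_mem ?_
    exact (ae_map_iff (p := (· ∈ W)) (hN.measurable_atoms n).aemeasurable hWm).2
      (hN.ae_mem_simplex hn t)
  have hc := voidProb_ne_zero μ t
  have hc' := voidProb_ne_top μ t
  -- Dividing by the constant leaves a pure product, the form in which `Measure.pi_eq` identifies a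
  -- measure.
  have hkey : ((voidProb μ t)⁻¹ • M).restrict W =
      (Measure.pi fun _ : Fin n => (volume : Measure ℝ).prod μ).restrict W := by
    rw [hW, ← iUnion_orderedBox hn t, Measure.restrict_iUnion_congr]
    rintro ⟨s, hmono, hs⟩
    have hmono' : Monotone fun i => (s i : ℝ) := fun i j hij => Rat.cast_le.2 (hmono hij)
    rw [orderedBox, Measure.restrict_pi_pi]
    refine (Measure.pi_eq fun B hB => ?_).symm
    have hI : ∀ i, MeasurableSet (Ioc (prevTime (fun i => (s i : ℝ)) i) (s i : ℝ) ×ˢ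
      (univ : Set ℝ)) := fun i => measurableSet_Ioc.prod MeasurableSet.univ
    rw [Measure.restrict_apply (MeasurableSet.univ_pi hB), ← pi_inter_distrib,
      Measure.smul_apply, hM, hN.measure_atoms_pi (fun i => (hB i).inter (hI i))
        (fun i => inter_subset_right) (fun i j hij => prevTime_le_of_monotone hmono' hij)
        (prevTime_nonneg fun i => Rat.cast_nonneg.2 (hs i).1) fun i => (hs i).2.le,
      smul_eq_mul, ← mul_assoc, ENNReal.inv_mul_cancel hc hc', one_mul]
    exact Finset.prod_congr rfl fun i _ => (Measure.restrict_apply (hB i)).symm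
  rw [← hkey, Measure.restrict_smul, smul_smul, ENNReal.mul_inv_cancel hc hc', one_smul, hMW]

theorem IsPoissonPointMeasure.map_marks_times [IsProbabilityMeasure P] [IsFiniteMeasure μ]
    (hN : IsPoissonPointMeasure P μ τ Δ) (hn : 0 < n) (t : ℝ) :
    (P.restrict (exactly τ t n)).map
        (fun ω => ((fun i : Fin n => Δ i ω), fun i : Fin n => τ i ω)) =
      voidProb μ t • (Measure.pi fun _ : Fin n => μ).prod (volume.restrict (simplex n t)) := by
  have h1 := measurePreserving_arrowProdEquivProdArrow ℝ ℝ (Fin n)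
    (fun _ => (volume : Measure ℝ)) fun _ => μ
  have h2 : MeasurePreserving Prod.swap
      ((Measure.pi fun _ : Fin n => (volume : Measure ℝ)).prod (Measure.pi fun _ : Fin n => μ))
      ((Measure.pi fun _ : Fin n => μ).prod (Measure.pi fun _ : Fin n => (volume : Measure ℝ))) :=
    ⟨measurable_swap, Measure.prod_swap⟩
  have hm : MeasurableSet ((univ : Set (Fin n → ℝ)) ×ˢ simplex n t) :=
    MeasurableSet.univ.prod (isOpen_simplex n t).measurableSet
  have h3 := (h2.comp h1).restrict_preimage hm
  have hset : (Prod.swap ∘ (MeasurableEquiv.arrowProdEquivProdArrow ℝ ℝ (Fin n))) ⁻¹'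
      ((univ : Set (Fin n → ℝ)) ×ˢ simplex n t) = {p | (fun i => (p i).1) ∈ simplex n t} := by
    ext p
    exact ⟨fun h => h.2, fun h => ⟨trivial, h⟩⟩
  rw [hset] at h3
  have h4 := congrArg (Measure.map (Prod.swap ∘
    (MeasurableEquiv.arrowProdEquivProdArrow ℝ ℝ (Fin n)))) (hN.map_atoms hn t)
  rw [Measure.map_map h3.measurable (hN.measurable_atoms n), Measure.map_smul, h3.map_eq,
    ← Measure.prod_restrict, Measure.restrict_univ] at h4
  exact h4

end Poisson

end JumpDiffusion

namespace JumpDiffusion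

open Filter Topology

/-! ### Transfer to the jump diffusion -/

theorem RegularCoefficients.eq_detSol {Ω : Type*} {T K : ℝ} {c : ℝ → ℝ → ℝ → ℝ} {g : ℝ → ℝ → ℝ}
    (h : RegularCoefficients T K c g) (hT : 0 < T) {τ Δ : ℕ → Ω → ℝ} {ω : Ω} {t y : ℝ}
    (ht : t ∈ Icc 0 T) {n : ℕ} (hE : ω ∈ exactly τ t n)
    (hu : (fun i : Fin n => τ i ω) ∈ simplex n t) {s : ℝ → ℝ}
    (hs : IsJumpSolution T c g y (fun i => τ i ω) (fun i => Δ i ω) s) :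
    s t = detSol T c g y (fun i : Fin n => τ i ω) (fun i => Δ i ω) t := by
  have hg := h.smoothDrift hT
  obtain ⟨Φ, hΦ⟩ := hg.exists_isFlow hT.le
  rw [hΦ.detSol_eq_of_mem_simplex hg ht y _ hu]
  refine hΦ.eq_of_isJumpSolution hg ht Fin.val_injective ?_ (strictMono_of_mem_simplex hu)
    (fun j => (mem_Ioo_zero_of_mem_simplex hu j).1)
    ((isJumpSolution_extendDrift_iff hT.le).2 hs)
  ext i
  rw [mem_range]
  exact (hE i).trans ⟨fun hi => ⟨⟨i, hi⟩, rfl⟩, fun ⟨j, hj⟩ => hj ▸ j.2⟩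

end JumpDiffusion

theorem proposition3p2 {Ω : Type*} [MeasurableSpace Ω] (P : Measure Ω) [IsProbabilityMeasure P]
    (μ : Measure ℝ) [IsFiniteMeasure μ] (hμ : μ ≠ 0)
    (τ Δ : ℕ → Ω → ℝ) (hN : JumpDiffusion.IsPoissonPointMeasure P μ τ Δ)
    (T K : ℝ) (hT : 0 < T) (c : ℝ → ℝ → ℝ → ℝ) (g : ℝ → ℝ → ℝ)
    (hcg : JumpDiffusion.RegularCoefficients T K c g)
    (η : ℝ) (hη : 0 < η)
    (hq : ∀ t ∈ Icc 0 T, ∀ a x, η ≤ |JumpDiffusion.q T c g t a x|)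
    (hc : ∀ t ∈ Icc 0 T, ∀ a x, η ≤ |1 + JumpDiffusion.dxc c t a x|)
    -- `S y t` is the solution at time `t` of the stochastic equation started at `y`
    (S : ℝ → ℝ → Ω → ℝ)
    (hS : ∀ᵐ ω ∂P, ∀ y, JumpDiffusion.IsJumpSolution T c g y (fun i => τ i ω) (fun i => Δ i ω)
      (fun t => S y t ω))
    (α : ℝ) (hα : α ∈ Ioo (0 : ℝ) (1 / 2))
    (x t : ℝ) (ht : t ∈ Icc 0 T) (n : ℕ) (hn : 4 ≤ n)
    (φ : ℝ → ℝ) (hφ : ContDiff ℝ 1 φ) (hφ_growth : ∃ C, ∀ y, |φ y| ≤ C * (1 + |y|)) :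
    IntegrableOn (fun ω => deriv φ (S x t ω) * deriv (fun y => S y t ω) x)
      {ω | JumpDiffusion.counting τ Δ t ω = n} P ∧
    IntegrableOn (fun ω => φ (S x t ω) * JumpDiffusion.malliavinWeight T c g α x t τ Δ n ω)
      {ω | JumpDiffusion.counting τ Δ t ω = n} P ∧
    ∫ ω in {ω | JumpDiffusion.counting τ Δ t ω = n},
        deriv φ (S x t ω) * deriv (fun y => S y t ω) x ∂P =
      ∫ ω in {ω | JumpDiffusion.counting τ Δ t ω = n},
        φ (S x t ω) * JumpDiffusion.malliavinWeight T c g α x t τ Δ n ω ∂P := by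
  open JumpDiffusion in
  have hn0 : 0 < n := by omega
  obtain ⟨C, ε, hpair⟩ := hcg.exists_isIBPPair (n := n) hT hη hq hc ht x hφ
  obtain ⟨hleft, hright, heq⟩ := integrable_ibp hpair hφ (hcg.measurableFamily_detSol hT ht x)
    (hcg.measurableFamily_deriv_detSol hT ht x) hα ht.1 hn (Measure.pi fun _ : Fin n => μ)
  set Z : Ω → (Fin n → ℝ) × (Fin n → ℝ) := fun ω =>
    ((fun i : Fin n => Δ i ω), fun i : Fin n => τ i ω)
  have hZm : Measurable Z :=
    (measurable_pi_lambda _ fun i : Fin n => hN.measurable_mark i).prodMk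
      (measurable_pi_lambda _ fun i : Fin n => hN.measurable_time i)
  have hmap := hN.map_marks_times hn0 t
  -- The exceptional set does not depend on the starting point, so the two solutions agree as
  -- functions of `y` and their derivatives at `x` agree too.
  have hsol : ∀ᵐ ω ∂P.restrict (exactly τ t n), ∀ y,
      S y t ω = detSol T c g y (Z ω).2 (Z ω).1 t := by
    filter_upwards [ae_restrict_of_ae hS, hN.ae_mem_simplex hn0 t,
      ae_restrict_mem (hN.measurableSet_exactly t n)] with ω h1 h2 h3 y
    exact hcg.eq_detSol hT ht h3 h2 (h1 y)
  have hcountE := Measure.restrict_congr_set (hN.counting_ae_eq t n)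
  let l : (Fin n → ℝ) × (Fin n → ℝ) → ℝ := fun p =>
    deriv φ (detSol T c g x p.2 p.1 t) * deriv (fun y => detSol T c g y p.2 p.1 t) x
  let r : (Fin n → ℝ) × (Fin n → ℝ) → ℝ := fun p => φ (detSol T c g x p.2 p.1 t) *
    H α t (fun u => detSol T c g x u p.1 t) (fun u => deriv (fun y => detSol T c g y u p.1 t) x) p.2
  have h1 : (fun ω => deriv φ (S x t ω) * deriv (fun y => S y t ω) x)
      =ᵐ[P.restrict (exactly τ t n)] fun ω => l (Z ω) := by
    filter_upwards [hsol] with ω hω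
    simp only [hω, l]
  have h2 : (fun ω => φ (S x t ω) * malliavinWeight T c g α x t τ Δ n ω)
      =ᵐ[P.restrict (exactly τ t n)] fun ω => r (Z ω) := by
    filter_upwards [hsol] with ω hω
    simp only [hω, r, malliavinWeight, Z]
  have hleft' := hleft.smul_measure (voidProb_ne_top μ t)
  have hright' := hright.smul_measure (voidProb_ne_top μ t)
  rw [← hmap] at hleft' hright'
  simp only [IntegrableOn, hcountE]
  refine ⟨(hleft'.comp_measurable hZm).congr h1.symm, (hright'.comp_measurable hZm).congr h2.symm,
    ?_⟩
  rw [integral_congr_ae h1, integral_congr_ae h2,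
    ← integral_map hZm.aemeasurable hleft'.aestronglyMeasurable,
    ← integral_map hZm.aemeasurable hright'.aestronglyMeasurable, hmap, integral_smul_measure,
    integral_smul_measure, heq]
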